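/- Let $\mathbb{F}_q$ be a finite field of odd characteristic $p$, let $K=\mathbb{F}_q(t)$, let $d\ge 1$ be an integer coprime to $q$, and let $E_d/K$ be the elliptic curve $$E_d:\quad y^2=x\,(x^2+t^{2d}x-4t^{2d}).$$ For a place $v$ of $K$ with residue field $\mathbb{F}_v$, put $q_v=|\mathbb{F}_v|$, $\deg v=[\mathbb{F}_v:\mathbb{F}_q]$ and $a_v=q_v+1-|(\widetilde{E_d})_v(\mathbb{F}_v)|$, where $(\widetilde{E_d})_v$ is the plane cubic obtained by reducing a minimal $v$-integral Weierstrass model of $E_d$. The $L$-function of $E_d/K$ is the power series $$L(E_d/K,T)=\prod_{v\text{ good}}\left(1-a_vT^{\deg v}+q_vT^{2\deg v}\right)^{-1}\prod_{v\text{ bad}}\left(1-a_vT^{\deg v}\right)^{-1},$$ the product being over all places of $K$, of good and of bad reduction; it converges coefficientwise in $\mathbb{Z}[[T]]$. Let $Z_{2d}=\mathbb{Z}/2d\mathbb{Z}\smallsetminus\{0,d/2,d,3d/2\}$ if $d$ is even and $Z_{2d}=\mathbb{Z}/2d\mathbb{Z}\smallsetminus\{0,d\}$ if $d$ is odd, and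 let $\mathcal{O}_q(Z_{2d})$ be the set of orbits of multiplication by $q$ on $Z_{2d}$; write $|\mathbf{n}|$ for the length of an orbit $\mathbf{n}$. Fix a prime ideal $\mathfrak{P}$ above $p$ of the ring $\bar{\mathbb{Z}}$ of algebraic integers in $\bar{\mathbb{Q}}$. Let $\theta:(\bar{\mathbb{Z}}/\mathfrak{P})^\times\to\bar{\mathbb{Q}}^\times$ be the inverse of the isomorphism given by reduction modulo $\mathfrak{P}$ from the group of roots of unity of order prime to $p$ onto $(\bar{\mathbb{Z}}/\mathfrak{P})^\times$, and view finite fields of characteristic $p$ as subfields of $\bar{\mathbb{Z}}/\mathfrak{P}$. For $n\in Z_{2d}$ with orbit $\mathbf{n}$, put $Q=q^{|\mathbf{n}|}$, let $\theta_n=\theta^{(Q-1)n/2d}$ on $\mathbb{F}_Q^\times$, let $\lambda$ be the character of order $2$ of $\mathbb{F}_Q^\times$, and set $$\beta(n)=\theta_n^2(4)\cdot \mathbf{j}(\theta_n,\theta_n)\cdot \mathbf{j}(\lambda\theta_n^2,\theta_n^{-1}),\qquad \mathbf{j}(\chi_1,\chi_2)=-\sum_{x\in\mathbb{F}_Q}\chi_1(x)\chi_2(1-x),$$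 where the (nontrivial) characters are extended by $0$ at $0$. Then $$L(E_d/K,T)=(1-qT)\prod_{\mathbf{n}\in\mathcal{O}_q(Z_{2d})}\left(1-\beta(n)\,T^{|\mathbf{n}|}\right),$$ where $n$ is any representative of the orbit $\mathbf{n}$. In particular, if $2d\mid q-1$ and $\chi:\mathbb{F}_q^\times\to\bar{\mathbb{Q}}^\times$ is any character of exact order $2d$, then $$L(E_d/K,T)=(1-qT)\prod_{\substack{1\le n\le 2d-1\\ n\ne d/2,\,d,\,3d/2}}(1-B(n)\,T),\qquad B(n)=\chi^{2n}(4)\sum_{u\in\mathbb{F}_q}\sum_{v\in\mathbb{F}_q}\chi^n(u(1-u))\,\chi^{2n+d}(v)\,\chi^{-n}(1-v).$$ -/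

import Mathlib

open scoped PowerSeries.WithPiTopology

noncomputable section

namespace KummerL

/-! ### Places of `F(t)` and the `L`-function of a Weierstrass curve over `F(t)` -/

/-- A place of the rational function field `F(t)`: a discrete valuation ring of `F(t)` containing
the field of constants `F`. -/
structure Place (F : Type*) [Field F] where
  /-- The valuation ring of the place. -/
  ring : ValuationSubring (RatFunc F)
  isDVR : IsDiscreteValuationRing ring
  const_mem : ∀ c : F, RatFunc.C c ∈ ring

namespace Place

variable {F : Type*} [Field F] (v : Place F)

instance : IsDiscreteValuationRing v.ring := v.isDVR

/-- The residue field `F_v`. -/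
abbrev residueField : Type _ := IsLocalRing.ResidueField v.ring

/-- The embedding of the constant field `F` into `F_v`. -/
def constHom : F →+* v.residueField :=
  (IsLocalRing.residue v.ring).comp
    ((RatFunc.C : F →+* RatFunc F).codRestrict v.ring.toSubring v.const_mem)

/-- The degree `[F_v : F]` of a place. -/
def degree : ℕ :=
  letI := v.constHom.toAlgebra
  Module.finrank F v.residueField

/-- The number of `F_v`-rational points of the plane projective cubic over `F_v` obtained by
reducing a minimal `v`-integral Weierstrass model: the solutions of the affine equation (singular
or not), and the point at infinity. -/
def numPoints (W : WeierstrassCurve (RatFunc F)) : ℕ :=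
  Nat.card {P : v.residueField × v.residueField //
    ((W.minimal v.ring).reduction v.ring).toAffine.Equation P.1 P.2} + 1

/-- `a_v = |F_v| + 1 - |Ẽ_v(F_v)|`, at places of good and of bad reduction. -/
def trace (W : WeierstrassCurve (RatFunc F)) : ℤ :=
  (Nat.card v.residueField : ℤ) + 1 - (v.numPoints W : ℤ)

open Classical in
/-- The Euler factor at `v`: `(1 - a_v T^deg v + q_v T^(2 deg v))⁻¹` if the reduction is good and
`(1 - a_v T^deg v)⁻¹` if it is bad. -/
def eulerFactor (W : WeierstrassCurve (RatFunc F)) : PowerSeries ℤ :=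
  if (W.minimal v.ring).HasGoodReduction v.ring then
    PowerSeries.invOfUnit
      (1 - PowerSeries.C (v.trace W) * PowerSeries.X ^ v.degree
        + PowerSeries.C (Nat.card v.residueField : ℤ) * PowerSeries.X ^ (2 * v.degree)) 1
  else
    PowerSeries.invOfUnit (1 - PowerSeries.C (v.trace W) * PowerSeries.X ^ v.degree) 1

end Place

/-- The `L`-function of a Weierstrass curve over `F(t)`, as a power series: the product of the Euler
factors over all places, for the topology of coefficientwise (discrete) convergence. -/
def LFunction {F : Type*} [Field F] (W : WeierstrassCurve (RatFunc F)) : PowerSeries ℤ :=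
  ∏' v : Place F, v.eulerFactor W

/-- The curve `E_d : y² = x (x² + t^(2d) x - 4 t^(2d))` over `F(t)`. -/
def curveE (F : Type*) [Field F] (d : ℕ) : WeierstrassCurve (RatFunc F) where
  a₁ := 0
  a₂ := RatFunc.X ^ (2 * d)
  a₃ := 0
  a₄ := -4 * RatFunc.X ^ (2 * d)
  a₆ := 0

/-! ### The action of `q` on `ℤ/2dℤ` -/

/-- The orbit `{n, q n, q² n, …}` of `n`. -/
def orbit (q : ℕ) {D : ℕ} [NeZero D] (n : ZMod D) : Finset (ZMod D) :=
  open Classical in Finset.univ.filter fun m => ∃ k : ℕ, m = (q : ZMod D) ^ k * n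

theorem card_orbit_pos (q : ℕ) {D : ℕ} [NeZero D] (n : ZMod D) : 0 < (orbit q n).card :=
  Finset.card_pos.2 ⟨n, by simpa [orbit] using ⟨0, by simp⟩⟩

/-- The set of orbits of a subset `Z` of `ℤ/Dℤ`. -/
def orbits (q : ℕ) {D : ℕ} [NeZero D] (Z : Finset (ZMod D)) : Finset (Finset (ZMod D)) :=
  Z.image (orbit q)

/-- The set `Z_{2d}`. -/
def indexSet (d : ℕ) [NeZero d] : Finset (ZMod (2 * d)) :=
  if Even d then {0, ((d / 2 : ℕ) : ZMod (2 * d)), (d : ZMod (2 * d)),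
    ((3 * d / 2 : ℕ) : ZMod (2 * d))}ᶜ
  else {0, (d : ZMod (2 * d))}ᶜ

/-! ### The Teichmüller character attached to a prime of `ℤ̄` above `p` -/

/-- An algebraic closure of `ℚ`. -/
abbrev QBar : Type := AlgebraicClosure ℚ

/-- The ring of all algebraic integers. -/
abbrev ZBar : Type := integralClosure ℤ QBar

attribute [local instance] Ideal.Quotient.field

section Teichmuller

variable (p : ℕ) [hp : Fact p.Prime] (P : Ideal ZBar) [P.IsMaximal] [CharP (ZBar ⧸ P) p]

/-- The group of roots of unity in `ℤ̄` of order prime to `p`. -/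
def primeToRoots : Subgroup ZBarˣ where
  carrier := {ζ | ∃ m : ℕ, m.Coprime p ∧ ζ ^ m = 1}
  one_mem' := ⟨1, by simp⟩
  mul_mem' := by
    rintro a b ⟨m, hm, ha⟩ ⟨n, hn, hb⟩
    refine ⟨m * n, Nat.Coprime.mul_left hm hn, ?_⟩
    rw [mul_pow, pow_mul, ha, mul_comm m n, pow_mul b, hb]
    simp
  inv_mem' := by
    rintro a ⟨m, hm, ha⟩
    exact ⟨m, hm, by rw [inv_pow, ha, inv_one]⟩

/-- Reduction modulo `P` on the roots of unity of order prime to `p`. -/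
def reductionHom : primeToRoots p →* (ZBar ⧸ P)ˣ :=
  (Units.map (Ideal.Quotient.mk P : ZBar →* ZBar ⧸ P)).comp (primeToRoots p).subtype

theorem reductionHom_injective : Function.Injective (reductionHom p P) := by
  rw [injective_iff_map_eq_one]
  rintro ⟨ζ, m, hm, hζ⟩ h
  have h1 : Ideal.Quotient.mk P (ζ : ZBar) = 1 := by
    simpa [reductionHom] using congrArg Units.val h
  have hζ' : (ζ : ZBar) ^ m = 1 := by
    rw [← Units.val_pow_eq_pow_val, hζ, Units.val_one]
  by_contra hne
  have hne' : (ζ : ZBar) - 1 ≠ 0 := by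
    intro h0
    apply hne
    ext1
    ext1
    simpa using sub_eq_zero.1 h0
  have hs : ∑ i ∈ Finset.range m, (ζ : ZBar) ^ i = 0 := by
    have := geom_sum_mul (ζ : ZBar) m
    rw [hζ', sub_self] at this
    exact (mul_eq_zero.1 this).resolve_right hne'
  have hm0 : (m : ZBar ⧸ P) = 0 := by
    have := congrArg (Ideal.Quotient.mk P) hs
    simpa [map_sum, h1] using this
  have hdvd := (CharP.cast_eq_zero_iff (ZBar ⧸ P) p m).1 hm0
  exact hp.out.one_lt.ne' (Nat.dvd_one.1 (hm ▸ Nat.dvd_gcd hdvd dvd_rfl))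

theorem reductionHom_surjective : Function.Surjective (reductionHom p P) := by
  intro x
  obtain ⟨m, hm, hx⟩ : ∃ m : ℕ, m.Coprime p ∧ (x : ZBar ⧸ P) ^ m = 1 := by
    let _ : Algebra (ZMod p) (ZBar ⧸ P) := ZMod.algebra _ p
    have hint : IsIntegral ℤ (x : ZBar ⧸ P) := by
      obtain ⟨y, hy⟩ := Ideal.Quotient.mk_surjective (I := P) (x : ZBar ⧸ P)
      rw [← hy]
      have hyi : IsIntegral ℤ y := Algebra.IsIntegral.isIntegral y
      exact hyi.map (Ideal.Quotient.mk P).toIntAlgHom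
    have hint' : IsIntegral (ZMod p) (x : ZBar ⧸ P) := by
      obtain ⟨g, hg, hg0⟩ := hint
      refine ⟨g.map (Int.castRingHom (ZMod p)), hg.map _, ?_⟩
      rw [Polynomial.eval₂_map, RingHom.ext_int ((algebraMap (ZMod p) (ZBar ⧸ P)).comp
        (Int.castRingHom (ZMod p))) (algebraMap ℤ (ZBar ⧸ P))]
      exact hg0
    have := IntermediateField.adjoin.finiteDimensional hint'
    have : Finite (IntermediateField.adjoin (ZMod p) {(x : ZBar ⧸ P)}) :=
      Module.finite_of_finite (ZMod p)
    let _ := Fintype.ofFinite (IntermediateField.adjoin (ZMod p) {(x : ZBar ⧸ P)})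
    let y := IntermediateField.AdjoinSimple.gen (ZMod p) (x : ZBar ⧸ P)
    have hy0 : y ≠ 0 := by
      intro h
      have := congrArg Subtype.val h
      exact x.ne_zero (by simpa [y] using this)
    refine ⟨Fintype.card (IntermediateField.adjoin (ZMod p) {(x : ZBar ⧸ P)}) - 1, ?_, ?_⟩
    · obtain ⟨n, -, hn⟩ :=
        FiniteField.card (IntermediateField.adjoin (ZMod p) {(x : ZBar ⧸ P)}) p
      rw [hn]
      refine Nat.Coprime.symm ((Nat.Prime.coprime_iff_not_dvd hp.out).2 fun h => ?_)
      have h1 : p ∣ p ^ (n : ℕ) := dvd_pow_self p n.ne_zero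
      have h2 := (Nat.dvd_sub_iff_right (Nat.one_le_pow _ _ hp.out.pos) h1).1 h
      exact hp.out.one_lt.ne' (Nat.dvd_one.1 h2)
    · have := congrArg Subtype.val (FiniteField.pow_card_sub_one_eq_one y hy0)
      simpa [y] using this
  have hm0 : 0 < m := by
    rcases Nat.eq_zero_or_pos m with rfl | h
    · exact absurd (Nat.coprime_zero_left p |>.1 hm) hp.out.one_lt.ne'
    · exact h
  have : NeZero m := ⟨hm0.ne'⟩
  obtain ⟨ω, hω⟩ := HasEnoughRootsOfUnity.exists_primitiveRoot QBar m
  have hωi : IsIntegral ℤ ω := hω.isIntegral hm0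
  let ω' : ZBar := ⟨ω, hωi⟩
  have hω' : IsPrimitiveRoot ω' m :=
    IsPrimitiveRoot.of_map_of_injective (f := (integralClosure ℤ QBar).val)
      (by simpa [ω'] using hω) Subtype.val_injective
  have hprod := Polynomial.X_pow_sub_one_eq_prod hm0 hω'
  have hev := congrArg (Polynomial.eval₂ (Ideal.Quotient.mk P) (x : ZBar ⧸ P)) hprod
  rw [Polynomial.eval₂_finsetProd] at hev
  simp only [Polynomial.eval₂_sub, Polynomial.eval₂_pow, Polynomial.eval₂_X,
    Polynomial.eval₂_one, Polynomial.eval₂_C, hx, sub_self] at hev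
  obtain ⟨ξ, hξ, hξx⟩ := Finset.prod_eq_zero_iff.1 hev.symm
  have hξm : ξ ^ m = 1 := (Polynomial.mem_nthRootsFinset hm0 1).1 hξ
  refine ⟨⟨Units.ofPowEqOne ξ m hξm hm0.ne', m, hm, Units.pow_ofPowEqOne hξm hm0.ne'⟩, ?_⟩
  ext1
  simpa [reductionHom] using (sub_eq_zero.1 hξx).symm

/-- The isomorphism between the roots of unity of order prime to `p` in `ℤ̄` and `(ℤ̄/P)ˣ` given by
reduction modulo `P`. -/
def reductionEquiv : primeToRoots p ≃* (ZBar ⧸ P)ˣ :=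
  MulEquiv.ofBijective (reductionHom p P) ⟨reductionHom_injective p P, reductionHom_surjective p P⟩

/-- The Teichmüller character `θ` on `(ℤ̄/P)ˣ`, the inverse of reduction, extended by `θ(0) = 0`. -/
def teichmuller : MulChar (ZBar ⧸ P) QBar :=
  MulChar.ofUnitHom <|
    (Units.map ((integralClosure ℤ QBar).val : ZBar →* QBar)).comp <|
      (primeToRoots p).subtype.comp (reductionEquiv p P).symm.toMonoidHom

/-- The subfield `{x | x ^ (p ^ m) = x}` with `p ^ m` elements of `ℤ̄/P`, which is an algebraic
closure of `𝔽_p`. -/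
def finiteSubfield (m : ℕ) : Subfield (ZBar ⧸ P) :=
  (iterateFrobenius (ZBar ⧸ P) p m).eqLocusField (RingHom.id _)

instance finite_finiteSubfield (m : ℕ) [NeZero m] : Finite (finiteSubfield p P m) := by
  have h1 : 1 < p ^ m := Nat.one_lt_pow (NeZero.ne m) hp.out.one_lt
  refine Set.Finite.subset (Polynomial.rootSet_finite
    (Polynomial.X ^ (p ^ m) - Polynomial.X : Polynomial (ZBar ⧸ P)) (ZBar ⧸ P)) fun x hx => ?_
  have hx' : x ^ (p ^ m) = x := by
    simpa [finiteSubfield, RingHom.mem_eqLocusField, iterateFrobenius_def] using hx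
  rw [Polynomial.mem_rootSet]
  exact ⟨FiniteField.X_pow_card_sub_X_ne_zero _ h1, by simp [hx']⟩

instance fintype_finiteSubfield (m : ℕ) [NeZero m] : Fintype (finiteSubfield p P m) :=
  Fintype.ofFinite _

/-- The restriction of the Teichmüller character to the finite field with `p ^ m` elements. -/
def teichmullerOn (m : ℕ) : MulChar (finiteSubfield p P m) QBar :=
  MulChar.ofUnitHom <|
    (teichmuller p P).toUnitHom.comp (Units.map (finiteSubfield p P m).subtype.toMonoidHom)

open Classical in
/-- The character `λ` of order two of a finite field of odd characteristic, with `λ(0) = 0`. -/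
def quadChar (F : Type*) [Field F] [Fintype F] : MulChar F QBar :=
  (quadraticChar F).ringHomComp (Int.castRingHom QBar)

/-- The Jacobi sum `j(χ₁, χ₂) = - ∑_{x₁ + x₂ = 1} χ₁(x₁) χ₂(x₂)`, where characters vanish at `0`.
It is used below for nontrivial characters only, so that the value of the trivial character at `0`
plays no role. -/
def jac {F : Type*} [Field F] [Fintype F] (χ₁ χ₂ : MulChar F QBar) : QBar :=
  -jacobiSum χ₁ χ₂

/-- With `q = p ^ f`, `ℓ` the length of the orbit of `n` and `Q = q ^ ℓ`, the character
`θ_n = θ ^ ((Q - 1) n / 2d)` of the field with `Q` elements. The division is exact,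
as `Q n = n` in `ℤ/2dℤ`. -/
def thetaChar (f d : ℕ) [NeZero d] (n : ZMod (2 * d)) :
    MulChar (finiteSubfield p P (f * (orbit (p ^ f) n).card)) QBar :=
  teichmullerOn p P (f * (orbit (p ^ f) n).card) ^
    (((p ^ f) ^ (orbit (p ^ f) n).card - 1) * n.val / (2 * d))

/-- `β(n) = θ_n²(4) j(θ_n, θ_n) j(λ θ_n², θ_n⁻¹)`, the Jacobi sums being taken over the field with
`Q = q ^ |orbit of n|` elements, `q = p ^ f`. -/
def beta (f : ℕ) [NeZero f] (d : ℕ) [NeZero d] (n : ZMod (2 * d)) : QBar :=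
  haveI : NeZero (orbit (p ^ f) n).card := ⟨(card_orbit_pos _ n).ne'⟩
  (thetaChar p P f d n ^ 2) 4 * jac (thetaChar p P f d n) (thetaChar p P f d n) *
    jac (quadChar _ * thetaChar p P f d n ^ 2) (thetaChar p P f d n)⁻¹

end Teichmuller

/-- For a character `χ` of order `2d` of `F`, the sum
`B(n) = χ^{2n}(4) ∑_u ∑_v χ^n(u(1-u)) χ^{2n+d}(v) χ^{-n}(1-v)`. -/
def sumB {F : Type*} [Field F] [Fintype F] (d : ℕ) (χ : MulChar F QBar) (n : ℕ) : QBar :=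
  (χ ^ (2 * n)) 4 *
    ∑ u : F, ∑ v : F, (χ ^ n) (u * (1 - u)) * (χ ^ (2 * n + d)) v * (χ ^ n)⁻¹ (1 - v)

end KummerL

end

/-!
A power series over `QBar` with constant coefficient `1` is determined by its logarithmic
derivative, so it suffices to compare the power sums attached to both sides. On the side of
`L(E_d/K, T)` the coefficient of `T ^ m` is a sum over the points of `ℙ¹(L)`, where `L` has degree
`m` over `𝔽_q`, of traces of Frobenius over `L`: the identity between the power sums of the roots of
an Euler factor and the character sums of the reduced cubic over extensions comes from the
`L`-series of the function `g ↦ λ(Res(g, f))` on monic polynomials.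

At `t = τ` the cubic is `x (x² + s x - 4 s)` with `s = τ ^ 2d`. For fixed `x` it is linear in `s`,
and the number of `τ` with `τ ^ 2d = s` is the sum of `χ(s)` over the characters `χ` with
`χ ^ 2d = 1`; hence the double sum over `τ` and `x` is a sum of products of Jacobi sums, one for
each such `χ`. The characters with `χ ^ 4 = 1` either contribute nothing or account, together with
the place at infinity, for the factor `1 - q T`.

By the Hasse–Davenport relation the number attached to `χ ∘ N` is a power of the one attached to
`χ`, and raising `χ` to the power `q` does not change it. The characters of `L` thus regroup into
orbits of multiplication by `q`, which gives the power sums of the product on the right.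
-/

noncomputable section

namespace KummerL

/-! ### Logarithmic derivatives of power series -/

section LogDeriv

open PowerSeries
open Finset.HasAntidiagonal (antidiagonal mem_antidiagonal)

variable {R : Type*} [CommRing R] {A B S T : R⟦X⟧}

/-- The power series `S` is the logarithmic derivative `X A' / A` of the power series `A`. -/
def HasLogDeriv (A S : R⟦X⟧) : Prop := X * derivative R A = A * S

theorem coeff_X_mul_derivative (A : R⟦X⟧) (n : ℕ) :
    coeff n (X * derivative R A) = n * coeff n A := by
  cases n with
  | zero => simp
  | succ n => rw [coeff_succ_X_mul, coeff_derivative, mul_comm, Nat.cast_succ]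

theorem hasLogDeriv_one : HasLogDeriv (1 : R⟦X⟧) 0 := by
  simp [HasLogDeriv]

theorem HasLogDeriv.mul (hA : HasLogDeriv A S) (hB : HasLogDeriv B T) :
    HasLogDeriv (A * B) (S + T) := by
  unfold HasLogDeriv at *
  rw [Derivation.leibniz, smul_eq_mul, smul_eq_mul]
  linear_combination B * hA + A * hB

theorem HasLogDeriv.prod {ι : Type*} (s : Finset ι) {A S : ι → R⟦X⟧}
    (h : ∀ i ∈ s, HasLogDeriv (A i) (S i)) : HasLogDeriv (∏ i ∈ s, A i) (∑ i ∈ s, S i) := by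
  induction s using Finset.cons_induction with
  | empty => simpa using hasLogDeriv_one
  | cons a s ha ih =>
    rw [Finset.prod_cons, Finset.sum_cons]
    exact (h a (Finset.mem_cons_self a s)).mul
      (ih fun i hi => h i (Finset.mem_cons_of_mem hi))

theorem HasLogDeriv.of_mul_eq_one (hA : HasLogDeriv A S) (hAB : A * B = 1) :
    HasLogDeriv B (-S) := by
  have h : A * derivative R B + B * derivative R A = 0 := by
    simpa using congrArg (derivative R) hAB
  unfold HasLogDeriv at *
  linear_combination (X * B) * h - (X * derivative R B) * hAB - B ^ 2 * hA - S * B * hAB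

theorem HasLogDeriv.map {R' : Type*} [CommRing R'] (φ : R →+* R') (hA : HasLogDeriv A S) :
    HasLogDeriv (A.map φ) (S.map φ) := by
  unfold HasLogDeriv at *
  rw [← map_mul, ← hA]
  ext n
  simp only [coeff_X_mul_derivative, coeff_map, map_mul φ, map_natCast]

theorem HasLogDeriv.expand (hA : HasLogDeriv A S) (e : ℕ) (he : e ≠ 0) :
    HasLogDeriv (expand e he A) ((e : R⟦X⟧) * expand e he S) := by
  have h : X * derivative R (PowerSeries.expand e he A) =
      (e : R⟦X⟧) * PowerSeries.expand e he (X * derivative R A) := by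
    ext n
    rw [← map_natCast (C (R := R)), coeff_C_mul, coeff_X_mul_derivative, coeff_expand, coeff_expand]
    split_ifs with hn
    · rw [coeff_X_mul_derivative, ← mul_assoc, ← Nat.cast_mul, Nat.mul_div_cancel' hn]
    · simp
  unfold HasLogDeriv at *
  rw [h, hA, map_mul]
  ring

theorem HasLogDeriv.natCast_mul_coeff (hA : HasLogDeriv A S) (n : ℕ) :
    (n : R) * coeff n A = ∑ i ∈ antidiagonal n, coeff i.1 A * coeff i.2 S := by
  rw [← coeff_mul, ← coeff_X_mul_derivative, hA]

theorem HasLogDeriv.coeff_zero (hA : HasLogDeriv A S) (hA0 : constantCoeff A = 1) :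
    coeff 0 S = 0 := by
  simpa [hA0] using (hA.natCast_mul_coeff 0).symm

theorem HasLogDeriv.unique (hS : HasLogDeriv A S) (hT : HasLogDeriv A T)
    (hA0 : constantCoeff A = 1) : S = T :=
  (isUnit_iff_constantCoeff.2 (hA0 ▸ isUnit_one)).mul_left_cancel (hS.symm.trans hT)

theorem HasLogDeriv.coeff_unique [IsDomain R] [CharZero R] (hA : HasLogDeriv A S)
    (hB : HasLogDeriv B T) (hA0 : constantCoeff A = 1) (hB0 : constantCoeff B = 1) {N : ℕ}
    (hST : ∀ n ≤ N, coeff n S = coeff n T) {n : ℕ} (hn : n ≤ N) : coeff n A = coeff n B := by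
  induction n using Nat.strong_induction_on with
  | _ n ih =>
    rcases n.eq_zero_or_pos with rfl | hpos
    · rw [coeff_zero_eq_constantCoeff, hA0, hB0]
    apply mul_left_cancel₀ (Nat.cast_ne_zero (R := R).2 hpos.ne')
    rw [hA.natCast_mul_coeff, hB.natCast_mul_coeff]
    refine Finset.sum_congr rfl fun i hi => ?_
    rw [mem_antidiagonal] at hi
    rcases i.2.eq_zero_or_pos with h0 | h0
    · rw [h0, hA.coeff_zero hA0, hB.coeff_zero hB0, mul_zero, mul_zero]
    · rw [ih i.1 (by omega) (by omega), hST i.2 (by omega)]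

theorem one_sub_C_mul_X_mul_mk_pow (a : R) : (1 - C a * X) * mk (a ^ ·) = 1 := by
  ext n
  cases n with
  | zero => simp
  | succ n => simp [sub_mul, mul_assoc, coeff_succ_X_mul, pow_succ', coeff_one]

theorem hasLogDeriv_one_sub (a : R) : HasLogDeriv (1 - C a * X) (1 - mk (a ^ ·)) := by
  rw [HasLogDeriv, mul_sub, one_sub_C_mul_X_mul_mk_pow]
  simp [mul_comm]

/-- The logarithmic derivative `X A' / A` of a power series `A` with constant coefficient `1`. -/
def formalLogDeriv (A : R⟦X⟧) : R⟦X⟧ := X * derivative R A * invOfUnit A 1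

theorem hasLogDeriv_formalLogDeriv (hA : constantCoeff A = 1) :
    HasLogDeriv A (formalLogDeriv A) := by
  rw [HasLogDeriv, formalLogDeriv, mul_left_comm, mul_invOfUnit A 1 hA, mul_one]

theorem HasLogDeriv.formalLogDeriv_eq (hS : HasLogDeriv A S) (hA : constantCoeff A = 1) :
    formalLogDeriv A = S :=
  (hasLogDeriv_formalLogDeriv hA).unique hS hA

end LogDeriv

/-! ### `L`-series of multiplicative functions on monic polynomials -/

section Monics

open Polynomial

variable (k : Type*) [Field k] [Finite k]

theorem finite_monic_natDegree_eq (n : ℕ) : {g : k[X] | g.Monic ∧ g.natDegree = n}.Finite := by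
  have : Finite (degreeLT k (n + 1)) := Module.finite_of_finite k
  refine Set.Finite.subset (Set.toFinite (degreeLT k (n + 1) : Set k[X])) ?_
  rintro g ⟨-, rfl⟩
  rw [SetLike.mem_coe, mem_degreeLT]
  exact degree_le_natDegree.trans_lt (by exact_mod_cast Nat.lt_succ_self _)

/-- The finite set of monic polynomials of degree `n` over a finite field. -/
def monicsOfDegree (n : ℕ) : Finset k[X] := (finite_monic_natDegree_eq k n).toFinset

open Classical in
/-- The finite set of monic irreducible polynomials of degree at most `n` over a finite field. -/
def irreduciblesUpTo (n : ℕ) : Finset k[X] :=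
  ((Finset.range (n + 1)).biUnion (monicsOfDegree k)).filter Irreducible

/-- The finite set of monic irreducible polynomials over a finite field whose degree divides `m`.
By convention it is empty for `m = 0`. -/
def irreduciblesDvd (m : ℕ) : Finset k[X] :=
  (irreduciblesUpTo k m).filter fun π => π.natDegree ∣ m ∧ m ≠ 0

variable {k} {R : Type*} {m n : ℕ} {c : k} {e g π : k[X]}

@[simp]
theorem mem_monicsOfDegree : g ∈ monicsOfDegree k n ↔ g.Monic ∧ g.natDegree = n := by
  simp [monicsOfDegree]

@[simp]
theorem mem_irreduciblesUpTo :
    π ∈ irreduciblesUpTo k n ↔ π.Monic ∧ Irreducible π ∧ π.natDegree ≤ n := by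
  simp [irreduciblesUpTo, and_comm, and_left_comm]

@[simp]
theorem mem_irreduciblesDvd :
    π ∈ irreduciblesDvd k m ↔ π.Monic ∧ Irreducible π ∧ π.natDegree ∣ m ∧ m ≠ 0 := by
  simp only [irreduciblesDvd, Finset.mem_filter, mem_irreduciblesUpTo, and_assoc]
  refine and_congr_right fun _ => and_congr_right fun _ => and_iff_right_of_imp fun h => ?_
  exact Nat.le_of_dvd (Nat.pos_of_ne_zero h.2) h.1

theorem monicsOfDegree_zero : monicsOfDegree k 0 = {1} := by
  ext g
  rw [mem_monicsOfDegree, Finset.mem_singleton]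
  exact ⟨fun h => eq_one_of_monic_natDegree_zero h.1 h.2, fun h => by simp [h]⟩

theorem sum_monicsOfDegree_one [Fintype k] [AddCommMonoid R] (φ : k[X] → R) :
    ∑ g ∈ monicsOfDegree k 1, φ g = ∑ x : k, φ (X - C x) := by
  symm
  refine Finset.sum_bij (fun x _ => X - C x) (fun x _ => ?_) (fun x _ y _ h => ?_)
    (fun g hg => ?_) (fun _ _ => rfl)
  · simp [monic_X_sub_C]
  · simpa using h
  · rw [mem_monicsOfDegree] at hg
    refine ⟨-g.coeff 0, Finset.mem_univ _, ?_⟩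
    conv_rhs => rw [hg.1.eq_X_add_C hg.2]
    simp

theorem sum_monicsOfDegree_two [Fintype k] [AddCommMonoid R] (φ : k[X] → R) :
    ∑ g ∈ monicsOfDegree k 2, φ g = ∑ w : k, ∑ u : k, φ (X ^ 2 + C u * X + C w) := by
  have hdeg (u w : k) : (X ^ 2 + C u * X + C w).natDegree = 2 := by compute_degree!
  rw [← Finset.sum_product']
  symm
  refine Finset.sum_bij (fun x _ => X ^ 2 + C x.2 * X + C x.1) (fun x _ => ?_)
    (fun x _ y _ h => ?_) (fun g hg => ?_) (fun _ _ => rfl)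
  · rw [mem_monicsOfDegree]
    exact ⟨by monicity!, hdeg _ _⟩
  · refine Prod.ext ?_ ?_
    · simpa using congrArg (coeff · 0) h
    · simpa [coeff_C, coeff_X_pow] using congrArg (coeff · 1) h
  · rw [mem_monicsOfDegree] at hg
    have h2 : g.coeff 2 = 1 := hg.2 ▸ hg.1.coeff_natDegree
    refine ⟨(g.coeff 0, g.coeff 1), Finset.mem_univ _, ?_⟩
    conv_rhs => rw [g.as_sum_range_C_mul_X_pow, hg.2]
    simp only [Finset.sum_range_succ, Finset.sum_range_zero, h2]
    simp
    ring

theorem sum_filter_dvd_monicsOfDegree [AddCommMonoid R] (he : e ∈ monicsOfDegree k m)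
    (hmn : m ≤ n) (φ : k[X] → R) :
    open Classical in ∑ g ∈ monicsOfDegree k n with e ∣ g, φ g =
      ∑ g ∈ monicsOfDegree k (n - m), φ (e * g) := by
  classical
  rw [mem_monicsOfDegree] at he
  obtain ⟨he, rfl⟩ := he
  symm
  refine Finset.sum_bij (fun g _ => e * g) (fun g hg => ?_)
    (fun _ _ _ _ h => mul_left_cancel₀ he.ne_zero h) (fun g hg => ?_) (fun _ _ => rfl)
  · rw [mem_monicsOfDegree] at hg
    rw [Finset.mem_filter, mem_monicsOfDegree, he.natDegree_mul hg.1]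
    exact ⟨⟨he.mul hg.1, by omega⟩, dvd_mul_right _ _⟩
  · rw [Finset.mem_filter, mem_monicsOfDegree] at hg
    obtain ⟨⟨hmon, hdeg⟩, g, rfl⟩ := hg
    have hg := he.of_mul_monic_left hmon
    rw [he.natDegree_mul hg] at hdeg
    exact ⟨g, mem_monicsOfDegree.2 ⟨hg, by omega⟩, rfl⟩

theorem homothety_mem_monicsOfDegree (he : e ∈ monicsOfDegree k n) (hg : g ∈ monicsOfDegree k n)
    (c : k) : C c * (g - e) + e ∈ monicsOfDegree k n := by
  rw [mem_monicsOfDegree] at *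
  have hdeg : g.degree = e.degree := by
    rw [degree_eq_natDegree hg.1.ne_zero, degree_eq_natDegree he.1.ne_zero, hg.2, he.2]
  have hlt : (C c * (g - e)).degree < e.degree := by
    rw [← smul_eq_C_mul]
    refine (degree_smul_le c _).trans_lt ?_
    rw [← hdeg]
    exact degree_sub_lt_left hdeg hg.1.ne_zero (hg.1.leadingCoeff.trans he.1.leadingCoeff.symm)
  exact ⟨he.1.add_of_right hlt, (natDegree_add_eq_right_of_degree_lt hlt).trans he.2⟩

theorem sum_monicsOfDegree_eq_zero [CommRing R] [IsDomain R] {h : k[X] → R} {ζ : R}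
    (he : e ∈ monicsOfDegree k n) (hc : c ≠ 0) (hζ : ζ ≠ 1)
    (hh : ∀ g ∈ monicsOfDegree k n, h (C c * (g - e) + e) = ζ * h g) :
    ∑ g ∈ monicsOfDegree k n, h g = 0 := by
  have hcc : (C c : k[X]) * C c⁻¹ = 1 := by rw [← C_mul, mul_inv_cancel₀ hc, C_1]
  have hsum : ∑ g ∈ monicsOfDegree k n, h g = ζ * ∑ g ∈ monicsOfDegree k n, h g := by
    rw [Finset.mul_sum]
    symm
    refine Finset.sum_bij' (fun g _ => C c * (g - e) + e) (fun g _ => C c⁻¹ * (g - e) + e)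
      (fun g hg => homothety_mem_monicsOfDegree he hg c)
      (fun g hg => homothety_mem_monicsOfDegree he hg c⁻¹) (fun g _ => ?_) (fun g _ => ?_)
      (fun g hg => (hh g hg).symm)
    all_goals linear_combination (g - e) * hcc
  have hmul : (1 - ζ) * ∑ g ∈ monicsOfDegree k n, h g = 0 := by
    rw [sub_mul, one_mul, ← hsum, sub_self]
  exact (mul_eq_zero.1 hmul).resolve_left (sub_ne_zero.2 hζ.symm)

end Monics

section Factorization

open Polynomial UniqueFactorizationMonoid

variable {k : Type*} [Field k] {g π : k[X]}

open Classical in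
theorem pow_dvd_iff_le_count_normalizedFactors (hg : g ≠ 0) (hπ : Irreducible π) (hπm : π.Monic)
    (j : ℕ) : π ^ j ∣ g ↔ j ≤ (normalizedFactors g).count π := by
  rw [pow_dvd_iff_le_emultiplicity, le_emultiplicity_iff_replicate_le_normalizedFactors hπ hg,
    hπm.normalize_eq_self, Multiset.le_count_iff_replicate_le]

open Classical in
theorem card_pow_dvd_eq_count_normalizedFactors (hg : g ≠ 0) (hπ : Irreducible π)
    (hπm : π.Monic) : {m ∈ Finset.range (g.natDegree + 1) | (π.natDegree ∣ m ∧ m ≠ 0) ∧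
      π ^ (m / π.natDegree) ∣ g}.card = (normalizedFactors g).count π := by
  have hd : 0 < π.natDegree := hπ.natDegree_pos
  have himage : {m ∈ Finset.range (g.natDegree + 1) | (π.natDegree ∣ m ∧ m ≠ 0) ∧
      π ^ (m / π.natDegree) ∣ g} =
      (Finset.Icc 1 ((normalizedFactors g).count π)).image (π.natDegree * ·) := by
    ext m
    simp only [Finset.mem_filter, Finset.mem_range, Finset.mem_image, Finset.mem_Icc,
      ← pow_dvd_iff_le_count_normalizedFactors hg hπ hπm]
    constructor
    · rintro ⟨-, ⟨⟨j, rfl⟩, hm⟩, hj⟩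
      rw [Nat.mul_div_cancel_left _ hd] at hj
      exact ⟨j, ⟨Nat.pos_of_ne_zero (right_ne_zero_of_mul hm), hj⟩, rfl⟩
    · rintro ⟨j, ⟨hj0, hj⟩, rfl⟩
      have hle := natDegree_le_of_dvd hj hg
      rw [natDegree_pow, mul_comm] at hle
      rw [Nat.mul_div_cancel_left _ hd]
      exact ⟨by omega, ⟨dvd_mul_right _ _, (Nat.mul_pos hd hj0).ne'⟩, hj⟩
  rw [himage, Finset.card_image_of_injective _ fun a b => Nat.eq_of_mul_eq_mul_left hd,
    Nat.card_Icc, Nat.add_sub_cancel]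

open Classical in
theorem natDegree_eq_sum_count_normalizedFactors [Finite k] (hg : g.Monic) :
    g.natDegree = ∑ π ∈ irreduciblesUpTo k g.natDegree,
      (normalizedFactors g).count π * π.natDegree := by
  have hmonic : ∀ π ∈ normalizedFactors g, π.Monic := fun π hπ => by
    rw [← normalize_normalized_factor π hπ]
    exact monic_normalize (irreducible_of_normalized_factor π hπ).ne_zero
  have hprod : (normalizedFactors g).prod = g := by
    rw [prod_normalizedFactors_eq hg.ne_zero, hg.normalize_eq_self]
  conv_lhs => rw [← hprod]
  rw [natDegree_multiset_prod_of_monic _ hmonic, Finset.sum_multiset_map_count]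
  refine Finset.sum_subset (fun π hπ => ?_) (fun π _ hπ => ?_)
  · rw [Multiset.mem_toFinset] at hπ
    exact mem_irreduciblesUpTo.2 ⟨hmonic π hπ, irreducible_of_normalized_factor π hπ,
      natDegree_le_of_dvd (dvd_of_mem_normalizedFactors hπ) hg.ne_zero⟩
  · rw [Multiset.mem_toFinset] at hπ
    simp [Multiset.count_eq_zero_of_notMem hπ]

open Classical in
theorem natDegree_eq_sum_irreduciblesDvd [Finite k] (hg : g.Monic) :
    g.natDegree = ∑ m ∈ Finset.range (g.natDegree + 1), ∑ π ∈ irreduciblesDvd k m,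
      if π ^ (m / π.natDegree) ∣ g then π.natDegree else 0 := by
  have hfilter : ∀ m ∈ Finset.range (g.natDegree + 1), irreduciblesDvd k m =
      {π ∈ irreduciblesUpTo k g.natDegree | π.natDegree ∣ m ∧ m ≠ 0} := fun m hm => by
    rw [Finset.mem_range, Nat.lt_succ_iff] at hm
    ext π
    simp only [mem_irreduciblesDvd, Finset.mem_filter, mem_irreduciblesUpTo, and_assoc]
    refine and_congr_right fun _ => and_congr_right fun _ => (and_iff_right_of_imp fun h => ?_).symm
    exact (Nat.le_of_dvd (Nat.pos_of_ne_zero h.2) h.1).trans hm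
  conv_rhs =>
    rw [Finset.sum_congr rfl fun m hm => by rw [hfilter m hm, Finset.sum_filter], Finset.sum_comm]
  conv_lhs => rw [natDegree_eq_sum_count_normalizedFactors hg]
  refine Finset.sum_congr rfl fun π hπ => ?_
  rw [mem_irreduciblesUpTo] at hπ
  simp only [← ite_and]
  rw [← Finset.sum_filter, Finset.sum_const, smul_eq_mul,
    card_pow_dvd_eq_count_normalizedFactors hg.ne_zero hπ.2.1 hπ.1]

end Factorization

section LSeries

open Polynomial

variable {k : Type*} [Field k] {R : Type*} [CommRing R]

/-- A function on polynomials that is completely multiplicative on monic polynomials. -/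
structure MonicMultiplicative (h : k[X] → R) : Prop where
  map_one : h 1 = 1
  map_mul : ∀ {a b : k[X]}, a.Monic → b.Monic → h (a * b) = h a * h b

namespace MonicMultiplicative

variable {h h' : k[X] → R}

theorem mul (H : MonicMultiplicative h) (H' : MonicMultiplicative h') :
    MonicMultiplicative fun g => h g * h' g where
  map_one := by simp [H.map_one, H'.map_one]
  map_mul ha hb := by rw [H.map_mul ha hb, H'.map_mul ha hb, mul_mul_mul_comm]

theorem map_pow (H : MonicMultiplicative h) {a : k[X]} (ha : a.Monic) (j : ℕ) :
    h (a ^ j) = h a ^ j := by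
  induction j with
  | zero => simpa using H.map_one
  | succ j ih => rw [pow_succ, H.map_mul (ha.pow j) ha, ih, pow_succ]

end MonicMultiplicative

variable [Finite k]

/-- The `L`-series `∑ h(g) T ^ deg g`, the sum being over the monic polynomials `g`. -/
def monicLSeries (h : k[X] → R) : PowerSeries R :=
  PowerSeries.mk fun n => ∑ g ∈ monicsOfDegree k n, h g

/-- The logarithmic derivative of the Euler product `∏ (1 - h(π) T ^ deg π)⁻¹` over the monic
irreducible polynomials `π`. -/
def monicLogDeriv (h : k[X] → R) : PowerSeries R :=
  PowerSeries.mk fun m => ∑ π ∈ irreduciblesDvd k m, (π.natDegree : R) * h π ^ (m / π.natDegree)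

theorem hasLogDeriv_monicLSeries {h : k[X] → R} (H : MonicMultiplicative h) :
    HasLogDeriv (monicLSeries h) (monicLogDeriv h) := by
  classical
  rw [HasLogDeriv, mul_comm (monicLSeries h)]
  ext n
  rw [coeff_X_mul_derivative, PowerSeries.coeff_mul]
  simp only [monicLSeries, monicLogDeriv, PowerSeries.coeff_mk]
  have hdeg : ∀ g ∈ monicsOfDegree k n, (n : R) * h g = ∑ m ∈ Finset.range (n + 1),
      ∑ π ∈ irreduciblesDvd k m,
        if π ^ (m / π.natDegree) ∣ g then (π.natDegree : R) * h g else 0 := by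
    intro g hg
    obtain ⟨hgm, rfl⟩ := mem_monicsOfDegree.1 hg
    conv_lhs => rw [natDegree_eq_sum_irreduciblesDvd hgm]
    simp only [Nat.cast_sum, Nat.cast_ite, Nat.cast_zero, Finset.sum_mul, ite_mul, zero_mul]
  rw [Finset.mul_sum, Finset.sum_congr rfl hdeg, Finset.sum_comm,
    Finset.Nat.sum_antidiagonal_eq_sum_range_succ fun i j => (∑ π ∈ irreduciblesDvd k i,
      (π.natDegree : R) * h π ^ (i / π.natDegree)) * ∑ g ∈ monicsOfDegree k j, h g]
  refine Finset.sum_congr rfl fun m hm => ?_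
  rw [Finset.sum_comm, Finset.sum_mul]
  refine Finset.sum_congr rfl fun π hπ => ?_
  obtain ⟨hπm, hπi, ⟨j, rfl⟩, -⟩ := mem_irreduciblesDvd.1 hπ
  have hpow : π ^ j ∈ monicsOfDegree k (π.natDegree * j) :=
    mem_monicsOfDegree.2 ⟨hπm.pow j, by rw [natDegree_pow, mul_comm]⟩
  rw [Nat.mul_div_cancel_left _ hπi.natDegree_pos, ← Finset.sum_filter,
    sum_filter_dvd_monicsOfDegree hpow (by simpa [Nat.lt_succ_iff] using hm), Finset.mul_sum]
  refine Finset.sum_congr rfl fun g hg => ?_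
  rw [H.map_mul (hπm.pow j) (mem_monicsOfDegree.1 hg).1, H.map_pow hπm, mul_assoc]

end LSeries

section Minpoly

open Polynomial

variable {k : Type*} [Field k] [Finite k] {L : Type*} [Field L] [Fintype L] [Algebra k L]

open Classical in
theorem card_filter_minpoly_eq {π : k[X]} (hπm : π.Monic) (hπ : Irreducible π)
    (hdeg : π.natDegree ∣ Module.finrank k L) :
    ({x | minpoly k x = π} : Finset L).card = π.natDegree := by
  have hdvd : π ∣ X ^ Nat.card L - X := by
    rw [Module.natCard_eq_pow_finrank (K := k)]
    exact (hπ.natDegree_dvd_iff_dvd_X_pow_card_pow_sub_X).1 hdeg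
  have hsplits : (π.map (algebraMap k L)).Splits := by
    have h := (FiniteField.isSplittingField_sub L k).splits
    rw [← Nat.card_eq_fintype_card] at h
    refine h.of_dvd ?_ (Polynomial.map_dvd _ hdvd)
    simpa using FiniteField.X_pow_card_sub_X_ne_zero L (Finite.one_lt_card (α := L))
  rw [← card_rootSet_eq_natDegree (PerfectField.separable_of_irreducible hπ) hsplits,
    ← Set.toFinset_card]
  congr 1
  ext x
  rw [Finset.mem_filter_univ, Set.mem_toFinset, mem_rootSet_of_ne hπm.ne_zero]
  exact ⟨fun h => h ▸ minpoly.aeval k x,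
    fun h => (minpoly.eq_of_irreducible_of_monic hπ h hπm).symm⟩

theorem sum_minpoly_eq {R : Type*} [CommRing R] (φ : k[X] → R) :
    ∑ x : L, φ (minpoly k x) =
      ∑ π ∈ irreduciblesDvd k (Module.finrank k L), (π.natDegree : R) * φ π := by
  classical
  have hint (x : L) : IsIntegral k x := Algebra.IsIntegral.isIntegral x
  rw [← Finset.sum_fiberwise_of_maps_to (t := irreduciblesDvd k (Module.finrank k L))
    (g := minpoly k) fun x _ => mem_irreduciblesDvd.2 ⟨minpoly.monic (hint x),
      minpoly.irreducible (hint x), minpoly.degree_dvd (hint x), Module.finrank_pos.ne'⟩]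
  refine Finset.sum_congr rfl fun π hπ => ?_
  obtain ⟨hπm, hπ, hdeg, -⟩ := mem_irreduciblesDvd.1 hπ
  rw [Finset.sum_congr rfl fun x hx => by rw [(Finset.mem_filter.1 hx).2], Finset.sum_const,
    nsmul_eq_mul, ← card_filter_minpoly_eq hπm hπ hdeg]

theorem coeff_finrank_monicLogDeriv (L : Type*) [Field L] [Fintype L] [Algebra k L] {R : Type*}
    [CommRing R] (h : k[X] → R) :
    PowerSeries.coeff (Module.finrank k L) (monicLogDeriv h) =
      ∑ x : L, h (minpoly k x) ^ (Module.finrank k L / (minpoly k x).natDegree) := by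
  rw [monicLogDeriv, PowerSeries.coeff_mk,
    sum_minpoly_eq fun π => h π ^ (Module.finrank k L / π.natDegree)]

end Minpoly

/-! ### Norms and resultants -/

section Resultant

open Polynomial

variable {k : Type*} [Field k]

theorem resultant_minpoly_gen {L : Type*} [Field L] [Algebra k L] [FiniteDimensional k L]
    [Algebra.IsSeparable k L] (pb : PowerBasis k L) (f : k[X]) :
    resultant (minpoly k pb.gen) f = Algebra.norm k (aeval pb.gen f) := by
  classical
  let Ω := AlgebraicClosure k
  apply FaithfulSMul.algebraMap_injective k Ω
  have hsplits : ((minpoly k pb.gen).map (algebraMap k Ω)).Splits := IsAlgClosed.splits _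
  have hmonic : ((minpoly k pb.gen).map (algebraMap k Ω)).Monic :=
    (minpoly.monic pb.isIntegral_gen).map _
  have hnodup : ((minpoly k pb.gen).map (algebraMap k Ω)).roots.Nodup :=
    nodup_roots (Separable.map (Algebra.IsSeparable.isSeparable k pb.gen))
  rw [Algebra.norm_eq_prod_embeddings k Ω, Fintype.prod_equiv pb.liftEquiv' _
      (fun y => aeval y.1 f) fun σ => by rw [pb.liftEquiv'_apply_coe, aeval_algHom_apply],
    Finset.prod_mem_multiset _ _ (aeval · f) fun _ => rfl, Finset.prod_eq_multiset_prod,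
    Multiset.toFinset_val, Multiset.dedup_eq_self.2 hnodup, ← resultant_map_map,
    ← natDegree_map (algebraMap k Ω), resultant_eq_prod_eval _ _ _ natDegree_map_le hsplits,
    hmonic.leadingCoeff, one_pow, one_mul]
  simp only [eval_map_algebraMap]

open IntermediateField in
theorem norm_aeval_eq_resultant_minpoly_pow {L : Type*} [Field L] [Algebra k L]
    [FiniteDimensional k L] [Algebra.IsSeparable k L] (x : L) (f : k[X]) :
    Algebra.norm k (aeval x f) =
      resultant (minpoly k x) f ^ (Module.finrank k L / (minpoly k x).natDegree) := by
  have hx : IsIntegral k x := Algebra.IsIntegral.isIntegral x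
  have hsep : Algebra.IsSeparable k k⟮x⟯ := Algebra.isSeparable_tower_bot_of_isSeparable k k⟮x⟯ L
  have haeval : aeval x f = algebraMap k⟮x⟯ L (aeval (AdjoinSimple.gen k x) f) := by
    rw [← aeval_algebraMap_apply, AdjoinSimple.algebraMap_gen]
  have hdeg : Module.finrank k L / (minpoly k x).natDegree = Module.finrank k⟮x⟯ L := by
    rw [← adjoin.finrank hx, ← Module.finrank_mul_finrank k k⟮x⟯ L,
      Nat.mul_div_cancel_left _ Module.finrank_pos]
  have hgen := resultant_minpoly_gen (adjoin.powerBasis hx) f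
  rw [adjoin.powerBasis_gen, minpoly_gen] at hgen
  rw [haeval, hdeg, ← Algebra.norm_norm (S := k⟮x⟯), Algebra.norm_algebraMap, map_pow, hgen]

variable {R : Type*} [CommRing R]

/-- The function `g ↦ χ(Res(g, f))` on polynomials. -/
def resultantChar (χ : MulChar k R) (f g : k[X]) : R := χ (resultant g f)

theorem monicMultiplicative_resultantChar (χ : MulChar k R) (f : k[X]) :
    MonicMultiplicative (resultantChar χ f) where
  map_one := by simp [resultantChar]
  map_mul {a b} ha hb := by
    simp only [resultantChar]
    rw [ha.natDegree_mul hb, resultant_mul_left a b f f.natDegree le_rfl, map_mul]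

theorem resultantChar_X_sub_C (χ : MulChar k R) (f : k[X]) (x : k) :
    resultantChar χ f (X - C x) = χ (f.eval x) := by
  rw [resultantChar, natDegree_X_sub_C, resultant_X_sub_C_left _ _ _ le_rfl]

theorem resultantChar_homothety [Finite k] (χ : MulChar k R) {e f g : k[X]} {n : ℕ}
    (he : e ∈ monicsOfDegree k n) (hg : g ∈ monicsOfDegree k n) (hfe : f ∣ e) (c : k) :
    resultantChar χ f (C c * (g - e) + e) = χ c ^ f.natDegree * resultantChar χ f g := by
  have hdeg := (mem_monicsOfDegree.1 (homothety_mem_monicsOfDegree he hg c)).2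
  rw [mem_monicsOfDegree] at he hg
  obtain ⟨p, rfl⟩ := hfe
  have hp : (C (1 - c) * p).natDegree + f.natDegree ≤ n := by
    have hfp := mul_ne_zero_iff.1 he.1.ne_zero
    rw [← he.2, natDegree_mul hfp.1 hfp.2, add_comm]
    exact Nat.add_le_add_left (natDegree_C_mul_le _ _) _
  have hexpand : C c * (g - f * p) + f * p = C c * g + f * (C (1 - c) * p) := by
    rw [C_sub, C_1]
    ring
  rw [resultantChar, resultantChar, hdeg, hexpand, resultant_add_mul_left _ _ _ _ _ hp le_rfl,
    resultant_C_mul_left, hg.2, map_mul, map_pow]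

end Resultant

/-! ### Characters composed with the norm, and the Hasse–Davenport relation -/

section NormChar

/-- The character `χ ∘ N` of a finite extension. -/
def normChar {k R : Type*} [Field k] [CommRing R] (L : Type*) [Field L] [Algebra k L]
    [FiniteDimensional k L] (χ : MulChar k R) : MulChar L R where
  toFun x := χ (Algebra.norm k x)
  map_one' := by simp
  map_mul' x y := by simp
  map_nonunit' x hx := by
    have hx0 : x = 0 := by simpa using hx
    simp [hx0, MulChar.map_zero]

variable {k : Type*} [Field k] {R : Type*} [CommRing R]
  {L : Type*} [Field L] [Algebra k L] [FiniteDimensional k L]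

@[simp]
theorem normChar_apply (χ : MulChar k R) (x : L) : normChar L χ x = χ (Algebra.norm k x) := rfl

theorem normChar_mul (χ ψ : MulChar k R) : normChar L (χ * ψ) = normChar L χ * normChar L ψ := by
  ext x
  simp

theorem normChar_one : normChar L (1 : MulChar k R) = 1 := by
  ext x
  rw [normChar_apply, MulChar.one_apply_coe, MulChar.one_apply]
  simp

theorem normChar_pow (χ : MulChar k R) (n : ℕ) : normChar L (χ ^ n) = normChar L χ ^ n := by
  induction n with
  | zero => simpa using normChar_one
  | succ n ih => rw [pow_succ, normChar_mul, ih, pow_succ]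

theorem normChar_inv (χ : MulChar k R) : normChar L χ⁻¹ = (normChar L χ)⁻¹ := by
  apply eq_inv_of_mul_eq_one_left
  rw [← normChar_mul, inv_mul_cancel, normChar_one]

theorem normChar_injective [Finite L] :
    Function.Injective (normChar L : MulChar k R → MulChar L R) := by
  have := Finite.of_injective _ (FaithfulSMul.algebraMap_injective k L)
  intro χ ψ h
  ext x
  obtain ⟨y, hy⟩ := FiniteField.norm_surjective k L (x : k)
  have := DFunLike.congr_fun h y
  rwa [normChar_apply, normChar_apply, hy] at this

theorem resultantChar_minpoly_pow [Algebra.IsSeparable k L] (χ : MulChar k R)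
    (f : Polynomial k) (x : L) :
    resultantChar χ f (minpoly k x) ^ (Module.finrank k L / (minpoly k x).natDegree) =
      normChar L χ (Polynomial.aeval x f) := by
  rw [resultantChar, ← map_pow, ← norm_aeval_eq_resultant_minpoly_pow, normChar_apply]

end NormChar

section HasseDavenport

open Polynomial

variable {k : Type*} [Field k] [Fintype k] {R : Type*} [CommRing R] [IsDomain R]

theorem monicLSeries_jacobi (χ₁ χ₂ : MulChar k R) (h : χ₁ * χ₂ ≠ 1) :
    monicLSeries (fun g => resultantChar χ₁ X g * resultantChar χ₂ (1 - X) g) =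
      1 - PowerSeries.C (-jacobiSum χ₁ χ₂) * PowerSeries.X := by
  have H := (monicMultiplicative_resultantChar χ₁ X).mul
    (monicMultiplicative_resultantChar χ₂ (1 - X))
  ext n
  rw [monicLSeries, PowerSeries.coeff_mk]
  rcases n with - | - | n
  · simp [monicsOfDegree_zero, H.map_one]
  · rw [zero_add, sum_monicsOfDegree_one]
    simp [resultantChar_X_sub_C, jacobiSum]
  · obtain ⟨c, hc⟩ := MulChar.ne_one_iff.1 h
    have hX : (1 - X : k[X]).natDegree = 1 := by
      rw [← neg_sub, natDegree_neg, ← C_1, natDegree_X_sub_C]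
    have he : X ^ n * (X * (X - C 1)) ∈ monicsOfDegree k (n + 2) := by
      rw [mem_monicsOfDegree]
      exact ⟨by monicity!, by compute_degree!⟩
    have hXdvd : X ∣ X ^ n * (X * (X - C (1 : k))) := ⟨X ^ n * (X - C 1), by ring⟩
    have hXdvd' : 1 - X ∣ X ^ n * (X * (X - C (1 : k))) := ⟨-(X ^ n * X), by rw [C_1]; ring⟩
    rw [sum_monicsOfDegree_eq_zero he c.ne_zero hc fun g hg => by
      rw [resultantChar_homothety χ₁ he hg hXdvd, resultantChar_homothety χ₂ he hg hXdvd',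
        natDegree_X, hX, pow_one, pow_one, MulChar.mul_apply]
      ring]
    simp [PowerSeries.coeff_one]

theorem neg_jacobiSum_normChar {L : Type*} [Field L] [Fintype L] [Algebra k L]
    (χ₁ χ₂ : MulChar k R) (h : χ₁ * χ₂ ≠ 1) :
    -jacobiSum (normChar L χ₁) (normChar L χ₂) =
      (-jacobiSum χ₁ χ₂) ^ Module.finrank k L := by
  have H := (monicMultiplicative_resultantChar χ₁ X).mul
    (monicMultiplicative_resultantChar χ₂ (1 - X))
  have hL := hasLogDeriv_monicLSeries H
  rw [monicLSeries_jacobi χ₁ χ₂ h] at hL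
  have hcoeff := congrArg (PowerSeries.coeff (Module.finrank k L))
    (hL.unique (hasLogDeriv_one_sub (-jacobiSum χ₁ χ₂)) (by simp))
  rw [coeff_finrank_monicLogDeriv, map_sub, PowerSeries.coeff_mk, PowerSeries.coeff_one,
    if_neg Module.finrank_pos.ne', zero_sub] at hcoeff
  rw [← neg_eq_iff_eq_neg.2 hcoeff, jacobiSum]
  simp [mul_pow, resultantChar_minpoly_pow]

end HasseDavenport

theorem sum_char_mul_char_sub {k R : Type*} [Field k] [Fintype k] [CommRing R]
    (χ ψ : MulChar k R) {a : k} (ha : a ≠ 0) :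
    ∑ x : k, χ x * ψ (a - x) = (χ * ψ) a * jacobiSum χ ψ := by
  rw [jacobiSum, Finset.mul_sum]
  symm
  refine Fintype.sum_equiv (Equiv.mulLeft₀ a ha) _ _ fun y => ?_
  change _ = χ (a * y) * ψ (a - a * y)
  rw [← mul_one_sub, map_mul, map_mul, MulChar.mul_apply]
  ring

/-! ### Quadratic characters -/

section Quadratic

variable {k : Type*} [Field k] [Fintype k] [DecidableEq k]

theorem normChar_quadraticChar (hk : ringChar k ≠ 2) (L : Type*) [Field L] [Fintype L]
    [DecidableEq L] [Algebra k L] : normChar L (quadraticChar k) = quadraticChar L := by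
  have hchar : ringChar L = ringChar k := (Algebra.ringChar_eq k L).symm
  ext x
  rw [normChar_apply]
  set y : L := (x : L)
  have hinj := Int.cast_injOn_of_ringChar_ne_two (R := L) (by rwa [hchar])
  apply hinj
  · rcases quadraticChar_isQuadratic k (Algebra.norm k y) with h | h | h <;> simp [h]
  · rcases quadraticChar_isQuadratic L y with h | h | h <;> simp [h]
  rw [quadraticChar_eq_pow_of_char_ne_two' (by rwa [hchar]),
    ← map_intCast (algebraMap k L), quadraticChar_eq_pow_of_char_ne_two' hk, map_pow,
    FiniteField.algebraMap_norm_eq_pow_sum, ← pow_mul]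
  congr 1
  have h1 : Fintype.card L = Fintype.card k ^ Module.finrank k L := Module.card_eq_pow_finrank
  have h2 : Odd (Fintype.card k) := Nat.odd_iff.2 (FiniteField.odd_card_of_char_ne_two hk)
  obtain ⟨j, hj⟩ := h2
  rw [h1, Nat.card_eq_fintype_card, hj]
  have h4 := geom_sum_mul_add (2 * j) (Module.finrank k L)
  have h5 : (2 * j + 1) / 2 = j := by omega
  rw [h5, ← h4]
  set S := ∑ i ∈ Finset.range (Module.finrank k L), (2 * j + 1) ^ i
  rw [show S * (2 * j) = 2 * (S * j) by ring]
  omega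

theorem sum_comp_sq (hk : ringChar k ≠ 2) {R : Type*} [CommRing R] (g : k → R) :
    ∑ y : k, g (y ^ 2) = ∑ s : k, (1 + (quadraticChar k s : R)) * g s := by
  rw [← Finset.sum_fiberwise (s := Finset.univ) (g := fun y : k => y ^ 2)]
  refine Finset.sum_congr rfl fun s _ => ?_
  rw [Finset.sum_congr rfl (g := fun _ => g s) fun y hy => by rw [(Finset.mem_filter.1 hy).2],
    Finset.sum_const, nsmul_eq_mul]
  have := quadraticChar_card_sqrts hk s
  congr 1
  rw [add_comm, ← Int.cast_one, ← Int.cast_add, ← this]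
  simp only [Int.cast_natCast]
  congr 2
  ext y
  simp

theorem sum_quadraticChar_sq_sub (hk : ringChar k ≠ 2) {D : k} (hD : D ≠ 0) :
    ∑ y : k, quadraticChar k (y ^ 2 - D) = -1 := by
  have hsub : ∑ s : k, quadraticChar k (s - D) = 0 := by
    rw [← quadraticChar_sum_zero hk]
    exact Fintype.sum_equiv (Equiv.subRight D) _ _ fun _ => rfl
  have hneg (s : k) : quadraticChar k s * quadraticChar k (s - D) =
      quadraticChar k (-1) * (quadraticChar k s * quadraticChar k (D - s)) := by
    rw [mul_left_comm, ← map_mul _ (-1), neg_one_mul, neg_sub]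
  have hJ := jacobiSum_nontrivial_inv (quadraticChar_ne_one hk)
  rw [(quadraticChar_isQuadratic k).inv] at hJ
  rw [sum_comp_sq hk fun s => quadraticChar k (s - D)]
  simp only [add_mul, one_mul, Int.cast_id, Finset.sum_add_distrib, hsub, zero_add]
  simp only [hneg]
  rw [← Finset.mul_sum, sum_char_mul_char_sub _ _ hD, hJ, MulChar.mul_apply, ← sq,
    quadraticChar_sq_one hD, one_mul, mul_neg, ← sq,
    quadraticChar_sq_one (neg_ne_zero.2 one_ne_zero)]

theorem sum_quadraticChar_quadratic (hk : ringChar k ≠ 2) {A B C : k} (hA : A ≠ 0)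
    (hD : B ^ 2 - 4 * A * C ≠ 0) :
    ∑ x : k, quadraticChar k (A * x ^ 2 + B * x + C) = -quadraticChar k A := by
  have h2 : (2 : k) ≠ 0 := Ring.two_ne_zero hk
  have h2A : 2 * A ≠ 0 := mul_ne_zero h2 hA
  have e : ∀ x : k, quadraticChar k (A * x ^ 2 + B * x + C) =
      quadraticChar k A * quadraticChar k ((2 * A * x + B) ^ 2 - (B ^ 2 - 4 * A * C)) := by
    intro x
    have : (2 * A * x + B) ^ 2 - (B ^ 2 - 4 * A * C) = 2 ^ 2 * A * (A * x ^ 2 + B * x + C) := by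
      ring
    rw [this, map_mul, map_mul, quadraticChar_sq_one' h2]
    have := quadraticChar_sq_one hA
    linear_combination -(quadraticChar k (A * x ^ 2 + B * x + C)) * this
  have e2 : ∑ x : k, quadraticChar k ((2 * A * x + B) ^ 2 - (B ^ 2 - 4 * A * C)) =
      ∑ y : k, quadraticChar k (y ^ 2 - (B ^ 2 - 4 * A * C)) :=
    Fintype.sum_equiv ((Equiv.mulLeft₀ (2 * A) h2A).trans (Equiv.addRight B)) _ _ fun _ => rfl
  rw [Finset.sum_congr rfl fun x _ => e x, ← Finset.mul_sum, e2, sum_quadraticChar_sq_sub hk hD]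
  ring

end Quadratic

/-! ### Point counts on `y² = x (x² + a x + b)` over extensions of a finite field -/

section CubicPoly

open Polynomial

variable {k : Type*} [Field k]

/-- The polynomial `X (X² + a X + b)`. -/
def cubicPoly (a b : k) : k[X] := X * (X ^ 2 + C a * X + C b)

theorem natDegree_quadratic (a b : k) : (X ^ 2 + C a * X + C b).natDegree = 2 := by
  compute_degree!

theorem monic_quadratic (a b : k) : (X ^ 2 + C a * X + C b).Monic := by
  monicity!

theorem monic_cubicPoly (a b : k) : (cubicPoly a b).Monic :=
  monic_X.mul (monic_quadratic a b)

theorem natDegree_cubicPoly (a b : k) : (cubicPoly a b).natDegree = 3 := by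
  rw [cubicPoly, monic_X.natDegree_mul (monic_quadratic a b), natDegree_X, natDegree_quadratic]

theorem resultant_quadratic_quadratic (u w a b : k) :
    resultant (X ^ 2 + C u * X + C w) (X ^ 2 + C a * X + C b) =
      b * (u - a) ^ 2 - a * (w - b) * (u - a) + (w - b) ^ 2 := by
  have h : sylvester (X ^ 2 + C u * X + C w) (X ^ 2 + C a * X + C b) 2 2 =
      !![b, 0, w, 0; a, b, u, w; 1, a, 1, u; 0, 1, 0, 1] := by
    ext i j
    fin_cases i <;> fin_cases j <;>
      simp [sylvester, Fin.addCases, coeff_X, coeff_C]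
  rw [natDegree_quadratic, natDegree_quadratic, resultant, h, Matrix.det_succ_row_zero]
  simp [Fin.sum_univ_succ, Matrix.det_fin_three, Matrix.submatrix, Fin.succAbove]
  ring

theorem resultant_quadratic_cubicPoly (u w a b : k) :
    resultant (X ^ 2 + C u * X + C w) (cubicPoly a b) =
      w * (b * (u - a) ^ 2 - a * (w - b) * (u - a) + (w - b) ^ 2) := by
  have hX : resultant (X ^ 2 + C u * X + C w) (X : k[X]) 2 1 = w := by
    have h := resultant_X_sub_C_right (X ^ 2 + C u * X + C w) 2 0 (natDegree_quadratic u w).le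
    rw [C_0, sub_zero] at h
    simpa using h
  have hmul := resultant_mul_right (X ^ 2 + C u * X + C w) X (X ^ 2 + C a * X + C b) 2
    (natDegree_quadratic u w).le
  have hquad := resultant_quadratic_quadratic u w a b
  simp only [natDegree_quadratic, natDegree_X] at hquad hmul
  rw [hX, hquad] at hmul
  rw [natDegree_cubicPoly, natDegree_quadratic, cubicPoly, ← hmul]

end CubicPoly

section Cubic

open Polynomial

variable {k : Type*} [Field k] [Fintype k] [DecidableEq k] {a b : k}

/-- The sum of the values `λ(x (x² + a x + b))` of the quadratic character `λ`; it is minus the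
trace of Frobenius of the curve `y² = x (x² + a x + b)`. -/
def cubicSum (a b : k) : ℤ := ∑ x : k, quadraticChar k (x * (x ^ 2 + a * x + b))

/-- The values `λ(Res(g, X (X² + a X + b)))` of the quadratic character `λ`. -/
def cubicChar (a b : k) : k[X] → ℤ := resultantChar (quadraticChar k) (cubicPoly a b)

theorem monicMultiplicative_cubicChar (a b : k) : MonicMultiplicative (cubicChar a b) :=
  monicMultiplicative_resultantChar _ _

theorem sum_cubicChar_quadratic (hk : ringChar k ≠ 2) (hb : b ≠ 0)
    (hab : a ^ 2 - 4 * b ≠ 0) (w : k) :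
    ∑ u : k, cubicChar a b (X ^ 2 + C u * X + C w) =
      -quadraticChar k b * quadraticChar k w + if w = b then (Fintype.card k : ℤ) else 0 := by
  have hchar (u : k) : cubicChar a b (X ^ 2 + C u * X + C w) = quadraticChar k w *
      quadraticChar k (b * (u - a) ^ 2 + -(a * (w - b)) * (u - a) + (w - b) ^ 2) := by
    rw [cubicChar, resultantChar, resultant_quadratic_cubicPoly, map_mul]
    ring_nf
  have hshift : ∑ u : k, quadraticChar k
        (b * (u - a) ^ 2 + -(a * (w - b)) * (u - a) + (w - b) ^ 2) =
      ∑ y : k, quadraticChar k (b * y ^ 2 + -(a * (w - b)) * y + (w - b) ^ 2) :=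
    Fintype.sum_equiv (Equiv.subRight a) _ _ fun _ => rfl
  simp only [hchar]
  rw [← Finset.mul_sum, hshift]
  split_ifs with hw
  · subst hw
    have hsq (y : k) : quadraticChar k (w * y ^ 2 + -(a * (w - w)) * y + (w - w) ^ 2) =
        quadraticChar k w * (1 - if y = 0 then 1 else 0) := by
      rcases eq_or_ne y 0 with rfl | hy
      · simp
      · rw [if_neg hy, sub_self, mul_zero, neg_zero, zero_mul, add_zero, zero_pow two_ne_zero,
          add_zero, map_mul, quadraticChar_sq_one' hy, sub_zero]
    simp only [hsq]
    rw [← Finset.mul_sum, Finset.sum_sub_distrib]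
    simp only [Finset.sum_const, Finset.card_univ, nsmul_eq_mul, mul_one, Finset.sum_ite_eq',
      Finset.mem_univ, if_true]
    linear_combination (Fintype.card k : ℤ) * quadraticChar_sq_one hb
  · have hdisc : (-(a * (w - b))) ^ 2 - 4 * b * (w - b) ^ 2 =
        (w - b) ^ 2 * (a ^ 2 - 4 * b) := by
      ring
    rw [sum_quadraticChar_quadratic hk hb
      (hdisc ▸ mul_ne_zero (pow_ne_zero _ (sub_ne_zero.2 hw)) hab)]
    ring

theorem monicLSeries_cubicChar (hk : ringChar k ≠ 2) (hb : b ≠ 0) (hab : a ^ 2 - 4 * b ≠ 0) :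
    monicLSeries (cubicChar a b) = 1 + PowerSeries.C (cubicSum a b) * PowerSeries.X +
      PowerSeries.C (Fintype.card k : ℤ) * PowerSeries.X ^ 2 := by
  ext n
  rw [monicLSeries, PowerSeries.coeff_mk, map_add, map_add, PowerSeries.coeff_C_mul,
    PowerSeries.coeff_C_mul, PowerSeries.coeff_one, PowerSeries.coeff_X, PowerSeries.coeff_X_pow]
  rcases n with - | - | - | n
  · simp [monicsOfDegree_zero, (monicMultiplicative_cubicChar a b).map_one]
  · rw [zero_add, sum_monicsOfDegree_one]
    simp [cubicChar, resultantChar_X_sub_C, cubicSum, cubicPoly]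
  · rw [zero_add, one_add_one_eq_two, sum_monicsOfDegree_two]
    simp only [sum_cubicChar_quadratic hk hb hab]
    rw [Finset.sum_add_distrib, ← Finset.mul_sum, quadraticChar_sum_zero hk]
    simp
  · obtain ⟨c, hc⟩ := quadraticChar_exists_neg_one' hk
    have he : X ^ n * cubicPoly a b ∈ monicsOfDegree k (n + 3) := by
      rw [mem_monicsOfDegree, (monic_X_pow n).natDegree_mul (monic_cubicPoly a b), natDegree_X_pow,
        natDegree_cubicPoly]
      exact ⟨(monic_X_pow n).mul (monic_cubicPoly a b), rfl⟩
    rw [sum_monicsOfDegree_eq_zero (ζ := -1) he c.ne_zero (by decide) fun g hg => by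
      rw [cubicChar, resultantChar_homothety _ he hg (dvd_mul_left _ _), natDegree_cubicPoly, hc,
        Odd.neg_one_pow (by decide)]]
    simp

theorem hasLogDeriv_cubicChar (hk : ringChar k ≠ 2) (hb : b ≠ 0) (hab : a ^ 2 - 4 * b ≠ 0) :
    HasLogDeriv (1 - PowerSeries.C (-cubicSum a b) * PowerSeries.X +
      PowerSeries.C (Fintype.card k : ℤ) * PowerSeries.X ^ 2) (monicLogDeriv (cubicChar a b)) := by
  rw [map_neg, neg_mul, sub_neg_eq_add, ← monicLSeries_cubicChar hk hb hab]
  exact hasLogDeriv_monicLSeries (monicMultiplicative_cubicChar a b)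

theorem coeff_finrank_monicLogDeriv_cubicChar (hk : ringChar k ≠ 2) (a b : k) (L : Type*) [Field L]
    [Fintype L] [DecidableEq L] [Algebra k L] :
    PowerSeries.coeff (Module.finrank k L) (monicLogDeriv (cubicChar a b)) =
      cubicSum (algebraMap k L a) (algebraMap k L b) := by
  simp only [coeff_finrank_monicLogDeriv, cubicChar, resultantChar_minpoly_pow,
    normChar_quadraticChar hk L, cubicSum]
  simp [cubicPoly]

end Cubic

section Singular

variable {k : Type*} [Field k] [Fintype k] [DecidableEq k]

theorem sum_quadraticChar_mul_sq (hk : ringChar k ≠ 2) (g c : k) :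
    ∑ x : k, quadraticChar k ((x + g) * (x + c) ^ 2) = -quadraticChar k (g - c) := by
  have hterm (x : k) : quadraticChar k ((x + g) * (x + c) ^ 2) =
      quadraticChar k (x + g) - if x = -c then quadraticChar k (g - c) else 0 := by
    split_ifs with h
    · rw [h, neg_add_cancel, zero_pow two_ne_zero, mul_zero, MulChar.map_zero, neg_add_eq_sub,
        sub_self]
    · rw [map_mul, quadraticChar_sq_one' (h ∘ eq_neg_of_add_eq_zero_left), mul_one, sub_zero]
  simp only [hterm]
  rw [Finset.sum_sub_distrib, Finset.sum_ite_eq' Finset.univ, if_pos (Finset.mem_univ _),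
    Fintype.sum_equiv (Equiv.addRight g) (fun x => quadraticChar k (x + g)) (quadraticChar k)
      (fun x => rfl), quadraticChar_sum_zero hk, zero_sub]

theorem cubicSum_zero_right (hk : ringChar k ≠ 2) (a : k) :
    cubicSum a 0 = -quadraticChar k a := by
  rw [cubicSum, ← sub_zero a, ← sum_quadraticChar_mul_sq hk a 0]
  refine Finset.sum_congr rfl fun x _ => congrArg _ ?_
  ring

theorem cubicSum_of_discrim_eq_zero (hk : ringChar k ≠ 2) {a b : k} (h : a ^ 2 - 4 * b = 0) :
    cubicSum a b = -quadraticChar k (-a / 2) := by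
  have h2 : (2 : k) ≠ 0 := Ring.two_ne_zero hk
  have hfactor (x : k) : x * (x ^ 2 + a * x + b) = (x + 0) * (x + a / 2) ^ 2 := by
    field_simp
    linear_combination -x * h
  simp only [cubicSum, hfactor]
  rw [sum_quadraticChar_mul_sq hk, zero_sub, neg_div]

theorem quadraticChar_algebraMap (hk : ringChar k ≠ 2) (L : Type*) [Field L] [Fintype L]
    [DecidableEq L] [Algebra k L] (c : k) :
    quadraticChar L (algebraMap k L c) = quadraticChar k c ^ Module.finrank k L := by
  rw [← normChar_quadraticChar hk L, normChar_apply, Algebra.norm_algebraMap, map_pow]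

theorem cubicSum_algebraMap_of_singular (hk : ringChar k ≠ 2) {a b : k}
    (h : b = 0 ∨ a ^ 2 - 4 * b = 0) (L : Type*) [Field L] [Fintype L] [DecidableEq L]
    [Algebra k L] : cubicSum (algebraMap k L a) (algebraMap k L b) =
      -(-cubicSum a b) ^ Module.finrank k L := by
  have hL : ringChar L ≠ 2 := by rwa [← Algebra.ringChar_eq k L]
  rcases h with rfl | h
  · rw [map_zero, cubicSum_zero_right hL, cubicSum_zero_right hk, neg_neg,
      quadraticChar_algebraMap hk]
  · have hLd : algebraMap k L a ^ 2 - 4 * algebraMap k L b = 0 := by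
      rw [← map_zero (algebraMap k L), ← h, map_sub, map_mul, map_pow, map_ofNat]
    rw [cubicSum_of_discrim_eq_zero hL hLd, cubicSum_of_discrim_eq_zero hk h, neg_neg,
      ← quadraticChar_algebraMap hk, map_div₀ (algebraMap k L), map_neg (algebraMap k L),
      map_ofNat (algebraMap k L)]

end Singular

/-! ### Characters of order dividing `D` -/

theorem sum_eq_zero_add_sum_units {G R : Type*} [GroupWithZero G] [Fintype G] [Fintype Gˣ]
    [AddCommMonoid R] (g : G → R) : ∑ x : G, g x = g 0 + ∑ u : Gˣ, g u := by
  classical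
  rw [← Finset.add_sum_erase _ _ (Finset.mem_univ (0 : G)), ← Finset.filter_ne',
    Finset.sum_subtype (p := fun x : G => x ≠ 0) _ (by simp)]
  exact congr_arg (g 0 + ·) (Fintype.sum_equiv unitsEquivNeZero _ _ fun _ => rfl).symm

section TorsionChars

variable (L R : Type*) [Field L] [Finite L] [CommRing R] [IsDomain R]

/-- The multiplicative characters `χ` of a finite field with `χ ^ D = 1`. -/
def torsionChars (D : ℕ) : Finset (MulChar L R) := (Set.toFinite {χ | χ ^ D = 1}).toFinset

variable {L R} {D : ℕ}

@[simp]
theorem mem_torsionChars {χ : MulChar L R} : χ ∈ torsionChars L R D ↔ χ ^ D = 1 := by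
  simp [torsionChars]

theorem filter_torsionChars (D E : ℕ) [DecidablePred fun χ : MulChar L R => χ ^ E = 1] :
    (torsionChars L R D).filter (· ^ E = 1) = torsionChars L R (D.gcd E) := by
  ext χ
  simp only [Finset.mem_filter, mem_torsionChars, pow_gcd_eq_one]

variable [HasEnoughRootsOfUnity R (Monoid.exponent Lˣ)]

theorem card_torsionChars [Fintype L] [DecidableEq L] (D : ℕ) :
    (torsionChars L R D).card = (Finset.univ.filter fun u : Lˣ => u ^ D = 1).card := by
  obtain ⟨e⟩ := MulChar.mulEquiv_units L R
  refine Finset.card_equiv e.toEquiv fun χ => ?_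
  simp [← map_pow]

theorem card_torsionChars_le (hD : D ≠ 0) : (torsionChars L R D).card ≤ D := by
  classical
  have := Fintype.ofFinite L
  rw [card_torsionChars]
  exact IsCyclic.card_pow_eq_one_le (Nat.pos_of_ne_zero hD)

theorem exists_torsionChar_apply_ne_one {s : Lˣ} (hs : ∀ u : Lˣ, u ^ D ≠ s) :
    ∃ χ ∈ torsionChars L R D, χ (s : L) ≠ 1 := by
  set H := (powMonoidHom D : Lˣ →* Lˣ).range
  have : HasEnoughRootsOfUnity R (Monoid.exponent (Lˣ ⧸ H)) := .of_dvd R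
    (MonoidHom.exponent_dvd (QuotientGroup.mk'_surjective H))
  have hne : (s : Lˣ ⧸ H) ≠ 1 := by
    rw [Ne, QuotientGroup.eq_one_iff]
    rintro ⟨u, hu⟩
    exact hs u hu
  obtain ⟨φ, hφ⟩ := CommGroup.exists_apply_ne_one_of_hasEnoughRootsOfUnity (Lˣ ⧸ H) R hne
  refine ⟨MulChar.ofUnitHom (φ.comp (QuotientGroup.mk' H)), ?_, ?_⟩
  · rw [mem_torsionChars]
    ext u
    have hu : QuotientGroup.mk' H (u ^ D) = 1 := (QuotientGroup.eq_one_iff _).2 ⟨u, rfl⟩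
    rw [MulChar.pow_apply_coe, MulChar.ofUnitHom_coe, MulChar.one_apply_coe,
      ← Units.val_pow_eq_pow_val, ← map_pow, MonoidHom.comp_apply, hu, map_one, Units.val_one]
  · rw [MulChar.ofUnitHom_coe]
    exact fun h => hφ (Units.ext h)

variable [Fintype L] [DecidableEq L]

theorem sum_torsionChars_apply (D : ℕ) (s : Lˣ) :
    ∑ χ ∈ torsionChars L R D, χ (s : L) =
      ((Finset.univ.filter fun u : Lˣ => u ^ D = s).card : R) := by
  by_cases hs : ∃ u : Lˣ, u ^ D = s
  · have hone : ∀ χ ∈ torsionChars L R D, χ (s : L) = 1 := by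
      obtain ⟨u, rfl⟩ := hs
      intro χ hχ
      rw [Units.val_pow_eq_pow_val, map_pow, ← MulChar.pow_apply_coe, mem_torsionChars.1 hχ,
        MulChar.one_apply_coe]
    rw [Finset.sum_congr rfl hone, Finset.sum_const, nsmul_one, card_torsionChars]
    congr 1
    exact MonoidHom.card_fiber_eq_of_mem_range (powMonoidHom D) ⟨1, one_pow D⟩ hs
  · push Not at hs
    rw [Finset.filter_false_of_mem fun u _ => hs u, Finset.card_empty, Nat.cast_zero]
    obtain ⟨ψ, hψ, hψs⟩ := exists_torsionChar_apply_ne_one (R := R) hs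
    rw [mem_torsionChars] at hψ
    have hinv : ∑ χ ∈ torsionChars L R D, χ (s : L) =
        ψ (s : L) * ∑ χ ∈ torsionChars L R D, χ (s : L) := by
      rw [Finset.mul_sum]
      refine Finset.sum_nbij' (ψ⁻¹ * ·) (ψ * ·) (fun χ hχ => ?_) (fun χ hχ => ?_)
        (fun _ _ => mul_inv_cancel_left _ _) (fun _ _ => inv_mul_cancel_left _ _) fun χ _ => ?_
      · simp [mul_pow, inv_pow, hψ, mem_torsionChars.1 hχ]
      · simp [mul_pow, hψ, mem_torsionChars.1 hχ]
      · rw [← MulChar.mul_apply, mul_inv_cancel_left]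
    by_contra hne
    exact hψs (mul_right_cancel₀ hne (by rw [← hinv, one_mul]))

theorem sum_units_pow (D : ℕ) (g : L → R) :
    ∑ u : Lˣ, g ((u : L) ^ D) = ∑ χ ∈ torsionChars L R D, ∑ s : L, χ s * g s := by
  have hfiber (s : Lˣ) : ∑ u with u ^ D = s, g ((u : L) ^ D) =
      ∑ χ ∈ torsionChars L R D, χ (s : L) * g s := by
    rw [← Finset.sum_mul, sum_torsionChars_apply, ← nsmul_eq_mul, ← Finset.sum_const]
    refine Finset.sum_congr rfl fun u hu => ?_
    rw [← (Finset.mem_filter.1 hu).2, Units.val_pow_eq_pow_val]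
  rw [← Finset.sum_fiberwise (s := Finset.univ) (g := fun u : Lˣ => u ^ D)]
  simp only [hfiber, sum_eq_zero_add_sum_units (G := L), MulChar.map_zero, zero_mul, zero_add]
  exact Finset.sum_comm

end TorsionChars

instance hasEnoughRootsOfUnity_exponent (G : Type*) [Group G] [Finite G] :
    HasEnoughRootsOfUnity QBar (Monoid.exponent G) :=
  have : NeZero (Monoid.exponent G : QBar) :=
    ⟨Nat.cast_ne_zero.2 Monoid.exponent_ne_zero_of_finite⟩
  inferInstance

/-! ### The quadratic character with values in `QBar` -/

theorem four_ne_zero_of_ringChar_ne_two {L : Type*} [Field L] (hL : ringChar L ≠ 2) :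
    (4 : L) ≠ 0 := by
  rw [← two_add_two_eq_four, ← two_mul]
  exact mul_ne_zero (Ring.two_ne_zero hL) (Ring.two_ne_zero hL)

section QuadChar

variable {L : Type*} [Field L] [Fintype L]

theorem quadChar_apply [DecidableEq L] (x : L) : quadChar L x = (quadraticChar L x : QBar) := by
  rw [quadChar, MulChar.ringHomComp_apply, eq_intCast]
  congr!

theorem quadChar_sq : quadChar L ^ 2 = 1 := by
  classical
  ext x
  rw [MulChar.pow_apply_coe, quadChar_apply, MulChar.one_apply_coe]
  exact_mod_cast quadraticChar_sq_one x.ne_zero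

theorem quadChar_inv : (quadChar L)⁻¹ = quadChar L := by
  rw [inv_eq_iff_mul_eq_one, ← sq, quadChar_sq]

theorem quadChar_ne_one (hL : ringChar L ≠ 2) : quadChar L ≠ 1 := by
  classical
  obtain ⟨a, ha⟩ := quadraticChar_exists_neg_one' hL
  refine MulChar.ne_one_iff.2 ⟨a, ?_⟩
  rw [quadChar_apply, ha]
  norm_num

theorem quadChar_apply_sq {x : L} (hx : x ≠ 0) : quadChar L (x ^ 2) = 1 := by
  rw [map_pow, ← MulChar.pow_apply' _ two_ne_zero, quadChar_sq,
    MulChar.one_apply (isUnit_iff_ne_zero.2 hx)]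

theorem quadChar_four (hL : ringChar L ≠ 2) : quadChar L 4 = 1 := by
  rw [show (4 : L) = 2 ^ 2 by norm_num, quadChar_apply_sq (Ring.two_ne_zero hL)]

open Classical in
theorem torsionChars_two (hL : ringChar L ≠ 2) : torsionChars L QBar 2 = {1, quadChar L} := by
  refine (Finset.eq_of_subset_of_card_le (fun χ hχ => ?_) ?_).symm
  · rcases Finset.mem_insert.1 hχ with rfl | hχ
    · simp
    · rw [Finset.mem_singleton.1 hχ, mem_torsionChars, quadChar_sq]
  · rw [Finset.card_pair (quadChar_ne_one hL).symm]
    exact card_torsionChars_le two_ne_zero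

theorem eq_quadChar_of_sq_eq_one (hL : ringChar L ≠ 2) {χ : MulChar L QBar} (h : χ ^ 2 = 1)
    (h1 : χ ≠ 1) : χ = quadChar L := by
  classical
  have hmem := mem_torsionChars.2 h
  rw [torsionChars_two hL, Finset.mem_insert, Finset.mem_singleton] at hmem
  exact hmem.resolve_left h1

theorem sum_quadChar_comp_sq (hL : ringChar L ≠ 2) (g : L → QBar) :
    ∑ y : L, g (y ^ 2) = ∑ s : L, (1 + quadChar L s) * g s := by
  classical
  rw [sum_comp_sq hL]
  simp only [quadChar_apply]

theorem jacobiSum_quadChar (hL : ringChar L ≠ 2) {χ : MulChar L QBar} (hχ : χ ≠ 1) :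
    jacobiSum χ (quadChar L) = χ 4 * jacobiSum χ χ := by
  have hsub : ∑ s : L, χ (1 - s) = 0 := by
    rw [← MulChar.sum_eq_zero_of_ne_one hχ]
    exact Fintype.sum_equiv (Equiv.subLeft 1) _ _ fun _ => rfl
  calc jacobiSum χ (quadChar L)
    _ = ∑ y : L, χ (1 - y ^ 2) := by
      rw [sum_quadChar_comp_sq hL fun s => χ (1 - s), jacobiSum_comm]
      simp only [add_mul, one_mul, Finset.sum_add_distrib, hsub, zero_add, jacobiSum]
    _ = ∑ u : L, χ 4 * (χ u * χ (1 - u)) := by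
      symm
      refine Fintype.sum_equiv ((Equiv.mulLeft₀ 2 (Ring.two_ne_zero hL)).trans (Equiv.subRight 1))
        _ _ fun u => ?_
      rw [← map_mul, ← map_mul]
      congr 1
      change _ = 1 - (2 * u - 1) ^ 2
      ring
    _ = χ 4 * jacobiSum χ χ := by rw [← Finset.mul_sum, jacobiSum]

end QuadChar

/-! ### Character sums of the family `y² = x (x² + s x - 4 s)` -/

section FamilySum

variable {L : Type*} [Field L] [Fintype L]

/-- The number `χ²(4) J(χ, χ) J(λ χ², χ⁻¹)` attached to a character `χ`, where `J` is the Jacobi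
sum and `λ` the quadratic character. -/
def charB (χ : MulChar L QBar) : QBar :=
  (χ ^ 2) 4 * jacobiSum χ χ * jacobiSum (quadChar L * χ ^ 2) χ⁻¹

theorem sum_char_mul_quadChar_fiber (hL : ringChar L ≠ 2) (χ : MulChar L QBar) (x : L)
    [Decidable (x = 4)] :
    ∑ s : L, χ s * quadChar L (x * (x ^ 2 + s * x + -4 * s)) =
      (if x = 4 then ∑ s : L, χ s else 0) +
        jacobiSum χ (quadChar L) * ((quadChar L * χ ^ 2) x * χ⁻¹ (4 - x)) := by
  rcases eq_or_ne x 0 with rfl | hx0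
  · simp [(four_ne_zero_of_ringChar_ne_two hL).symm, MulChar.map_zero]
  rcases eq_or_ne x 4 with rfl | hx4
  · have h8 : quadChar L ((8 : L) ^ 2) = 1 := quadChar_apply_sq <| by
      rw [show (8 : L) = 2 ^ 3 by norm_num]
      exact pow_ne_zero _ (Ring.two_ne_zero hL)
    have h (s : L) : (4 : L) * (4 ^ 2 + s * 4 + -4 * s) = 8 ^ 2 := by ring
    simp only [h, h8, mul_one, if_true, sub_self, MulChar.map_zero, mul_zero, add_zero]
  · have h4x : 4 - x ≠ 0 := sub_ne_zero.2 hx4.symm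
    have hzero : x ^ 2 / (4 - x) ≠ 0 := div_ne_zero (pow_ne_zero _ hx0) h4x
    -- For fixed `x` the cubic is linear in `s`, with zero `x² / (4 - x)`.
    have hlin (s : L) : x * (x ^ 2 + s * x + -4 * s) =
        x * (4 - x) * (x ^ 2 / (4 - x) - s) := by
      field_simp
      ring
    have hval : quadChar L (x * (4 - x)) * (χ * quadChar L) (x ^ 2 / (4 - x)) =
        (quadChar L * χ ^ 2) x * χ⁻¹ (4 - x) := by
      have hcube : x * (4 - x) * (x ^ 2 / (4 - x)) = x ^ 2 * x := by field_simp
      rw [MulChar.mul_apply, mul_left_comm, ← map_mul, hcube, map_mul, quadChar_apply_sq hx0,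
        MulChar.mul_apply, MulChar.inv_apply', MulChar.pow_apply' _ two_ne_zero, div_eq_mul_inv,
        map_mul, map_pow]
      ring
    rw [if_neg hx4, zero_add, ← hval]
    simp only [hlin, map_mul, mul_left_comm (χ _), mul_assoc]
    rw [← Finset.mul_sum, ← Finset.mul_sum, sum_char_mul_char_sub _ _ hzero]
    ring

variable [DecidableEq L]

theorem cast_cubicSum (a b : L) :
    (cubicSum a b : QBar) = ∑ x : L, quadChar L (x * (x ^ 2 + a * x + b)) := by
  simp only [cubicSum, Int.cast_sum, quadChar_apply]

theorem sum_char_mul_cubicSum (hL : ringChar L ≠ 2) (χ : MulChar L QBar) :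
    ∑ s : L, χ s * (cubicSum s (-4 * s) : QBar) =
      ∑ s : L, χ s + χ 4 * jacobiSum χ (quadChar L) * jacobiSum (quadChar L * χ ^ 2) χ⁻¹ := by
  have hχ : (quadChar L * χ ^ 2 * χ⁻¹) 4 = χ 4 := by
    rw [mul_assoc, sq, mul_inv_cancel_right, MulChar.mul_apply, quadChar_four hL, one_mul]
  simp only [cast_cubicSum, Finset.mul_sum]
  rw [Finset.sum_comm]
  simp only [sum_char_mul_quadChar_fiber hL]
  rw [Finset.sum_add_distrib, Finset.sum_ite_eq', if_pos (Finset.mem_univ _), ← Finset.mul_sum,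
    sum_char_mul_char_sub _ _ (four_ne_zero_of_ringChar_ne_two hL), hχ]
  ring

theorem sum_char_mul_cubicSum_of_ne_one (hL : ringChar L ≠ 2) {χ : MulChar L QBar} (hχ : χ ≠ 1) :
    ∑ s : L, χ s * (cubicSum s (-4 * s) : QBar) = charB χ := by
  rw [sum_char_mul_cubicSum hL, MulChar.sum_eq_zero_of_ne_one hχ, jacobiSum_quadChar hL hχ, charB,
    MulChar.pow_apply' _ two_ne_zero]
  ring

theorem sum_char_mul_cubicSum_one (hL : ringChar L ≠ 2) :
    ∑ s : L, (1 : MulChar L QBar) s * (cubicSum s (-4 * s) : QBar) = Fintype.card L := by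
  have h4 := isUnit_iff_ne_zero.2 (four_ne_zero_of_ringChar_ne_two hL)
  rw [sum_char_mul_cubicSum hL, MulChar.sum_one_eq_card_units, one_pow, mul_one, inv_one,
    jacobiSum_comm (quadChar L), jacobiSum_one_nontrivial (quadChar_ne_one hL),
    MulChar.one_apply h4, Fintype.card_eq_card_units_add_one (α := L)]
  push_cast
  ring

omit [DecidableEq L] in
theorem charB_quadChar (hL : ringChar L ≠ 2) : charB (quadChar L) = 1 := by
  have hJ := jacobiSum_nontrivial_inv (quadChar_ne_one hL)
  rw [quadChar_inv] at hJ
  have h4 := isUnit_iff_ne_zero.2 (four_ne_zero_of_ringChar_ne_two hL)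
  rw [charB, quadChar_sq, mul_one, quadChar_inv, hJ, MulChar.one_apply h4, one_mul, neg_mul_neg,
    ← sq, ← map_pow, quadChar_apply_sq (neg_ne_zero.2 one_ne_zero)]

theorem sum_torsionChars_two_cubicSum (hL : ringChar L ≠ 2) :
    ∑ χ ∈ torsionChars L QBar 2, ∑ s : L, χ s * (cubicSum s (-4 * s) : QBar) =
      Fintype.card L + 1 := by
  classical
  have hne := quadChar_ne_one hL
  rw [torsionChars_two hL, Finset.sum_pair hne.symm, sum_char_mul_cubicSum_one hL,
    sum_char_mul_cubicSum_of_ne_one hL hne, charB_quadChar hL]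

omit [DecidableEq L] in
theorem charB_of_sq_eq_quadChar (hL : ringChar L ≠ 2) {χ : MulChar L QBar}
    (hχ : χ ^ 2 = quadChar L) : charB χ = -∑ s : L, χ s * quadChar L (s - 4) := by
  have hχ1 : χ ≠ 1 := by
    rintro rfl
    exact quadChar_ne_one hL (by simpa using hχ.symm)
  have hneg : quadChar L (-1) = 1 := by
    rw [← hχ, MulChar.pow_apply' _ two_ne_zero, ← map_pow, neg_one_sq, map_one]
  have hsub (s : L) : quadChar L (s - 4) = quadChar L (4 - s) := by
    rw [← neg_sub, ← neg_one_mul, map_mul, hneg, one_mul]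
  simp only [hsub]
  rw [sum_char_mul_char_sub _ _ (four_ne_zero_of_ringChar_ne_two hL), MulChar.mul_apply,
    quadChar_four hL, jacobiSum_quadChar hL hχ1, charB, MulChar.pow_apply' _ two_ne_zero, hχ, ← sq,
    quadChar_sq, jacobiSum_one_nontrivial (inv_ne_one.2 hχ1)]
  ring

theorem sum_charB_order_four (hL : ringChar L ≠ 2)
    [DecidablePred fun χ : MulChar L QBar => χ ^ 2 = 1] :
    ∑ χ ∈ torsionChars L QBar 4 with ¬χ ^ 2 = 1, charB χ = -(cubicSum (0 : L) (-4) : QBar) := by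
  have hcharB : ∀ χ ∈ torsionChars L QBar 4, ¬χ ^ 2 = 1 →
      charB χ = -∑ s : L, χ s * quadChar L (s - 4) := fun χ hχ hχ2 =>
    charB_of_sq_eq_quadChar hL <| eq_quadChar_of_sq_eq_one hL
      (by rw [← pow_mul]; exact mem_torsionChars.1 hχ) hχ2
  have hfour := sum_units_pow 4 fun s : L => quadChar L (s - 4)
  have htwo := sum_units_pow 2 fun s : L => quadChar L (s - 4)
  rw [← Finset.sum_filter_add_sum_filter_not (torsionChars L QBar 4) (· ^ 2 = 1),
    filter_torsionChars,
    show Nat.gcd 4 2 = 2 from rfl, ← htwo] at hfour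
  have hall4 := sum_eq_zero_add_sum_units fun x : L => quadChar L (x ^ 4 - 4)
  have hall2 := sum_eq_zero_add_sum_units fun x : L => quadChar L (x ^ 2 - 4)
  have hsq : ∑ x : L, quadChar L (x ^ 4 - 4) =
      ∑ x : L, quadChar L (x ^ 2 - 4) + cubicSum (0 : L) (-4) := by
    have h := sum_quadChar_comp_sq hL fun s => quadChar L (s ^ 2 - 4)
    simp only [← pow_mul, add_mul, one_mul, Finset.sum_add_distrib, ← map_mul] at h
    rw [h, cast_cubicSum]
    ring_nf
  rw [Finset.sum_filter, Finset.sum_congr rfl fun χ hχ => by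
    rw [← ite_congr rfl (fun h => (hcharB χ hχ h).symm) fun _ => rfl], ← Finset.sum_filter,
    Finset.sum_neg_distrib]
  simp only [ne_eq, OfNat.ofNat_ne_zero, not_false_eq_true, zero_pow] at hall4 hall2
  linear_combination hfour + hall4 - hall2 - hsq

/-- The sum over `x` of the quadratic character of the cubic defining a minimal model of the curve
`E_d` at a point `t = τ` of the affine line. At `τ = 0` that cubic is `x³ - 4 x` for even `d` and
the cuspidal cubic `x³` for odd `d`. -/
def fiberSum (d : ℕ) (τ : L) : ℤ :=
  if τ = 0 then (if Even d then cubicSum (0 : L) (-4) else 0)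
  else cubicSum (τ ^ (2 * d)) (-4 * τ ^ (2 * d))

open Classical in
/-- The characters of `L` that contribute to the `L`-function, corresponding to the index set
`Z_{2d}`. -/
def familyChars (L : Type*) [Field L] [Finite L] (d : ℕ) : Finset (MulChar L QBar) :=
  {χ ∈ torsionChars L QBar (2 * d) | χ ^ 4 ≠ 1}

omit [Fintype L] [DecidableEq L] in
theorem mem_familyChars [Finite L] {d : ℕ} {χ : MulChar L QBar} :
    χ ∈ familyChars L d ↔ χ ^ (2 * d) = 1 ∧ χ ^ 4 ≠ 1 := by
  simp only [familyChars, Finset.mem_filter, mem_torsionChars]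

theorem fiberSum_zero_add_sum_torsionChars (hL : ringChar L ≠ 2) (d : ℕ)
    [DecidablePred fun χ : MulChar L QBar => χ ^ 4 = 1] :
    (fiberSum d (0 : L) : QBar) + ∑ χ ∈ torsionChars L QBar (2 * d) with χ ^ 4 = 1,
      ∑ s : L, χ s * (cubicSum s (-4 * s) : QBar) = Fintype.card L + 1 := by
  classical
  have hgcd : (2 * d).gcd 4 = 2 * d.gcd 2 := Nat.gcd_mul_left 2 d 2
  rw [filter_torsionChars, hgcd, fiberSum, if_pos rfl]
  split_ifs with hd
  · have hsplit := Finset.sum_filter_add_sum_filter_not (torsionChars L QBar 4) (· ^ 2 = 1)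
      fun χ => ∑ s : L, χ s * (cubicSum s (-4 * s) : QBar)
    have hcharB : ∀ χ ∈ (torsionChars L QBar 4).filter (¬· ^ 2 = 1),
        ∑ s : L, χ s * (cubicSum s (-4 * s) : QBar) = charB χ := by
      intro χ hχ
      refine sum_char_mul_cubicSum_of_ne_one hL ?_
      rintro rfl
      exact (Finset.mem_filter.1 hχ).2 (one_pow 2)
    rw [Finset.sum_congr rfl hcharB, sum_charB_order_four hL, filter_torsionChars,
      show Nat.gcd 4 2 = 2 from rfl, sum_torsionChars_two_cubicSum hL] at hsplit
    rw [Nat.gcd_eq_right hd.two_dvd, show 2 * 2 = 4 from rfl, ← hsplit]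
    ring
  · rw [Nat.Coprime.gcd_eq_one (Nat.not_even_iff_odd.1 hd).coprime_two_right,
      sum_torsionChars_two_cubicSum hL, Int.cast_zero, zero_add]

theorem sum_fiberSum (hL : ringChar L ≠ 2) (d : ℕ) :
    ∑ τ : L, (fiberSum d τ : QBar) = Fintype.card L + 1 + ∑ χ ∈ familyChars L d, charB χ := by
  classical
  have hunits (u : Lˣ) : fiberSum d (u : L) = cubicSum ((u : L) ^ (2 * d)) (-4 * u ^ (2 * d)) :=
    if_neg u.ne_zero
  have hcharB : ∀ χ ∈ familyChars L d,
      ∑ s : L, χ s * (cubicSum s (-4 * s) : QBar) = charB χ := by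
    intro χ hχ
    refine sum_char_mul_cubicSum_of_ne_one hL ?_
    rintro rfl
    exact (mem_familyChars.1 hχ).2 (one_pow 4)
  have hfilter : (torsionChars L QBar (2 * d)).filter (¬· ^ 4 = 1) = familyChars L d := by
    ext χ
    rw [Finset.mem_filter, mem_torsionChars, mem_familyChars]
  rw [sum_eq_zero_add_sum_units]
  simp only [hunits]
  rw [sum_units_pow (2 * d) fun s : L => (cubicSum s (-4 * s) : QBar),
    ← Finset.sum_filter_add_sum_filter_not _ (· ^ 4 = 1), ← add_assoc,
    fiberSum_zero_add_sum_torsionChars hL, hfilter, Finset.sum_congr rfl hcharB]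

end FamilySum

/-! ### Minimal Weierstrass models -/

section Minimal

open WeierstrassCurve IsDiscreteValuationRing IsDedekindDomain.HeightOneSpectrum

theorem equation_variableChange {k : Type*} [Field k] (W : WeierstrassCurve k)
    (C : VariableChange k) (x y : k) :
    (C • W).toAffine.Equation x y ↔
      W.toAffine.Equation (C.u ^ 2 * x + C.r) (C.u ^ 3 * y + (C.u ^ 2 * C.s * x + C.t)) := by
  have hu : (C.u : k) ≠ 0 := C.u.ne_zero
  rw [Affine.equation_iff', Affine.equation_iff', ← mul_right_inj' (pow_ne_zero 6 hu), mul_zero]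
  simp only [variableChange_a₁, variableChange_a₂, variableChange_a₃, variableChange_a₄,
    variableChange_a₆, Units.val_inv_eq_inv_val]
  refine Eq.congr ?_ rfl
  field_simp
  ring

theorem card_equation_variableChange {k : Type*} [Field k] (W : WeierstrassCurve k)
    (C : VariableChange k) :
    Nat.card {P : k × k // (C • W).toAffine.Equation P.1 P.2} =
      Nat.card {P : k × k // W.toAffine.Equation P.1 P.2} := by
  have hu (n : ℕ) : (C.u : k) ^ n ≠ 0 := pow_ne_zero n C.u.ne_zero
  refine Nat.card_congr (Equiv.subtypeEquiv
    (Equiv.prodShear ((Equiv.mulLeft₀ _ (hu 2)).trans (Equiv.addRight C.r)) fun x =>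
      (Equiv.mulLeft₀ _ (hu 3)).trans (Equiv.addRight (C.u ^ 2 * C.s * x + C.t))) fun P => ?_)
  exact equation_variableChange W C P.1 P.2

theorem exists_algebraMap_eq_of_mul {R K : Type*} [CommRing R] [CommRing K] [Algebra R K] {x : K}
    {c y : R} (hc : IsUnit c) (h : algebraMap R K y = algebraMap R K c * x) :
    ∃ z : R, algebraMap R K z = x := by
  obtain ⟨c, rfl⟩ := hc
  refine ⟨(c⁻¹ : Rˣ) * y, ?_⟩
  rw [map_mul, h, ← mul_assoc, ← map_mul, Units.inv_mul, map_one, one_mul]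

section Integrality

variable {R K : Type*} [CommRing R] [Field K] [Algebra R K] {W₀ W₁ : WeierstrassCurve R}
  {C : VariableChange K} {u r : R}

theorem exists_algebraMap_eq_s (h2 : IsUnit (2 : R))
    (hC : C • W₀.map (algebraMap R K) = W₁.map (algebraMap R K)) (hu : algebraMap R K u = C.u) :
    ∃ s : R, algebraMap R K s = C.s := by
  have ha := congrArg WeierstrassCurve.a₁ hC
  rw [variableChange_a₁, map_a₁, map_a₁, Units.val_inv_eq_inv_val] at ha
  refine exists_algebraMap_eq_of_mul (y := u * W₁.a₁ - W₀.a₁) h2 ?_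
  rw [map_sub, map_mul, ← ha, hu, map_ofNat]
  field_simp
  ring

theorem exists_algebraMap_eq_t (h2 : IsUnit (2 : R))
    (hC : C • W₀.map (algebraMap R K) = W₁.map (algebraMap R K)) (hu : algebraMap R K u = C.u)
    (hr : algebraMap R K r = C.r) : ∃ t : R, algebraMap R K t = C.t := by
  have ha := congrArg WeierstrassCurve.a₃ hC
  rw [variableChange_a₃, map_a₁, map_a₃, map_a₃, Units.val_inv_eq_inv_val] at ha
  refine exists_algebraMap_eq_of_mul (y := u ^ 3 * W₁.a₃ - W₀.a₃ - r * W₀.a₁) h2 ?_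
  rw [map_sub, map_sub, map_mul, map_mul, ← ha, map_pow, hu, hr, map_ofNat]
  field_simp
  ring

variable [IsFractionRing R K]

theorem isUnit_of_algebraMap_eq_u [IsLocalRing R]
    (h₀ : IsUnit W₀.c₄ ∨ W₀.Δ ∉ IsLocalRing.maximalIdeal R ^ 12)
    (hC : C • W₀.map (algebraMap R K) = W₁.map (algebraMap R K)) (hu : algebraMap R K u = C.u) :
    IsUnit u := by
  have hinj := IsFractionRing.injective R K
  have hc₄ : W₀.c₄ = u ^ 4 * W₁.c₄ := by
    apply hinj
    rw [map_mul, map_pow, hu, ← map_c₄, ← map_c₄, ← hC, variableChange_c₄,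
      Units.val_inv_eq_inv_val]
    field_simp
  have hΔ : W₀.Δ = u ^ 12 * W₁.Δ := by
    apply hinj
    rw [map_mul, map_pow, hu, ← map_Δ, ← map_Δ, ← hC, variableChange_Δ, Units.val_inv_eq_inv_val]
    field_simp
  rcases h₀ with h₀ | h₀
  · rw [hc₄] at h₀
    exact (isUnit_pow_iff four_ne_zero).1 (isUnit_of_mul_isUnit_left h₀)
  · contrapose! h₀
    rw [hΔ]
    exact Ideal.mul_mem_right _ _ (Ideal.pow_mem_pow ((IsLocalRing.mem_maximalIdeal _).2 h₀) _)

theorem exists_algebraMap_eq_r [IsIntegrallyClosed R] (h2 : IsUnit (2 : R))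
    (hC : C • W₀.map (algebraMap R K) = W₁.map (algebraMap R K)) (hu : algebraMap R K u = C.u) :
    ∃ r : R, algebraMap R K r = C.r := by
  have hb := congrArg WeierstrassCurve.b₆ hC
  rw [variableChange_b₆, map_b₆, map_b₆, map_b₂, map_b₄, Units.val_inv_eq_inv_val, ← hu] at hb
  have huK : algebraMap R K u ≠ 0 := hu ▸ C.u.ne_zero
  field_simp at hb
  -- The transformation rule for `b₆` is a cubic equation for `r` with leading coefficient `4`.
  have hint : _root_.IsIntegral R (4 * C.r) := by
    refine ⟨.X ^ 3 + (.C W₀.b₂ * .X ^ 2 + .C (8 * W₀.b₄) * .X +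
      .C (16 * (W₀.b₆ - u ^ 6 * W₁.b₆))), Polynomial.monic_X_pow_add ?_, ?_⟩
    · exact Polynomial.degree_quadratic_le.trans_lt (by norm_num)
    · simp only [Polynomial.eval₂_add, Polynomial.eval₂_mul, Polynomial.eval₂_C,
        Polynomial.eval₂_X_pow, Polynomial.eval₂_X]
      simp only [map_mul, map_sub, map_pow, map_ofNat]
      linear_combination 16 * hb
  obtain ⟨y, hy⟩ := IsIntegrallyClosed.isIntegral_iff.1 hint
  have h4 : IsUnit (4 : R) := by
    rw [← two_add_two_eq_four, ← two_mul]
    exact h2.mul h2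
  exact exists_algebraMap_eq_of_mul h4 (by rw [hy, map_ofNat])

variable [IsDomain R] [IsDiscreteValuationRing R]

theorem valuation_Δ_le_of_isMinimal {W : WeierstrassCurve K} [IsMinimal R W]
    (C : VariableChange K) [h : IsIntegral R (C • W)] :
    (maximalIdeal R).valuation K (C • W).Δ ≤ (maximalIdeal R).valuation K W.Δ := by
  have hle : valuation_Δ_aux R (C • W) ≤ valuation_Δ_aux R W := by
    rcases le_total (valuation_Δ_aux R (C • W)) (valuation_Δ_aux R W) with hle | hle
    · exact hle
    · simpa using (IsMinimal.val_Δ_maximal (R := R) (W := W)).2 (j := C) h (by simpa using hle)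
  rwa [← Subtype.coe_le_coe, valuation_Δ_aux_eq_of_isIntegral, valuation_Δ_aux_eq_of_isIntegral]
    at hle

theorem exists_algebraMap_eq_u (hΔ : W₀.Δ ≠ 0)
    (hC : C • W₀.map (algebraMap R K) = W₁.map (algebraMap R K))
    [IsMinimal R (W₁.map (algebraMap R K))] : ∃ u : R, algebraMap R K u = C.u := by
  have hΔK : algebraMap R K W₀.Δ ≠ 0 := (map_ne_zero_iff _ (IsFractionRing.injective R K)).2 hΔ
  have hC' : C⁻¹ • W₁.map (algebraMap R K) = W₀.map (algebraMap R K) := by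
    rw [← hC, inv_smul_smul]
  have : IsIntegral R (C⁻¹ • W₁.map (algebraMap R K)) := hC' ▸ ⟨⟨W₀, rfl⟩⟩
  have hle := valuation_Δ_le_of_isMinimal (R := R) (W := W₁.map (algebraMap R K)) C⁻¹
  rw [hC', map_Δ, ← hC, variableChange_Δ, Units.val_inv_eq_inv_val, map_Δ, map_mul,
    le_mul_iff_one_le_left (zero_lt_iff.2 ((Valuation.ne_zero_iff _).2 hΔK)), map_pow,
    one_le_pow_iff_of_nonneg zero_le (by norm_num), map_inv₀,
    one_le_inv₀ (zero_lt_iff.2 ((Valuation.ne_zero_iff _).2 C.u.ne_zero))] at hle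
  exact exists_lift_of_le_one hle

theorem exists_integral_variableChange (h2 : IsUnit (2 : R)) (hΔ : W₀.Δ ≠ 0)
    (h₀ : IsUnit W₀.c₄ ∨ W₀.Δ ∉ IsLocalRing.maximalIdeal R ^ 12)
    (hC : C • W₀.map (algebraMap R K) = W₁.map (algebraMap R K))
    [IsMinimal R (W₁.map (algebraMap R K))] : ∃ C₀ : VariableChange R, C₀ • W₀ = W₁ := by
  obtain ⟨u, hu⟩ := exists_algebraMap_eq_u hΔ hC
  obtain ⟨r, hr⟩ := exists_algebraMap_eq_r h2 hC hu
  obtain ⟨s, hs⟩ := exists_algebraMap_eq_s h2 hC hu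
  obtain ⟨t, ht⟩ := exists_algebraMap_eq_t h2 hC hu hr
  let C₀ : VariableChange R := ⟨(isUnit_of_algebraMap_eq_u h₀ hC hu).unit, r, s, t⟩
  have hC₀ : C₀.map (algebraMap R K) = C := VariableChange.ext (Units.ext hu) hr hs ht
  exact ⟨C₀, map_injective (IsFractionRing.injective R K) <| by
    dsimp only
    rw [← map_variableChange, hC₀, hC]⟩

theorem exists_reduction_minimal_eq_smul (h2 : IsUnit (2 : R)) (hΔ : W₀.Δ ≠ 0)
    (h₀ : IsUnit W₀.c₄ ∨ W₀.Δ ∉ IsLocalRing.maximalIdeal R ^ 12) {W : WeierstrassCurve K}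
    (hC : C • W = W₀.map (algebraMap R K)) :
    ∃ C₁ : VariableChange (IsLocalRing.ResidueField R),
      (W.minimal R).reduction R = C₁ • W₀.map (IsLocalRing.residue R) := by
  have hW₁ : (integralModel R (W.minimal R)).map (algebraMap R K) = W.minimal R :=
    baseChange_integralModel_eq R _
  have : IsMinimal R ((integralModel R (W.minimal R)).map (algebraMap R K)) := by
    rw [hW₁]
    infer_instance
  obtain ⟨C₀, hC₀⟩ := exists_integral_variableChange h2 hΔ h₀
    (C := (W.exists_isMinimal R).choose * C⁻¹) (W₁ := integralModel R (W.minimal R)) (by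
      rw [hW₁, mul_smul, ← hC, inv_smul_smul]
      rfl)
  exact ⟨C₀.map (IsLocalRing.residue R), by rw [map_variableChange, hC₀]; rfl⟩

end Integrality

end Minimal

/-- The curve `y² = x (x² + a x + b)`. -/
def twoTorsionCurve {R : Type*} [CommRing R] (a b : R) : WeierstrassCurve R := ⟨0, a, 0, b, 0⟩

theorem twoTorsionCurve_Δ {R : Type*} [CommRing R] (a b : R) :
    (twoTorsionCurve a b).Δ = 16 * b ^ 2 * (a ^ 2 - 4 * b) := by
  simp only [twoTorsionCurve, WeierstrassCurve.Δ, WeierstrassCurve.b₂, WeierstrassCurve.b₄,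
    WeierstrassCurve.b₆, WeierstrassCurve.b₈]
  ring

theorem twoTorsionCurve_c₄ {R : Type*} [CommRing R] (a b : R) :
    (twoTorsionCurve a b).c₄ = 16 * (a ^ 2 - 3 * b) := by
  simp only [twoTorsionCurve, WeierstrassCurve.c₄, WeierstrassCurve.b₂, WeierstrassCurve.b₄]
  ring

theorem twoTorsionCurve_map {R S : Type*} [CommRing R] [CommRing S] (a b : R) (φ : R →+* S) :
    (twoTorsionCurve a b).map φ = twoTorsionCurve (φ a) (φ b) := by
  ext <;> simp [twoTorsionCurve]

theorem card_twoTorsionCurve {k : Type*} [Field k] [Fintype k] [DecidableEq k]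
    (hk : ringChar k ≠ 2) (a b : k) :
    (Nat.card {P : k × k // (twoTorsionCurve a b).toAffine.Equation P.1 P.2} : ℤ) =
      Fintype.card k + cubicSum a b := by
  have heq (x y : k) : (twoTorsionCurve a b).toAffine.Equation x y ↔
      y ∈ {y : k | y ^ 2 = x * (x ^ 2 + a * x + b)}.toFinset := by
    rw [WeierstrassCurve.Affine.equation_iff, Set.mem_toFinset, Set.mem_ofPred_eq]
    simp only [twoTorsionCurve]
    constructor <;> intro h <;> linear_combination h
  have hcard : Nat.card {P : k × k // (twoTorsionCurve a b).toAffine.Equation P.1 P.2} =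
      ∑ x : k, {y : k | y ^ 2 = x * (x ^ 2 + a * x + b)}.toFinset.card := by
    simp only [heq]
    rw [Nat.card_congr (Equiv.subtypeProdEquivSigmaSubtype fun x y =>
      y ∈ {y : k | y ^ 2 = x * (x ^ 2 + a * x + b)}.toFinset), Nat.card_sigma]
    simp only [Nat.card_eq_fintype_card, Fintype.card_coe]
  rw [hcard, Nat.cast_sum]
  simp only [quadraticChar_card_sqrts hk, Finset.sum_add_distrib, cubicSum, Finset.sum_const,
    Finset.card_univ, nsmul_one]
  exact add_comm _ _

/-- The curve `W` has a minimal model at `v` with reduction `y² = x (x² + α x + β)`, as far as the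
Euler factor can tell. -/
structure Place.ReducesTo {F : Type*} [Field F] (v : Place F) [Fintype v.residueField]
    [DecidableEq v.residueField] (W : WeierstrassCurve (RatFunc F)) (α β : v.residueField) :
    Prop where
  trace_eq : v.trace W = -cubicSum α β
  hasGoodReduction_iff :
    (W.minimal v.ring).HasGoodReduction v.ring ↔ β ≠ 0 ∧ α ^ 2 - 4 * β ≠ 0

theorem Place.reducesTo_of_smul_eq_twoTorsionCurve {F : Type*} [Field F] (v : Place F)
    [Fintype v.residueField] [DecidableEq v.residueField] (hk : ringChar v.residueField ≠ 2)
    {W : WeierstrassCurve (RatFunc F)} (hW : W.Δ ≠ 0) {a b : v.ring}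
    (h₀ : IsLocalRing.residue v.ring (a ^ 2 - 3 * b) ≠ 0 ∨
      b ^ 2 * (a ^ 2 - 4 * b) ∉ IsLocalRing.maximalIdeal v.ring ^ 12)
    {C : WeierstrassCurve.VariableChange (RatFunc F)}
    (hC : C • W = twoTorsionCurve (a : RatFunc F) b) :
    v.ReducesTo W (IsLocalRing.residue v.ring a) (IsLocalRing.residue v.ring b) := by
  have hCmap : C • W = (twoTorsionCurve a b).map (algebraMap v.ring (RatFunc F)) := by
    rw [hC, twoTorsionCurve_map]
    rfl
  have h2k : (2 : v.residueField) ≠ 0 := Ring.two_ne_zero hk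
  have h16k : (16 : v.residueField) ≠ 0 := by
    rw [show (16 : v.residueField) = 2 ^ 4 by norm_num]
    exact pow_ne_zero _ h2k
  have h2 : IsUnit (2 : v.ring) := (IsLocalRing.residue_ne_zero_iff_isUnit _).1 (by rwa [map_ofNat])
  have h16 : IsUnit (16 : v.ring) :=
    (IsLocalRing.residue_ne_zero_iff_isUnit _).1 (by rwa [map_ofNat])
  have hΔ : (twoTorsionCurve a b).Δ ≠ 0 := fun h => by
    have hΔW := congrArg WeierstrassCurve.Δ hCmap
    rw [WeierstrassCurve.map_Δ, h, map_zero, WeierstrassCurve.variableChange_Δ] at hΔW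
    exact mul_ne_zero (pow_ne_zero _ (Units.ne_zero _)) hW hΔW
  obtain ⟨C₁, hC₁⟩ := exists_reduction_minimal_eq_smul h2 hΔ (by
    rw [twoTorsionCurve_c₄, twoTorsionCurve_Δ, mul_assoc, IsUnit.mul_iff,
      Ideal.unit_mul_mem_iff_mem _ h16, ← IsLocalRing.residue_ne_zero_iff_isUnit (a ^ 2 - 3 * b)]
    exact h₀.imp_left fun h => ⟨h16, h⟩) hCmap
  rw [twoTorsionCurve_map] at hC₁
  constructor
  · rw [Place.trace, Place.numPoints, hC₁, card_equation_variableChange, Nat.cast_add,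
      card_twoTorsionCurve hk, Nat.card_eq_fintype_card]
    push_cast
    ring
  · rw [WeierstrassCurve.hasGoodReduction_iff_isElliptic_reduction, hC₁,
      WeierstrassCurve.isElliptic_iff, WeierstrassCurve.variableChange_Δ, isUnit_iff_ne_zero,
      twoTorsionCurve_Δ]
    simp [h16k]

/-! ### The places of `F(t)` -/

namespace Place

open Polynomial

variable {F : Type*} [Field F] (v : Place F)

instance : Algebra F v.residueField := v.constHom.toAlgebra

theorem algebraMap_residueField (c : F) :
    algebraMap F v.residueField c = IsLocalRing.residue v.ring ⟨RatFunc.C c, v.const_mem c⟩ := rfl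

theorem degree_eq_finrank : v.degree = Module.finrank F v.residueField := rfl

@[ext]
protected theorem ext {v w : Place F} (h : v.ring = w.ring) : v = w := by
  cases v
  cases w
  cases h
  rfl

variable {v}

section Finite

variable (hX : RatFunc.X ∈ v.ring)

/-- The inclusion of `F[t]` in the valuation ring of a finite place. -/
def polyHom : F[X] →+* v.ring :=
  eval₂RingHom ((RatFunc.C : F →+* RatFunc F).codRestrict v.ring.toSubring v.const_mem)
    ⟨RatFunc.X, hX⟩

theorem coe_polyHom (g : F[X]) : (polyHom hX g : RatFunc F) = algebraMap F[X] (RatFunc F) g := by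
  have : (v.ring.subtype).comp (polyHom hX) = algebraMap F[X] (RatFunc F) := by
    apply Polynomial.ringHom_ext
    · intro c
      simp [polyHom]
    · simp [polyHom]
  exact DFunLike.congr_fun this g

/-- The image of `t` in the residue field of a finite place. -/
def coord : v.residueField := IsLocalRing.residue v.ring ⟨RatFunc.X, hX⟩

theorem residue_polyHom (g : F[X]) :
    IsLocalRing.residue v.ring (polyHom hX g) = aeval (coord hX) g := by
  have : (IsLocalRing.residue v.ring).comp (polyHom hX) =
      (aeval (coord hX) : F[X] →ₐ[F] v.residueField).toRingHom := by
    apply Polynomial.ringHom_ext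
    · intro c
      simp [polyHom, algebraMap_residueField]
      rfl
    · simp [polyHom, coord]
  exact DFunLike.congr_fun this g

theorem coe_polyHom_num_eq (x : RatFunc F) :
    (polyHom hX x.num : RatFunc F) = x * polyHom hX x.denom := by
  rw [coe_polyHom, coe_polyHom]
  have h : algebraMap F[X] (RatFunc F) x.denom ≠ 0 := RatFunc.algebraMap_ne_zero x.denom_ne_zero
  nth_rw 2 [← RatFunc.num_div_denom x]
  field_simp

theorem aeval_denom_ne_zero {x : RatFunc F} (hx : x ∈ v.ring) :
    aeval (coord hX) x.denom ≠ 0 := by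
  intro h
  obtain ⟨a, b, hab⟩ := RatFunc.isCoprime_num_denom x
  have h1 : polyHom hX x.num = (⟨x, hx⟩ : v.ring) * polyHom hX x.denom :=
    Subtype.ext (coe_polyHom_num_eq hX x)
  have h2 := congrArg (IsLocalRing.residue v.ring) h1
  rw [map_mul, residue_polyHom, residue_polyHom, h, mul_zero] at h2
  have h3 := congrArg (aeval (coord hX)) hab
  rw [map_add, map_mul, map_mul, h, h2, mul_zero, mul_zero, add_zero, map_one] at h3
  exact zero_ne_one h3

theorem mem_ring_iff (x : RatFunc F) : x ∈ v.ring ↔ aeval (coord hX) x.denom ≠ 0 := by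
  refine ⟨aeval_denom_ne_zero hX, fun h => ?_⟩
  rw [← residue_polyHom, IsLocalRing.residue_ne_zero_iff_isUnit] at h
  obtain ⟨u, hu⟩ := h
  have : x = (polyHom hX x.num * ((u⁻¹ : v.ringˣ) : v.ring) : v.ring) := by
    have h1 : ((u : v.ring) : RatFunc F) * ((u⁻¹ : v.ringˣ) : v.ring) = 1 := by
      exact_mod_cast congrArg Subtype.val (Units.mul_inv u)
    have h2 := coe_polyHom_num_eq hX x
    rw [← hu] at h2
    push_cast
    rw [h2]
    linear_combination -x * h1
  rw [this]
  exact Subtype.mem _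

theorem residue_eq (x : v.ring) : IsLocalRing.residue v.ring x =
    aeval (coord hX) (x : RatFunc F).num / aeval (coord hX) (x : RatFunc F).denom := by
  rw [eq_div_iff (aeval_denom_ne_zero hX x.2), ← residue_polyHom, ← residue_polyHom, ← map_mul]
  congr 1
  exact Subtype.ext (coe_polyHom_num_eq hX x).symm

theorem isIntegral_coord : IsIntegral F (coord hX) := by
  obtain ⟨ϖ, hϖ⟩ := IsDiscreteValuationRing.exists_irreducible v.ring
  have h0 : (ϖ : RatFunc F) ≠ 0 := fun h => hϖ.ne_zero (Subtype.ext h)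
  have hm : IsLocalRing.residue v.ring ϖ = 0 := by
    rw [IsLocalRing.residue_eq_zero_iff, IsLocalRing.mem_maximalIdeal]
    exact hϖ.not_isUnit
  rw [residue_eq hX, div_eq_zero_iff, or_iff_left (aeval_denom_ne_zero hX ϖ.2)] at hm
  exact IsAlgebraic.isIntegral ⟨(ϖ : RatFunc F).num, RatFunc.num_ne_zero h0, hm⟩

theorem adjoin_coord : Algebra.adjoin F {coord hX} = ⊤ := by
  rw [eq_top_iff]
  rintro z -
  obtain ⟨x, rfl⟩ := IsLocalRing.residue_surjective z
  have hK : (Algebra.adjoin F {coord hX}) = (IntermediateField.adjoin F {coord hX}).toSubalgebra :=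
    (IntermediateField.adjoin_simple_toSubalgebra_of_isAlgebraic
      (isIntegral_coord hX).isAlgebraic).symm
  rw [hK, residue_eq hX]
  have hmem : ∀ g : F[X], aeval (coord hX) g ∈ IntermediateField.adjoin F {coord hX} := fun g =>
    IntermediateField.algebra_adjoin_le_adjoin F _ (aeval_mem_adjoin_singleton F _)
  exact (IntermediateField.mem_toSubalgebra _ _).2 (div_mem (hmem _) (hmem _))

/-- The power basis of the residue field of a finite place given by the image of `t`. -/
def powerBasis : PowerBasis F v.residueField :=
  PowerBasis.ofAdjoinEqTop (isIntegral_coord hX) (adjoin_coord hX)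

theorem powerBasis_gen : (powerBasis hX).gen = coord hX :=
  PowerBasis.ofAdjoinEqTop_gen _ _

/-- The monic irreducible polynomial of a finite place. -/
def poly : F[X] := minpoly F (coord hX)

theorem monic_poly : (poly hX).Monic := minpoly.monic (isIntegral_coord hX)

theorem irreducible_poly : Irreducible (poly hX) := minpoly.irreducible (isIntegral_coord hX)

theorem degree_eq_natDegree : v.degree = (poly hX).natDegree := by
  rw [degree_eq_finrank, (powerBasis hX).finrank, ← (powerBasis hX).natDegree_minpoly,
    powerBasis_gen, poly]

theorem finite_residueField_of_mem [Finite F] (hX : RatFunc.X ∈ v.ring) :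
    Finite v.residueField := by
  have := (powerBasis hX).finite
  exact Module.finite_of_finite F

theorem aeval_coord_eq_zero_iff (g : F[X]) : aeval (coord hX) g = 0 ↔ poly hX ∣ g :=
  ⟨fun h => minpoly.dvd F _ h, fun ⟨q, hq⟩ => by rw [hq, map_mul, poly, minpoly.aeval, zero_mul]⟩

theorem eq_of_poly_eq {w : Place F} (hX' : RatFunc.X ∈ w.ring) (h : poly hX = poly hX') :
    v = w := by
  apply Place.ext
  ext x
  rw [mem_ring_iff hX, mem_ring_iff hX', Ne, Ne, aeval_coord_eq_zero_iff, aeval_coord_eq_zero_iff,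
    h]

/-- The embedding of the residue field of a finite place given by a root of its polynomial. -/
def residueLift {L : Type*} [Field L] [Algebra F L] {τ : L} (hτ : minpoly F τ = poly hX) :
    v.residueField →ₐ[F] L :=
  (powerBasis hX).lift τ (by rw [powerBasis_gen, ← poly, ← hτ, minpoly.aeval])

theorem residueLift_coord {L : Type*} [Field L] [Algebra F L] {τ : L}
    (hτ : minpoly F τ = poly hX) : residueLift hX hτ (coord hX) = τ := by
  have h : residueLift hX hτ (powerBasis hX).gen = τ := (powerBasis hX).lift_gen τ _
  rwa [powerBasis_gen] at h

end Finite

open IsDedekindDomain in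
/-- The place attached to an irreducible polynomial. -/
def ofIrreducible {π : F[X]} (hπ : Irreducible π) : Place F where
  ring := (HeightOneSpectrum.valuation (RatFunc F)
    (⟨Ideal.span {π}, (PrincipalIdealRing.isMaximal_of_irreducible hπ).isPrime,
      by simpa using hπ.ne_zero⟩ : HeightOneSpectrum F[X])).valuationSubring
  isDVR := Valuation.valuationSubring_isDiscreteValuationRing _
  const_mem c := by
    rw [Valuation.mem_valuationSubring_iff, ← RatFunc.algebraMap_C]
    exact HeightOneSpectrum.valuation_le_one _ _

theorem X_mem_ofIrreducible {π : F[X]} (hπ : Irreducible π) :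
    RatFunc.X ∈ (ofIrreducible hπ).ring := by
  rw [ofIrreducible, Valuation.mem_valuationSubring_iff, ← RatFunc.algebraMap_X]
  exact IsDedekindDomain.HeightOneSpectrum.valuation_le_one _ _

theorem poly_ofIrreducible {π : F[X]} (hπ : Irreducible π) (hm : π.Monic) :
    poly (X_mem_ofIrreducible hπ) = π := by
  symm
  apply minpoly.eq_of_irreducible_of_monic hπ _ hm
  rw [← residue_polyHom, IsLocalRing.residue_eq_zero_iff, ValuationSubring.valuation_lt_one_iff,
    coe_polyHom]
  refine (Valuation.isEquiv_valuation_valuationSubring _).lt_one_iff_lt_one.1 ?_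
  rw [IsDedekindDomain.HeightOneSpectrum.valuation_lt_one_iff_mem]
  exact Ideal.mem_span_singleton_self π

section Infinity

theorem isTrivialOn (v : Place F) : v.ring.valuation.IsTrivialOn F := by
  constructor
  intro c hc
  have h1 : v.ring.valuation (RatFunc.C c) ≤ 1 := (v.ring.valuation_le_one_iff _).2 (v.const_mem c)
  have h2 : v.ring.valuation (RatFunc.C c⁻¹) ≤ 1 :=
    (v.ring.valuation_le_one_iff _).2 (v.const_mem _)
  rw [RatFunc.algebraMap_eq_C]
  refine le_antisymm h1 ?_
  rw [map_inv₀, map_inv₀] at h2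
  have hne : v.ring.valuation (RatFunc.C c) ≠ 0 := by
    rw [Valuation.ne_zero_iff]
    simpa using hc
  exact (inv_le_one₀ (zero_lt_iff.2 hne)).1 h2

theorem one_lt_valuation_X {v : Place F} (hX : RatFunc.X ∉ v.ring) :
    1 < v.ring.valuation (RatFunc.X : RatFunc F) := by
  rw [← not_le, v.ring.valuation_le_one_iff]
  exact hX

theorem valuation_algebraMap {v : Place F} (hX : RatFunc.X ∉ v.ring) {g : F[X]} (hg : g ≠ 0) :
    v.ring.valuation (algebraMap F[X] (RatFunc F) g) =
      v.ring.valuation (RatFunc.X : RatFunc F) ^ g.natDegree := by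
  have := v.isTrivialOn
  rw [RatFunc.valuation_eq_valuation_X_zpow_intDegree_of_one_lt_valuation_X
    (one_lt_valuation_X hX) (RatFunc.algebraMap_ne_zero hg), RatFunc.intDegree_polynomial,
    zpow_natCast]

theorem valuation_div_lt_one {v : Place F} (hX : RatFunc.X ∉ v.ring) {g h : F[X]}
    (hgh : g.degree < h.degree) :
    v.ring.valuation (algebraMap F[X] (RatFunc F) g / algebraMap F[X] (RatFunc F) h) < 1 := by
  rcases eq_or_ne g 0 with rfl | hg
  · simp
  have hlt := one_lt_valuation_X hX
  rw [map_div₀, valuation_algebraMap hX hg, valuation_algebraMap hX (ne_zero_of_degree_gt hgh),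
    div_lt_one₀ (pow_pos (zero_lt_one.trans hlt) _)]
  exact pow_lt_pow_right₀ hlt (natDegree_lt_natDegree hg hgh)

theorem mem_ring_iff_intDegree {v : Place F} (hX : RatFunc.X ∉ v.ring) (x : RatFunc F) :
    x ∈ v.ring ↔ x.intDegree ≤ 0 := by
  rcases eq_or_ne x 0 with rfl | hx
  · simp
  have := v.isTrivialOn
  rw [← v.ring.valuation_le_one_iff,
    RatFunc.valuation_eq_valuation_X_zpow_intDegree_of_one_lt_valuation_X (one_lt_valuation_X hX)
      hx]
  exact zpow_le_one_iff_right₀ (one_lt_valuation_X hX)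

theorem eq_of_X_notMem {v w : Place F} (hv : RatFunc.X ∉ v.ring) (hw : RatFunc.X ∉ w.ring) :
    v = w := by
  ext x
  rw [mem_ring_iff_intDegree hv, mem_ring_iff_intDegree hw]

open Classical in
/-- The place at infinity. -/
def infinity (F : Type*) [Field F] : Place F where
  ring := (RatFunc.inftyValuation F).valuationSubring
  isDVR := Valuation.valuationSubring_isDiscreteValuationRing _
  const_mem c := by
    rw [Valuation.mem_valuationSubring_iff]
    rcases eq_or_ne c 0 with rfl | hc
    · simp
    · rw [RatFunc.inftyValuation.C F hc]

theorem X_notMem_infinity : RatFunc.X ∉ (infinity F).ring := by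
  classical
  rw [infinity, Valuation.mem_valuationSubring_iff, RatFunc.inftyValuation.X, not_le]
  rw [← WithZero.exp_zero, WithZero.exp_lt_exp]
  exact zero_lt_one

theorem algebraMap_bijective_of_X_notMem {v : Place F} (hX : RatFunc.X ∉ v.ring) :
    Function.Bijective (algebraMap F v.residueField) := by
  refine ⟨(algebraMap F v.residueField).injective, fun z => ?_⟩
  obtain ⟨x, rfl⟩ := IsLocalRing.residue_surjective z
  set g := (x : RatFunc F).num
  set h := (x : RatFunc F).denom
  have hh : h.Monic := RatFunc.monic_denom _
  -- The quotient of `g` by `h` is a constant `c`, and the remainder over `h` vanishes at infinity.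
  obtain ⟨c, hc⟩ : ∃ c, g /ₘ h = C c := by
    have hdeg : (g.natDegree : ℤ) - h.natDegree ≤ 0 := (mem_ring_iff_intDegree hX _).1 x.2
    exact ⟨_, eq_C_of_natDegree_eq_zero (by rw [natDegree_divByMonic _ hh]; omega)⟩
  have hx : (x : RatFunc F) - RatFunc.C c =
      algebraMap F[X] (RatFunc F) (g %ₘ h) / algebraMap F[X] (RatFunc F) h := by
    rw [eq_div_iff (RatFunc.algebraMap_ne_zero hh.ne_zero), modByMonic_eq_sub_mul_div g h, hc,
      map_sub, map_mul, ← RatFunc.algebraMap_C, sub_mul, mul_comm (algebraMap _ _ h)]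
    congr 1
    nth_rw 1 [← RatFunc.num_div_denom (x : RatFunc F)]
    exact div_mul_cancel₀ _ (RatFunc.algebraMap_ne_zero hh.ne_zero)
  refine ⟨c, ?_⟩
  rw [algebraMap_residueField, eq_comm, ← sub_eq_zero, ← map_sub, IsLocalRing.residue_eq_zero_iff]
  refine (v.ring.valuation_lt_one_iff _).2 ?_
  change v.ring.valuation ((x : RatFunc F) - RatFunc.C c) < 1
  rw [hx]
  exact valuation_div_lt_one hX (degree_modByMonic_lt g hh)

theorem degree_eq_one_of_X_notMem {v : Place F} (hX : RatFunc.X ∉ v.ring) : v.degree = 1 := by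
  rw [degree_eq_finrank]
  exact (LinearEquiv.finrank_eq (LinearEquiv.ofBijective (Algebra.linearMap F v.residueField)
    (algebraMap_bijective_of_X_notMem hX))).symm.trans (Module.finrank_self F)

end Infinity

end Place

/-! ### The Euler factors -/

namespace Place

open PowerSeries

theorem invOfUnit_expand (e : ℕ) (he : e ≠ 0) {A : PowerSeries ℤ} (hA : constantCoeff A = 1) :
    invOfUnit (expand e he A) 1 = expand e he (invOfUnit A 1) := by
  have hA' : constantCoeff (expand e he A) = 1 := by
    rw [← coeff_zero_eq_constantCoeff_apply, coeff_expand, if_pos (dvd_zero e), Nat.zero_div,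
      coeff_zero_eq_constantCoeff_apply, hA]
  have hinv : expand e he A * expand e he (invOfUnit A 1) = 1 := by
    rw [← map_mul, mul_invOfUnit A 1 hA, map_one]
  exact (left_inv_eq_right_inv (mul_comm (expand e he A) _ ▸ hinv) (mul_invOfUnit _ 1 hA')).symm

variable {F : Type*} [Field F] (v : Place F)

open Classical in
/-- The reciprocal of the Euler factor of `W` at `v`, as a polynomial in `T ^ deg v`. -/
def eulerDenom (W : WeierstrassCurve (RatFunc F)) : PowerSeries ℤ :=
  if (W.minimal v.ring).HasGoodReduction v.ring then
    1 - C (v.trace W) * X + C (Nat.card v.residueField : ℤ) * X ^ 2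
  else 1 - C (v.trace W) * X

theorem constantCoeff_eulerDenom (W : WeierstrassCurve (RatFunc F)) :
    constantCoeff (v.eulerDenom W) = 1 := by
  unfold eulerDenom
  split_ifs <;> simp

theorem eulerFactor_eq_expand (W : WeierstrassCurve (RatFunc F)) (he : v.degree ≠ 0) :
    v.eulerFactor W = expand v.degree he (invOfUnit (v.eulerDenom W) 1) := by
  rw [← invOfUnit_expand _ _ (v.constantCoeff_eulerDenom W), eulerFactor, eulerDenom]
  split_ifs <;> simp [expand_X, ← pow_mul, mul_comm]

theorem constantCoeff_eulerFactor (W : WeierstrassCurve (RatFunc F)) (he : v.degree ≠ 0) :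
    constantCoeff (v.eulerFactor W) = 1 := by
  rw [v.eulerFactor_eq_expand W he, ← coeff_zero_eq_constantCoeff_apply, coeff_expand,
    if_pos (dvd_zero _), Nat.zero_div, coeff_zero_eq_constantCoeff_apply, constantCoeff_invOfUnit,
    inv_one, Units.val_one]

theorem coeff_eulerFactor_eq_zero (W : WeierstrassCurve (RatFunc F)) (he : v.degree ≠ 0) {n : ℕ}
    (hn : ¬v.degree ∣ n) : coeff n (v.eulerFactor W) = 0 := by
  rw [v.eulerFactor_eq_expand W he, coeff_expand, if_neg hn]

theorem coeff_formalLogDeriv_eulerFactor (W : WeierstrassCurve (RatFunc F)) (he : v.degree ≠ 0)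
    (n : ℕ) : coeff n (formalLogDeriv (v.eulerFactor W)) = if v.degree ∣ n then
      -(v.degree * coeff (n / v.degree) (formalLogDeriv (v.eulerDenom W))) else 0 := by
  have hdenom := v.constantCoeff_eulerDenom W
  have hfactor : HasLogDeriv (v.eulerFactor W) ((v.degree : PowerSeries ℤ) *
      expand v.degree he (-formalLogDeriv (v.eulerDenom W))) := by
    rw [v.eulerFactor_eq_expand W he]
    exact ((hasLogDeriv_formalLogDeriv hdenom).of_mul_eq_one (mul_invOfUnit _ 1 hdenom)).expand _ he
  rw [hfactor.formalLogDeriv_eq (v.constantCoeff_eulerFactor W he), ← map_natCast (C (R := ℤ)),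
    coeff_C_mul, coeff_expand]
  split_ifs
  · rw [map_neg, mul_neg]
  · rw [mul_zero]

variable {v} in
theorem ReducesTo.coeff_formalLogDeriv_eulerDenom [Fintype v.residueField]
    [DecidableEq v.residueField] (hk : ringChar v.residueField ≠ 2)
    {W : WeierstrassCurve (RatFunc F)} {α β : v.residueField} (h : v.ReducesTo W α β)
    (L : Type*) [Field L] [Fintype L] [DecidableEq L] [Algebra v.residueField L] :
    coeff (Module.finrank v.residueField L) (formalLogDeriv (v.eulerDenom W)) =
      cubicSum (algebraMap v.residueField L α) (algebraMap v.residueField L β) := by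
  have hdenom := v.constantCoeff_eulerDenom W
  by_cases hgood : (W.minimal v.ring).HasGoodReduction v.ring
  · have hlog : HasLogDeriv (v.eulerDenom W) (monicLogDeriv (cubicChar α β)) := by
      rw [eulerDenom, if_pos hgood, h.trace_eq, Nat.card_eq_fintype_card]
      exact hasLogDeriv_cubicChar hk (h.hasGoodReduction_iff.1 hgood).1
        (h.hasGoodReduction_iff.1 hgood).2
    rw [hlog.formalLogDeriv_eq hdenom, coeff_finrank_monicLogDeriv_cubicChar hk]
  · have hlog : HasLogDeriv (v.eulerDenom W) (1 - PowerSeries.mk ((-cubicSum α β) ^ ·)) := by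
      rw [eulerDenom, if_neg hgood, h.trace_eq]
      exact hasLogDeriv_one_sub _
    have hsing : β = 0 ∨ α ^ 2 - 4 * β = 0 := by
      by_contra! hne
      exact hgood (h.hasGoodReduction_iff.2 hne)
    have : Module.Finite v.residueField L := Module.Finite.of_finite
    rw [hlog.formalLogDeriv_eq hdenom, map_sub, coeff_one, if_neg Module.finrank_pos.ne', coeff_mk,
      zero_sub, cubicSum_algebraMap_of_singular hk hsing]

end Place

section CurveE

variable {F : Type*} [Field F] {d : ℕ}

theorem X_pow_add_ne_zero (hd : d ≠ 0) (c : F) :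
    (RatFunc.X : RatFunc F) ^ d + RatFunc.C c ≠ 0 := by
  simpa using RatFunc.algebraMap_ne_zero (K := F)
    (Polynomial.X_pow_add_C_ne_zero (Nat.pos_of_ne_zero hd) c)

theorem curveE_Δ_ne_zero (hF : ringChar F ≠ 2) (hd : d ≠ 0) : (curveE F d).Δ ≠ 0 := by
  have h2 : (2 : RatFunc F) ≠ 0 := by
    rw [← map_ofNat (RatFunc.C (K := F))]
    exact (map_ne_zero _).2 (Ring.two_ne_zero hF)
  have h16 := X_pow_add_ne_zero (mul_ne_zero two_ne_zero hd) (16 : F)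
  rw [map_ofNat] at h16
  have hΔ : (curveE F d).Δ = 2 ^ 8 * RatFunc.X ^ (6 * d) * (RatFunc.X ^ (2 * d) + 16) := by
    simp only [curveE, WeierstrassCurve.Δ, WeierstrassCurve.b₂, WeierstrassCurve.b₄,
      WeierstrassCurve.b₆, WeierstrassCurve.b₈]
    ring
  rw [hΔ]
  exact mul_ne_zero (mul_ne_zero (pow_ne_zero _ h2) (pow_ne_zero _ RatFunc.X_ne_zero)) h16

theorem smul_curveE_eq_twoTorsionCurve {u a b : RatFunc F} (hu : u ≠ 0)
    (ha : u ^ 2 * a = RatFunc.X ^ (2 * d)) (hb : u ^ 4 * b = -4 * RatFunc.X ^ (2 * d)) :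
    (⟨Units.mk0 u hu, 0, 0, 0⟩ : WeierstrassCurve.VariableChange (RatFunc F)) • curveE F d =
      twoTorsionCurve a b := by
  have ha' : a = u⁻¹ ^ 2 * RatFunc.X ^ (2 * d) := by
    rw [← ha]
    field_simp
  have hb' : b = u⁻¹ ^ 4 * (-4 * RatFunc.X ^ (2 * d)) := by
    rw [← hb]
    field_simp
  rw [WeierstrassCurve.variableChange_def, twoTorsionCurve, curveE, ha', hb']
  ext <;> simp

theorem Place.reducesTo_curveE (v : Place F) [Fintype v.residueField] [DecidableEq v.residueField]
    (hF : ringChar F ≠ 2) (hd : d ≠ 0) {u : RatFunc F} (hu : u ≠ 0) {a b : v.ring}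
    (ha : u ^ 2 * (a : RatFunc F) = RatFunc.X ^ (2 * d))
    (hb : u ^ 4 * (b : RatFunc F) = -4 * RatFunc.X ^ (2 * d))
    {α β : v.residueField} (hα : IsLocalRing.residue v.ring a = α)
    (hβ : IsLocalRing.residue v.ring b = β)
    (h₀ : α ^ 2 - 3 * β ≠ 0 ∨
      b ^ 2 * (a ^ 2 - 4 * b) ∉ IsLocalRing.maximalIdeal v.ring ^ 12) :
    v.ReducesTo (curveE F d) α β := by
  subst hα hβ
  rw [← map_ofNat (IsLocalRing.residue v.ring), ← map_pow, ← map_mul, ← map_sub] at h₀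
  exact v.reducesTo_of_smul_eq_twoTorsionCurve (by rwa [← Algebra.ringChar_eq F v.residueField])
    (curveE_Δ_ne_zero hF hd) h₀ (smul_curveE_eq_twoTorsionCurve hu ha hb)

namespace Place

variable {v : Place F}

theorem two_ne_zero_residueField (hF : ringChar F ≠ 2) : (2 : v.residueField) ≠ 0 :=
  Ring.two_ne_zero (by rwa [← Algebra.ringChar_eq F v.residueField])

theorem notMem_maximalIdeal_pow {x : v.ring} (hx : IsLocalRing.residue v.ring x ≠ 0) {n : ℕ}
    (hn : n ≠ 0) : x ∉ IsLocalRing.maximalIdeal v.ring ^ n := fun h =>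
  hx ((IsLocalRing.residue_eq_zero_iff x).2 (Ideal.pow_le_self hn h))

theorem maximalIdeal_eq_span_of_coord_eq_zero (hX : RatFunc.X ∈ v.ring) (h0 : coord hX = 0) :
    IsLocalRing.maximalIdeal v.ring = Ideal.span {⟨RatFunc.X, hX⟩} := by
  refine le_antisymm (fun x hx => ?_) ?_
  · have hdenom := aeval_denom_ne_zero hX x.2
    rw [← IsLocalRing.residue_eq_zero_iff, residue_eq hX, div_eq_zero_iff, or_iff_left hdenom,
      h0, ← map_zero (algebraMap F v.residueField), Polynomial.aeval_algebraMap_apply,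
      (algebraMap F v.residueField).injective.eq_iff, Polynomial.aeval_def,
      Polynomial.eval₂_at_zero, Algebra.algebraMap_self, RingHom.id_apply,
      ← Polynomial.X_dvd_iff] at hx
    obtain ⟨g, hg⟩ := hx
    rw [← residue_polyHom, IsLocalRing.residue_ne_zero_iff_isUnit] at hdenom
    have hnum : x * polyHom hX (x : RatFunc F).denom = ⟨RatFunc.X, hX⟩ * polyHom hX g :=
      Subtype.ext <| by
        rw [MulMemClass.coe_mul, MulMemClass.coe_mul, ← coe_polyHom_num_eq hX x, hg, map_mul]
        simp [coe_polyHom]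
    rw [Ideal.mem_span_singleton]
    exact hdenom.dvd_mul_right.1 (hnum ▸ dvd_mul_right _ _)
  · rw [Ideal.span_singleton_le_iff_mem, ← IsLocalRing.residue_eq_zero_iff]
    exact h0

variable [Fintype v.residueField] [DecidableEq v.residueField]

theorem reducesTo_of_coord_ne_zero (hF : ringChar F ≠ 2) (hd : d ≠ 0) (hX : RatFunc.X ∈ v.ring)
    (h0 : coord hX ≠ 0) :
    v.ReducesTo (curveE F d) (coord hX ^ (2 * d)) (-4 * coord hX ^ (2 * d)) := by
  set s := coord hX ^ (2 * d) with hs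
  have hs0 : s ≠ 0 := pow_ne_zero _ h0
  set a : v.ring := ⟨RatFunc.X, hX⟩ ^ (2 * d) with ha
  have hra : IsLocalRing.residue v.ring a = s := by rw [ha, hs, map_pow, coord]
  have hrb : IsLocalRing.residue v.ring (-4 * a) = -4 * s := by
    rw [map_mul, map_neg, map_ofNat, hra]
  refine v.reducesTo_curveE hF hd one_ne_zero (by simp [ha])
    (show 1 ^ 4 * (-4 * RatFunc.X ^ (2 * d)) = _ by rw [one_pow, one_mul]) hra hrb ?_
  by_cases h : s = -12
  · refine Or.inr (notMem_maximalIdeal_pow ?_ (by decide))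
    have hΔ : (-4 * s) ^ 2 * (s ^ 2 - 4 * (-4 * s)) = 2 ^ 6 * s ^ 3 := by
      linear_combination 16 * s ^ 3 * h
    simp only [map_sub, map_mul, map_pow, map_neg, map_ofNat, hra, hΔ]
    exact mul_ne_zero (pow_ne_zero _ (two_ne_zero_residueField hF)) (pow_ne_zero _ hs0)
  · left
    rw [show s ^ 2 - 3 * (-4 * s) = s * (s - -12) by ring]
    exact mul_ne_zero hs0 (sub_ne_zero.2 h)

theorem reducesTo_of_coord_eq_zero_of_even (hF : ringChar F ≠ 2) (hd : d ≠ 0)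
    (hX : RatFunc.X ∈ v.ring) (h0 : coord hX = 0) (hev : Even d) :
    v.ReducesTo (curveE F d) 0 (-4) := by
  obtain ⟨e, rfl⟩ := hev
  have he : 2 * e ≠ 0 := by lia
  set a : v.ring := ⟨RatFunc.X, hX⟩ ^ (2 * e) with ha
  have hra : IsLocalRing.residue v.ring a = 0 := by rw [ha, map_pow, ← coord, h0, zero_pow he]
  have hrb : IsLocalRing.residue v.ring (-4) = -4 := by rw [map_neg, map_ofNat]
  refine v.reducesTo_curveE hF hd (u := RatFunc.X ^ e) (pow_ne_zero _ RatFunc.X_ne_zero)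
    (show (RatFunc.X ^ e) ^ 2 * RatFunc.X ^ (2 * e) = _ by ring)
    (show (RatFunc.X ^ e) ^ 4 * -4 = _ by ring) hra hrb
    (Or.inr (notMem_maximalIdeal_pow ?_ (by decide)))
  have hΔ : ((-4) ^ 2 * (0 ^ 2 - 4 * -4) : v.residueField) = 2 ^ 8 := by norm_num
  simp only [map_sub, map_mul, map_pow, map_ofNat, hra, hrb, hΔ]
  exact pow_ne_zero _ (two_ne_zero_residueField hF)

theorem reducesTo_of_coord_eq_zero_of_odd (hF : ringChar F ≠ 2) (hX : RatFunc.X ∈ v.ring)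
    (h0 : coord hX = 0) (hodd : Odd d) : v.ReducesTo (curveE F d) 0 0 := by
  obtain ⟨e, rfl⟩ := hodd
  set t : v.ring := ⟨RatFunc.X, hX⟩ with ht
  have ht0 : t ≠ 0 := fun h => RatFunc.X_ne_zero (congrArg Subtype.val h)
  have hrt : IsLocalRing.residue v.ring t = 0 := h0
  have hra : IsLocalRing.residue v.ring (t ^ (2 * e + 2)) = 0 := by
    rw [map_pow, hrt, zero_pow (by lia)]
  have hrb : IsLocalRing.residue v.ring (-4 * t ^ 2) = 0 := by
    rw [map_mul, map_pow, hrt, zero_pow two_ne_zero, mul_zero]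
  refine v.reducesTo_curveE hF (2 * e).succ_ne_zero (u := RatFunc.X ^ e)
    (pow_ne_zero _ RatFunc.X_ne_zero)
    (show (RatFunc.X ^ e) ^ 2 * RatFunc.X ^ (2 * e + 2) = RatFunc.X ^ (2 * (2 * e + 1)) by ring)
    (show ((RatFunc.X : RatFunc F) ^ e) ^ 4 * (-4 * RatFunc.X ^ 2) =
      -4 * RatFunc.X ^ (2 * (2 * e + 1)) by ring) hra hrb (Or.inr ?_)
  rw [maximalIdeal_eq_span_of_coord_eq_zero hX h0, Ideal.span_singleton_pow,
    Ideal.mem_span_singleton, ← ht]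
  rintro ⟨c, hc⟩
  have hdvd : 16 * (t ^ (4 * e + 2) + 16) = t ^ 6 * c := by
    apply mul_left_cancel₀ (pow_ne_zero 6 ht0)
    linear_combination hc
  have hres := congrArg (IsLocalRing.residue v.ring) hdvd
  simp only [map_mul, map_add, map_pow, map_ofNat, hrt] at hres
  rw [zero_pow (Nat.succ_ne_zero _), zero_pow (by decide), zero_mul, zero_add] at hres
  apply pow_ne_zero 8 (two_ne_zero_residueField (v := v) hF)
  rw [← hres]
  norm_num

theorem reducesTo_of_X_notMem (hF : ringChar F ≠ 2) (hd : d ≠ 0) (hX : RatFunc.X ∉ v.ring) :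
    v.ReducesTo (curveE F d) 1 0 := by
  have hX0 : (RatFunc.X : RatFunc F) ≠ 0 := RatFunc.X_ne_zero
  have hlt : v.ring.valuation (RatFunc.X⁻¹ : RatFunc F) < 1 := by
    rw [map_inv₀]
    exact inv_lt_one_of_one_lt₀ (one_lt_valuation_X hX)
  have hmem : (RatFunc.X⁻¹ : RatFunc F) ∈ v.ring := (v.ring.valuation_le_one_iff _).1 hlt.le
  set b : v.ring := -4 * ⟨RatFunc.X⁻¹, hmem⟩ ^ (2 * d)
  have hrb : IsLocalRing.residue v.ring b = 0 := by
    rw [IsLocalRing.residue_eq_zero_iff]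
    exact Ideal.mul_mem_left _ _ (Ideal.pow_mem_of_mem _ ((v.ring.valuation_lt_one_iff _).2 hlt) _
      (by lia))
  have hXd : (RatFunc.X : RatFunc F) ^ (2 * d) * RatFunc.X⁻¹ ^ (2 * d) = 1 := by
    rw [← mul_pow, mul_inv_cancel₀ hX0, one_pow]
  refine v.reducesTo_curveE hF hd (u := RatFunc.X ^ d) (pow_ne_zero _ hX0)
    (show (RatFunc.X ^ d) ^ 2 * 1 = _ by ring)
    (show ((RatFunc.X : RatFunc F) ^ d) ^ 4 * (-4 * RatFunc.X⁻¹ ^ (2 * d)) =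
      -4 * RatFunc.X ^ (2 * d) by linear_combination -4 * RatFunc.X ^ (2 * d) * hXd)
    (map_one _) hrb (Or.inl ?_)
  simp

end Place

end CurveE

/-! ### The logarithmic derivative of the `L`-function -/

namespace Place

open PowerSeries

variable {F : Type*} [Field F] {v : Place F}

open Classical in
/-- The place attached to an irreducible polynomial; it is the place at infinity for all other
polynomials. -/
def ofPolynomial (π : Polynomial F) : Place F :=
  if h : Irreducible π then ofIrreducible h else infinity F

theorem X_mem_ofPolynomial {π : Polynomial F} (h : Irreducible π) :
    RatFunc.X ∈ (ofPolynomial π).ring := by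
  rw [ofPolynomial, dif_pos h]
  exact X_mem_ofIrreducible h

theorem poly_ofPolynomial {π : Polynomial F} (h : Irreducible π) (hm : π.Monic) :
    poly (X_mem_ofPolynomial h) = π := by
  have hπ : ofPolynomial π = ofIrreducible h := dif_pos h
  simp only [hπ, poly_ofIrreducible h hm]

theorem degree_ofPolynomial {π : Polynomial F} (h : Irreducible π) (hm : π.Monic) :
    (ofPolynomial π).degree = π.natDegree := by
  rw [degree_eq_natDegree (X_mem_ofPolynomial h), poly_ofPolynomial h hm]

theorem exists_reducesTo_fiberSum [Fintype v.residueField] [DecidableEq v.residueField]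
    (hF : ringChar F ≠ 2) {d : ℕ} (hd : d ≠ 0) (hX : RatFunc.X ∈ v.ring) {L : Type*} [Field L]
    [Fintype L] [DecidableEq L] (φ : v.residueField →+* L) :
    ∃ α β : v.residueField, v.ReducesTo (curveE F d) α β ∧
      cubicSum (φ α) (φ β) = fiberSum d (φ (coord hX)) := by
  by_cases h0 : coord hX = 0
  · rw [fiberSum, if_pos (by rw [h0, map_zero])]
    rcases Nat.even_or_odd d with hev | hodd
    · refine ⟨_, _, reducesTo_of_coord_eq_zero_of_even hF hd hX h0 hev, ?_⟩
      rw [if_pos hev, map_zero, map_neg, map_ofNat]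
    · have hL : ringChar L ≠ 2 := by
        let _ : Algebra v.residueField L := φ.toAlgebra
        rwa [← Algebra.ringChar_eq v.residueField L, ← Algebra.ringChar_eq F v.residueField]
      refine ⟨_, _, reducesTo_of_coord_eq_zero_of_odd hF hX h0 hodd, ?_⟩
      rw [if_neg (Nat.not_even_iff_odd.2 hodd), map_zero, cubicSum_zero_right hL,
        MulChar.map_zero, neg_zero]
  · refine ⟨_, _, reducesTo_of_coord_ne_zero hF hd hX h0, ?_⟩
    rw [fiberSum, if_neg (by rwa [_root_.map_eq_zero]), map_pow, map_mul, map_neg, map_ofNat,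
      map_pow]

variable [Finite F]

theorem finite_residueField (v : Place F) : Finite v.residueField := by
  by_cases hX : RatFunc.X ∈ v.ring
  · exact finite_residueField_of_mem hX
  · exact Finite.of_surjective _ (algebraMap_bijective_of_X_notMem hX).2

theorem degree_ne_zero (v : Place F) : v.degree ≠ 0 := by
  have := v.finite_residueField
  have : Module.Finite F v.residueField := Module.Finite.of_finite
  rw [degree_eq_finrank]
  exact Module.finrank_pos.ne'

theorem coeff_formalLogDeriv_eulerDenom_curveE (hF : ringChar F ≠ 2) {d : ℕ} (hd : d ≠ 0)
    (hX : RatFunc.X ∈ v.ring) {L : Type*} [Field L] [Fintype L] [DecidableEq L] [Algebra F L]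
    {τ : L} (hτ : minpoly F τ = poly hX) :
    coeff (Module.finrank F L / v.degree) (formalLogDeriv (v.eulerDenom (curveE F d))) =
      fiberSum d τ := by
  classical
  have := v.finite_residueField
  have := Fintype.ofFinite v.residueField
  let φ := residueLift hX hτ
  let _ : Algebra v.residueField L := φ.toRingHom.toAlgebra
  have : IsScalarTower F v.residueField L :=
    IsScalarTower.of_algebraMap_eq fun c => (φ.commutes c).symm
  obtain ⟨α, β, hαβ, hsum⟩ := exists_reducesTo_fiberSum hF hd hX φ.toRingHom
  rw [show φ.toRingHom (coord hX) = τ from residueLift_coord hX hτ] at hsum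
  rw [← Module.finrank_mul_finrank F v.residueField L, ← degree_eq_finrank,
    Nat.mul_div_cancel_left _ (Nat.pos_of_ne_zero v.degree_ne_zero), ← hsum]
  exact hαβ.coeff_formalLogDeriv_eulerDenom (by rwa [← Algebra.ringChar_eq F v.residueField]) L

theorem coeff_formalLogDeriv_eulerFactor_curveE_of_X_notMem (hF : ringChar F ≠ 2) {d : ℕ}
    (hd : d ≠ 0) (hX : RatFunc.X ∉ v.ring) (L : Type*) [Field L] [Finite L] [Algebra F L] :
    coeff (Module.finrank F L) (formalLogDeriv (v.eulerFactor (curveE F d))) = 1 := by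
  classical
  have := Fintype.ofFinite L
  have := v.finite_residueField
  have := Fintype.ofFinite v.residueField
  let e := RingEquiv.ofBijective (algebraMap F v.residueField)
    (algebraMap_bijective_of_X_notMem hX)
  let _ : Algebra v.residueField L := ((algebraMap F L).comp e.symm.toRingHom).toAlgebra
  have : IsScalarTower F v.residueField L := IsScalarTower.of_algebraMap_eq fun c => by
    change algebraMap F L c = algebraMap F L (e.symm (e c))
    rw [e.symm_apply_apply]
  have hdenom := (reducesTo_of_X_notMem hF hd hX).coeff_formalLogDeriv_eulerDenom
    (by rwa [← Algebra.ringChar_eq F v.residueField]) L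
  rw [map_one, map_zero, cubicSum_zero_right (by rwa [← Algebra.ringChar_eq F L]), map_one]
    at hdenom
  rw [v.coeff_formalLogDeriv_eulerFactor _ v.degree_ne_zero,
    ← Module.finrank_mul_finrank F v.residueField L, ← degree_eq_finrank,
    if_pos (dvd_mul_right _ _), Nat.mul_div_cancel_left _ (Nat.pos_of_ne_zero v.degree_ne_zero),
    hdenom, degree_eq_one_of_X_notMem hX, Nat.cast_one, one_mul, neg_neg]

open Classical in
variable (F) in
/-- The places of degree at most `N`, together with the place at infinity. -/
def upTo (N : ℕ) : Finset (Place F) :=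
  insert (infinity F) ((irreduciblesUpTo F N).image ofPolynomial)

theorem mem_upTo {N : ℕ} (h : v.degree ≤ N) : v ∈ upTo F N := by
  classical
  rw [upTo, Finset.mem_insert, Finset.mem_image]
  by_cases hX : RatFunc.X ∈ v.ring
  · refine Or.inr ⟨poly hX, ?_, ?_⟩
    · rw [mem_irreduciblesUpTo, ← degree_eq_natDegree hX]
      exact ⟨monic_poly hX, irreducible_poly hX, h⟩
    · exact eq_of_poly_eq (X_mem_ofPolynomial (irreducible_poly hX)) hX
        (poly_ofPolynomial (irreducible_poly hX) (monic_poly hX))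
  · exact Or.inl (eq_of_X_notMem hX X_notMem_infinity)

theorem upTo_mono {n N : ℕ} (hn : n ≤ N) : upTo F n ⊆ upTo F N := by
  classical
  refine Finset.insert_subset_insert _ (Finset.image_subset_image fun π hπ => ?_)
  rw [mem_irreduciblesUpTo] at hπ ⊢
  exact ⟨hπ.1, hπ.2.1, hπ.2.2.trans hn⟩

theorem sum_upTo {M : Type*} [AddCommMonoid M] (N : ℕ) (g : Place F → M) :
    ∑ v ∈ upTo F N, g v = g (infinity F) + ∑ π ∈ irreduciblesUpTo F N, g (ofPolynomial π) := by
  classical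
  rw [upTo, Finset.sum_insert, Finset.sum_image]
  · intro π hπ ρ hρ h
    rw [Finset.mem_coe, mem_irreduciblesUpTo] at hπ hρ
    rw [← poly_ofPolynomial hπ.2.1 hπ.1, ← poly_ofPolynomial hρ.2.1 hρ.1]
    congr!
  · rw [Finset.mem_image]
    rintro ⟨π, hπ, h⟩
    rw [mem_irreduciblesUpTo] at hπ
    exact X_notMem_infinity (h ▸ X_mem_ofPolynomial hπ.2.1)

theorem X_pow_dvd_eulerFactor_sub_one (W : WeierstrassCurve (RatFunc F)) {N : ℕ}
    (hN : N < v.degree) : (X : PowerSeries ℤ) ^ (N + 1) ∣ v.eulerFactor W - 1 := by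
  rw [X_pow_dvd_iff]
  intro m hm
  rw [map_sub, coeff_one]
  split_ifs with h0
  · rw [h0, coeff_zero_eq_constantCoeff_apply, v.constantCoeff_eulerFactor W v.degree_ne_zero,
      sub_self]
  · rw [v.coeff_eulerFactor_eq_zero W v.degree_ne_zero, sub_zero]
    exact fun hdvd => by have := Nat.le_of_dvd (Nat.pos_of_ne_zero h0) hdvd; lia

theorem coeff_prod_eulerFactor_eq (W : WeierstrassCurve (RatFunc F)) {N n : ℕ} (hn : n ≤ N)
    {T : Finset (Place F)} (hT : upTo F N ⊆ T) :
    coeff n (∏ v ∈ T, v.eulerFactor W) = coeff n (∏ v ∈ upTo F N, v.eulerFactor W) := by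
  classical
  have htail : (X : PowerSeries ℤ) ^ (N + 1) ∣ (∏ v ∈ T \ upTo F N, v.eulerFactor W) - 1 := by
    refine Finset.prod_induction _ (fun A => X ^ (N + 1) ∣ A - 1) (fun A B hA hB => ?_) (by simp)
      fun v hv => X_pow_dvd_eulerFactor_sub_one W ?_
    · rw [show A * B - 1 = A * (B - 1) + (A - 1) by ring]
      exact dvd_add (hB.mul_left _) hA
    · exact not_le.1 fun h => (Finset.mem_sdiff.1 hv).2 (mem_upTo h)
  obtain ⟨B, hB⟩ := htail
  rw [← Finset.prod_sdiff hT, sub_eq_iff_eq_add.1 hB, add_mul, one_mul, map_add, mul_assoc,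
    coeff_X_pow_mul', if_neg (by lia), zero_add]

theorem hasProd_eulerFactor (W : WeierstrassCurve (RatFunc F)) :
    HasProd (fun v : Place F => v.eulerFactor W)
      (PowerSeries.mk fun n => coeff n (∏ v ∈ upTo F n, v.eulerFactor W)) := by
  rw [HasProd, SummationFilter.unconditional_filter,
    PowerSeries.WithPiTopology.tendsto_iff_coeff_tendsto]
  intro n
  rw [coeff_mk]
  refine tendsto_const_nhds.congr' ?_
  filter_upwards [Filter.eventually_ge_atTop (upTo F n)] with T hT
  exact (coeff_prod_eulerFactor_eq W le_rfl hT).symm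

end Place

open PowerSeries

variable {F : Type*} [Field F] [Finite F]

theorem coeff_LFunction (W : WeierstrassCurve (RatFunc F)) {n N : ℕ} (hn : n ≤ N) :
    coeff n (LFunction W) = coeff n (∏ v ∈ Place.upTo F N, v.eulerFactor W) := by
  rw [LFunction, (Place.hasProd_eulerFactor W).tprod_eq, coeff_mk]
  exact (Place.coeff_prod_eulerFactor_eq W le_rfl (Place.upTo_mono hn)).symm

theorem sum_coeff_formalLogDeriv_eulerFactor (hF : ringChar F ≠ 2) {d : ℕ} (hd : d ≠ 0)
    {L : Type*} [Field L] [Fintype L] [DecidableEq L] [Algebra F L] {N : ℕ}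
    (hN : Module.finrank F L ≤ N) :
    ∑ v ∈ Place.upTo F N,
        coeff (Module.finrank F L) (formalLogDeriv (v.eulerFactor (curveE F d))) =
      1 - ∑ τ : L, fiberSum d τ := by
  have : Module.Finite F L := Module.Finite.of_finite
  set m := Module.finrank F L
  have hm : m ≠ 0 := Module.finrank_pos.ne'
  let φ (π : Polynomial F) : ℤ := -coeff (m / π.natDegree)
    (formalLogDeriv ((Place.ofPolynomial π).eulerDenom (curveE F d)))
  have hφ (τ : L) : φ (minpoly F τ) = -fiberSum d τ := by
    have hint : IsIntegral F τ := Algebra.IsIntegral.isIntegral τ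
    have hirr := minpoly.irreducible hint
    have hmonic := minpoly.monic hint
    simp only [φ, ← Place.degree_ofPolynomial hirr hmonic, m]
    rw [Place.coeff_formalLogDeriv_eulerDenom_curveE hF hd (Place.X_mem_ofPolynomial hirr)
      (Place.poly_ofPolynomial hirr hmonic).symm]
  have hterm {π : Polynomial F} (hπ : π ∈ irreduciblesUpTo F N) :
      coeff m (formalLogDeriv ((Place.ofPolynomial π).eulerFactor (curveE F d))) =
        if π.natDegree ∣ m then (π.natDegree : ℤ) * φ π else 0 := by
    rw [mem_irreduciblesUpTo] at hπ
    rw [Place.coeff_formalLogDeriv_eulerFactor _ _ (Place.degree_ne_zero _),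
      Place.degree_ofPolynomial hπ.2.1 hπ.1, ← mul_neg]
  have hfilter : (irreduciblesUpTo F N).filter (·.natDegree ∣ m) = irreduciblesDvd F m := by
    ext π
    rw [Finset.mem_filter, mem_irreduciblesUpTo, mem_irreduciblesDvd]
    have hle (h : π.natDegree ∣ m) := (Nat.le_of_dvd (Nat.pos_of_ne_zero hm) h).trans hN
    tauto
  rw [Place.sum_upTo, Place.coeff_formalLogDeriv_eulerFactor_curveE_of_X_notMem hF hd
    Place.X_notMem_infinity, sub_eq_add_neg, Finset.sum_congr rfl fun π hπ => hterm hπ,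
    ← Finset.sum_filter, hfilter, ← sum_minpoly_eq (L := L) φ, Finset.sum_congr rfl fun τ _ => hφ τ,
    Finset.sum_neg_distrib]

theorem LFunction_map_eq (hF : ringChar F ≠ 2) {d : ℕ} (hd : d ≠ 0) {B T : PowerSeries QBar}
    (hB : HasLogDeriv B T) (hB0 : constantCoeff B = 1)
    (h : ∀ m, m ≠ 0 → ∃ (L : Type) (_ : Field L) (_ : Fintype L) (_ : Algebra F L),
      Module.finrank F L = m ∧ coeff m T = -(Fintype.card L : QBar) -
        ∑ χ ∈ familyChars L d, charB χ) :
    (LFunction (curveE F d)).map (Int.castRingHom QBar) = B := by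
  classical
  ext N
  have hfactor (v : Place F) := v.constantCoeff_eulerFactor (curveE F d) v.degree_ne_zero
  have hA := (HasLogDeriv.prod (Place.upTo F N) fun v _ =>
    hasLogDeriv_formalLogDeriv (hfactor v)).map (Int.castRingHom QBar)
  have hA0 : constantCoeff ((∏ v ∈ Place.upTo F N, v.eulerFactor (curveE F d)).map
      (Int.castRingHom QBar)) = 1 := by
    rw [← coeff_zero_eq_constantCoeff_apply, coeff_map, coeff_zero_eq_constantCoeff_apply, map_prod,
      Finset.prod_eq_one fun v _ => hfactor v, map_one]
  rw [coeff_map, coeff_LFunction _ le_rfl, ← coeff_map]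
  refine hA.coeff_unique hB hA0 hB0 (fun m hmN => ?_) (le_refl N)
  rcases eq_or_ne m 0 with rfl | hm
  · rw [hA.coeff_zero hA0, hB.coeff_zero hB0]
  obtain ⟨L, _, _, _, rfl, hT⟩ := h m hm
  rw [hT, coeff_map, map_sum, sum_coeff_formalLogDeriv_eulerFactor hF hd hmN, eq_intCast,
    Int.cast_sub, Int.cast_sum, sum_fiberSum (by rwa [← Algebra.ringChar_eq F L])]
  push_cast
  ring

/-! ### The numbers `charB χ` in extensions -/

section Lift

variable {k : Type*} [Field k] [Fintype k]

theorem normChar_quadChar (hk : ringChar k ≠ 2) (L : Type*) [Field L] [Fintype L] [Algebra k L] :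
    normChar L (quadChar k) = quadChar L := by
  classical
  apply MulChar.ext'
  intro x
  rw [normChar_apply, quadChar_apply, quadChar_apply, ← normChar_quadraticChar hk L,
    normChar_apply]

theorem charB_normChar (hk : ringChar k ≠ 2) {χ : MulChar k QBar} (hχ : χ ^ 2 ≠ 1)
    (L : Type*) [Field L] [Fintype L] [Algebra k L] :
    charB (normChar L χ) = charB χ ^ Module.finrank k L := by
  have hχχ : χ * χ ≠ 1 := sq χ ▸ hχ
  have hprod : quadChar k * χ ^ 2 * χ⁻¹ ≠ 1 := by
    rw [sq, mul_assoc, mul_inv_cancel_right]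
    intro h
    rw [eq_inv_of_mul_eq_one_right h, quadChar_inv, quadChar_sq] at hχ
    exact hχ rfl
  have hJ := neg_jacobiSum_normChar (L := L) χ χ hχχ
  have hJ' := neg_jacobiSum_normChar (L := L) _ _ hprod
  rw [normChar_mul, normChar_quadChar hk, normChar_pow, normChar_inv] at hJ'
  have hfour : (normChar L χ ^ 2) 4 = (χ ^ 2) 4 ^ Module.finrank k L := by
    rw [← normChar_pow, normChar_apply, ← map_ofNat (algebraMap k L) 4, Algebra.norm_algebraMap,
      map_pow]
  have hneg (a b c : QBar) : a * b * c = a * -b * -c := by ring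
  rw [charB, charB, hneg _ (jacobiSum _ _), hneg _ (jacobiSum χ χ), hJ, hJ', hfour, mul_pow,
    mul_pow]

omit [Fintype k] in
theorem pow_char_pow_apply [Finite k] {R : Type*} [CommRing R] (p : ℕ) [Fact p.Prime]
    [CharP k p] (f : ℕ) (χ : MulChar k R) (x : k) :
    (χ ^ p ^ f) x = χ (iterateFrobeniusEquiv k p f x) := by
  rw [MulChar.pow_apply' _ (pow_ne_zero _ (Fact.out : p.Prime).ne_zero),
    iterateFrobeniusEquiv_apply, iterateFrobenius_def, map_pow]

theorem jacobiSum_pow_char_pow {R : Type*} [CommRing R] (p : ℕ) [Fact p.Prime] [CharP k p]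
    (f : ℕ) (χ ψ : MulChar k R) : jacobiSum (χ ^ p ^ f) (ψ ^ p ^ f) = jacobiSum χ ψ := by
  refine Fintype.sum_equiv (iterateFrobeniusEquiv k p f).toEquiv _ _ fun x => ?_
  rw [pow_char_pow_apply, pow_char_pow_apply, map_sub, map_one]
  rfl

theorem charB_pow_char_pow (p : ℕ) [Fact p.Prime] [CharP k p] (hp : p ≠ 2)
    (χ : MulChar k QBar) (f : ℕ) : charB (χ ^ p ^ f) = charB χ := by
  have hquad : quadChar k ^ p ^ f = quadChar k := by
    obtain ⟨e, he⟩ : Odd (p ^ f) := ((Fact.out : p.Prime).odd_of_ne_two hp).pow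
    rw [he, pow_succ, pow_mul, quadChar_sq, one_pow, one_mul]
  calc charB (χ ^ p ^ f)
    _ = ((χ ^ 2) ^ p ^ f) 4 * jacobiSum (χ ^ p ^ f) (χ ^ p ^ f) *
        jacobiSum ((quadChar k * χ ^ 2) ^ p ^ f) (χ⁻¹ ^ p ^ f) := by
      rw [charB, pow_right_comm, mul_pow, hquad, inv_pow, pow_right_comm χ]
    _ = charB χ := by
      rw [jacobiSum_pow_char_pow, jacobiSum_pow_char_pow, pow_char_pow_apply, map_ofNat, charB]

end Lift

/-! ### Comparison of the `L`-function with a finite product -/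

section Product

open PowerSeries

theorem constantCoeff_one_sub_C_mul_X_pow {R : Type*} [CommRing R] (b : R) {e : ℕ} (he : e ≠ 0) :
    constantCoeff (1 - C b * X ^ e) = 1 := by
  simp [he]

theorem coeff_formalLogDeriv_one_sub {R : Type*} [CommRing R] (b : R) {e m : ℕ} (he : e ≠ 0)
    (hm : m ≠ 0) :
    coeff m (formalLogDeriv (1 - C b * X ^ e)) = -if e ∣ m then e * b ^ (m / e) else 0 := by
  have hexpand : expand e he (1 - C b * X) = 1 - C b * X ^ e := by
    rw [map_sub, map_mul, map_one, expand_X, expand_C]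
  have h := (hasLogDeriv_one_sub b).expand e he
  rw [hexpand] at h
  rw [h.formalLogDeriv_eq (constantCoeff_one_sub_C_mul_X_pow b he), ← map_natCast (C (R := R)),
    coeff_C_mul, coeff_expand]
  split_ifs with hem
  · have hdiv : m / e ≠ 0 := (Nat.div_pos (Nat.le_of_dvd (Nat.pos_of_ne_zero hm) hem)
      (Nat.pos_of_ne_zero he)).ne'
    rw [map_sub, coeff_one, if_neg hdiv, coeff_mk, zero_sub, mul_neg]
  · rw [mul_zero, neg_zero]

theorem LFunction_map_eq_prod {F : Type*} [Field F] [Finite F] (hF : ringChar F ≠ 2) {d : ℕ}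
    (hd : d ≠ 0) {ι : Type*} (s : Finset ι) (b : ι → QBar) {e : ι → ℕ} (he : ∀ i ∈ s, e i ≠ 0)
    (h : ∀ m, m ≠ 0 → ∃ (L : Type) (_ : Field L) (_ : Fintype L) (_ : Algebra F L),
      Module.finrank F L = m ∧ ∑ χ ∈ familyChars L d, charB χ =
        ∑ i ∈ s, if e i ∣ m then e i * b i ^ (m / e i) else 0) :
    (LFunction (curveE F d)).map (Int.castRingHom QBar) =
      (1 - C (Nat.card F : QBar) * X) * ∏ i ∈ s, (1 - C (b i) * X ^ e i) := by
  have hprod := HasLogDeriv.prod s fun i hi =>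
    hasLogDeriv_formalLogDeriv (constantCoeff_one_sub_C_mul_X_pow (b i) (he i hi))
  refine LFunction_map_eq hF hd ((hasLogDeriv_one_sub (Nat.card F : QBar)).mul hprod) ?_
    fun m hm => ?_
  · rw [map_mul, map_prod, Finset.prod_eq_one fun i hi =>
      constantCoeff_one_sub_C_mul_X_pow (b i) (he i hi)]
    simp
  · obtain ⟨L, _, _, _, rfl, hL⟩ := h m hm
    refine ⟨L, inferInstance, inferInstance, inferInstance, rfl, ?_⟩
    rw [hL, map_add, map_sub, coeff_one, if_neg hm, coeff_mk, map_sum,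
      Finset.sum_congr rfl fun i hi => coeff_formalLogDeriv_one_sub (b i) (he i hi) hm,
      Finset.sum_neg_distrib, ← Nat.card_eq_fintype_card,
      Module.natCard_eq_pow_finrank (K := F) (V := L)]
    push_cast
    ring

end Product

/-! ### The factorization over a field with a character of order `2d` -/

section Split

variable {F : Type*} [Field F]

theorem sum_torsionChars_of_orderOf_eq {M : Type*} [AddCommMonoid M] {D : ℕ} (hD : D ≠ 0)
    {χ : MulChar F QBar} (hχ : orderOf χ = D) (L : Type*) [Field L] [Finite L] [Algebra F L]
    (g : MulChar L QBar → M) :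
    ∑ ψ ∈ torsionChars L QBar D, g ψ = ∑ n ∈ Finset.range D, g (normChar L (χ ^ n)) := by
  classical
  have hinj : Set.InjOn (fun n => normChar L (χ ^ n)) (Finset.range D) := by
    intro a ha b hb hab
    exact pow_injOn_Iio_orderOf (by simpa [hχ] using ha) (by simpa [hχ] using hb)
      (normChar_injective hab)
  have hsub : (Finset.range D).image (fun n => normChar L (χ ^ n)) ⊆ torsionChars L QBar D := by
    intro ψ hψ
    obtain ⟨n, -, rfl⟩ := Finset.mem_image.1 hψ
    rw [mem_torsionChars, ← normChar_pow, pow_right_comm, ← hχ, pow_orderOf_eq_one, one_pow,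
      normChar_one]
  have hcard : (torsionChars L QBar D).card ≤
      ((Finset.range D).image fun n => normChar L (χ ^ n)).card := by
    rw [Finset.card_image_of_injOn hinj, Finset.card_range]
    exact card_torsionChars_le hD
  rw [← Finset.eq_of_subset_of_card_le hsub hcard, Finset.sum_image hinj]

theorem sum_familyChars {M : Type*} [AddCommMonoid M] (L : Type*) [Field L] [Finite L] (d : ℕ)
    (g : MulChar L QBar → M) [DecidablePred fun χ : MulChar L QBar => χ ^ 4 = 1] :
    ∑ χ ∈ familyChars L d, g χ =
      ∑ χ ∈ torsionChars L QBar (2 * d), if χ ^ 4 = 1 then 0 else g χ := by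
  have hfilter : familyChars L d = {χ ∈ torsionChars L QBar (2 * d) | ¬χ ^ 4 = 1} := by
    ext χ
    rw [Finset.mem_filter, mem_torsionChars, mem_familyChars]
  rw [hfilter, Finset.sum_filter]
  exact Finset.sum_congr rfl fun χ _ => ite_not _ _ _

theorem dvd_four_mul_iff {d n : ℕ} (hn : n < 2 * d) :
    2 * d ∣ 4 * n ↔ n = 0 ∨ 2 * n = d ∨ n = d ∨ 2 * n = 3 * d := by
  constructor
  · rintro ⟨c, hc⟩
    have hlin : 2 * n = d * c := by linarith
    have hc4 : c < 4 := by
      by_contra! h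
      have := Nat.mul_le_mul_left d h
      omega
    interval_cases c <;> omega
  · rintro (h | h | h | h)
    · simp [h]
    · exact ⟨1, by omega⟩
    · exact ⟨2, by omega⟩
    · exact ⟨3, by omega⟩

theorem filter_Icc_eq_filter_range (d : ℕ) :
    (Finset.Icc 1 (2 * d - 1)).filter (fun n => 2 * n ≠ d ∧ n ≠ d ∧ 2 * n ≠ 3 * d) =
      (Finset.range (2 * d)).filter fun n => ¬2 * d ∣ 4 * n := by
  ext n
  rw [Finset.mem_filter, Finset.mem_filter, Finset.mem_Icc, Finset.mem_range]
  rcases lt_or_ge n (2 * d) with hn | hn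
  · rw [dvd_four_mul_iff hn]
    omega
  · omega

variable [Fintype F] {d : ℕ} {χ : MulChar F QBar}

theorem sumB_eq_charB (hF : ringChar F ≠ 2) (hd : d ≠ 0) (hχ : orderOf χ = 2 * d) (n : ℕ) :
    sumB d χ n = charB (χ ^ n) := by
  have hquad : χ ^ d = quadChar F := by
    apply eq_quadChar_of_sq_eq_one hF
    · rw [← pow_mul, mul_comm, ← hχ, pow_orderOf_eq_one]
    · exact pow_ne_one_of_lt_orderOf hd (by omega)
  rw [sumB, charB, ← hquad, jacobiSum, jacobiSum, mul_assoc, Finset.sum_mul_sum, ← pow_mul,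
    mul_comm n 2, ← pow_add, add_comm d]
  congr 1
  refine Finset.sum_congr rfl fun u _ => Finset.sum_congr rfl fun v _ => ?_
  rw [map_mul]
  ring

theorem sum_charB_familyChars_of_orderOf_eq (hF : ringChar F ≠ 2) (hd : d ≠ 0)
    (hχ : orderOf χ = 2 * d) (L : Type*) [Field L] [Fintype L] [Algebra F L] :
    ∑ ψ ∈ familyChars L d, charB ψ =
      ∑ n ∈ Finset.range (2 * d) with ¬2 * d ∣ 4 * n, sumB d χ n ^ Module.finrank F L := by
  classical
  have hfour (n : ℕ) : normChar L (χ ^ n) ^ 4 = 1 ↔ 2 * d ∣ 4 * n := by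
    rw [← normChar_pow, ← pow_mul, ← normChar_one (k := F), normChar_injective.eq_iff,
      ← orderOf_dvd_iff_pow_eq_one, hχ, mul_comm n]
  rw [sum_familyChars, sum_torsionChars_of_orderOf_eq (by omega) hχ, Finset.sum_filter]
  refine Finset.sum_congr rfl fun n _ => ?_
  simp only [hfour, ite_not]
  split_ifs with hn
  · rfl
  · rw [sumB_eq_charB hF hd hχ, charB_normChar hF]
    rw [← pow_mul, Ne, ← orderOf_dvd_iff_pow_eq_one, hχ]
    exact fun h => hn ((h.mul_left 2).trans (dvd_of_eq (by ring)))

theorem LFunction_eq_of_orderOf_eq (hF : ringChar F ≠ 2) (hd : d ≠ 0) (hχ : orderOf χ = 2 * d) :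
    (LFunction (curveE F d)).map (Int.castRingHom QBar) =
      (1 - PowerSeries.C (Nat.card F : QBar) * PowerSeries.X) *
        ∏ n ∈ (Finset.Icc 1 (2 * d - 1)).filter (fun n => 2 * n ≠ d ∧ n ≠ d ∧ 2 * n ≠ 3 * d),
          (1 - PowerSeries.C (sumB d χ n) * PowerSeries.X) := by
  rw [filter_Icc_eq_filter_range, LFunction_map_eq_prod hF hd
    ((Finset.range (2 * d)).filter fun n => ¬2 * d ∣ 4 * n) (sumB d χ) (e := 1)
    fun _ _ => one_ne_zero]
  · simp only [Pi.one_apply, pow_one]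
  intro m hm
  have : NeZero m := ⟨hm⟩
  obtain ⟨p, _⟩ := CharP.exists F
  have : Fact p.Prime := ⟨CharP.char_is_prime F p⟩
  let _ := Fintype.ofFinite (FiniteField.Extension F p m)
  refine ⟨FiniteField.Extension F p m, inferInstance, inferInstance, inferInstance,
    FiniteField.finrank_extension F p m, ?_⟩
  rw [sum_charB_familyChars_of_orderOf_eq hF hd hχ, FiniteField.finrank_extension]
  simp

end Split

/-! ### Orbits of multiplication by `q` -/

section Orbit

theorem isPeriodicPt_mul_left {q D : ℕ} (hq : q.Coprime D) (n : ZMod D) :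
    Function.IsPeriodicPt ((q : ZMod D) * ·) D.totient n := by
  have h := congrArg Units.val (ZMod.pow_totient (ZMod.unitOfCoprime q hq))
  rw [Units.val_pow_eq_pow_val, ZMod.coe_unitOfCoprime, Units.val_one] at h
  rw [Function.IsPeriodicPt, Function.IsFixedPt, mul_left_iterate_apply, h, one_mul]

variable {q D : ℕ} [NeZero D]

theorem mem_orbit {n m : ZMod D} : m ∈ orbit q n ↔ ∃ k : ℕ, m = (q : ZMod D) ^ k * n := by
  simp [orbit]

theorem self_mem_orbit (n : ZMod D) : n ∈ orbit q n := mem_orbit.2 ⟨0, by simp⟩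

theorem orbit_induction {motive : ZMod D → Prop} {n m : ZMod D} (hm : m ∈ orbit q n)
    (self : motive n) (mul : ∀ x, motive x → motive ((q : ZMod D) * x)) : motive m := by
  obtain ⟨k, rfl⟩ := mem_orbit.1 hm
  induction k with
  | zero => simpa using self
  | succ k ih =>
    rw [pow_succ', mul_assoc]
    exact mul _ (ih (mem_orbit.2 ⟨k, rfl⟩))

theorem minimalPeriod_mul_left_pos (hq : q.Coprime D) (n : ZMod D) :
    0 < Function.minimalPeriod ((q : ZMod D) * ·) n :=
  (isPeriodicPt_mul_left hq n).minimalPeriod_pos (Nat.totient_pos.2 (NeZero.pos D))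

theorem card_orbit (hq : q.Coprime D) (n : ZMod D) :
    (orbit q n).card = Function.minimalPeriod ((q : ZMod D) * ·) n := by
  classical
  set N := Function.minimalPeriod ((q : ZMod D) * ·) n with hN
  have h : orbit q n = (Finset.range N).image fun k => ((q : ZMod D) * ·)^[k] n := by
    ext m
    simp only [mem_orbit, Finset.mem_image, Finset.mem_range]
    constructor
    · rintro ⟨k, rfl⟩
      refine ⟨k % N, Nat.mod_lt _ (minimalPeriod_mul_left_pos hq n), ?_⟩
      rw [hN, Function.iterate_mod_minimalPeriod_eq, mul_left_iterate_apply]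
    · rintro ⟨k, -, rfl⟩
      exact ⟨k, mul_left_iterate_apply _ _⟩
  rw [h, Finset.card_image_of_injOn, Finset.card_range]
  intro a ha b hb hab
  exact Function.iterate_injOn_Iio_minimalPeriod (by simpa using ha) (by simpa using hb) hab

theorem card_orbit_dvd_iff (hq : q.Coprime D) (n : ZMod D) (m : ℕ) :
    (orbit q n).card ∣ m ↔ (q : ZMod D) ^ m * n = n := by
  rw [card_orbit hq, ← Function.isPeriodicPt_iff_minimalPeriod_dvd, Function.IsPeriodicPt,
    Function.IsFixedPt, mul_left_iterate_apply]

theorem orbit_eq_of_mem (hq : q.Coprime D) {n m : ZMod D} (h : m ∈ orbit q n) :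
    orbit q m = orbit q n := by
  have hsub : orbit q m ⊆ orbit q n := fun x hx => orbit_induction hx h fun y hy => by
    obtain ⟨k, rfl⟩ := mem_orbit.1 hy
    exact mem_orbit.2 ⟨k + 1, by rw [pow_succ', mul_assoc]⟩
  obtain ⟨k, rfl⟩ := mem_orbit.1 h
  have hunit : IsUnit ((q : ZMod D) ^ k) := ((ZMod.isUnit_iff_coprime _ _).2 hq).pow k
  refine Finset.eq_of_subset_of_card_le hsub (Nat.le_of_dvd (card_orbit_pos _ _) ?_)
  rw [card_orbit_dvd_iff hq, ← hunit.mul_right_inj, mul_left_comm,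
    (card_orbit_dvd_iff hq _ _).1 dvd_rfl]

theorem filter_orbit_eq (hq : q.Coprime D) {Z : Finset (ZMod D)}
    (hZ : ∀ n ∈ Z, (q : ZMod D) * n ∈ Z) {n : ZMod D} (hn : n ∈ Z) :
    Z.filter (fun x => orbit q x = orbit q n) = orbit q n := by
  ext x
  rw [Finset.mem_filter]
  exact ⟨fun hx => hx.2 ▸ self_mem_orbit x,
    fun hx => ⟨orbit_induction hx hn hZ, orbit_eq_of_mem hq hx⟩⟩

theorem sum_orbits {M : Type*} [Semiring M] (hq : q.Coprime D) {Z : Finset (ZMod D)}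
    (hZ : ∀ n ∈ Z, (q : ZMod D) * n ∈ Z) {rep : Finset (ZMod D) → ZMod D}
    (hrep : ∀ o ∈ orbits q Z, rep o ∈ o) {g : ZMod D → M}
    (hg : ∀ n, g ((q : ZMod D) * n) = g n) :
    ∑ o ∈ orbits q Z, (o.card : M) * g (rep o) = ∑ n ∈ Z, g n := by
  classical
  rw [← Finset.sum_fiberwise_of_maps_to (s := Z) (t := orbits q Z) (g := orbit q)
    (fun n hn => Finset.mem_image_of_mem _ hn)]
  refine Finset.sum_congr rfl fun o ho => ?_
  obtain ⟨n, hn, rfl⟩ := Finset.mem_image.1 ho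
  have hconst : ∀ x ∈ orbit q n, g x = g n := fun x hx =>
    orbit_induction (motive := (g · = g n)) hx rfl fun y hy => (hg y).trans hy
  rw [filter_orbit_eq hq hZ hn, Finset.sum_congr rfl hconst, Finset.sum_const, nsmul_eq_mul,
    hconst _ (hrep _ ho)]

theorem mem_and_orbit_eq_of_mem_orbits (hq : q.Coprime D) {Z : Finset (ZMod D)}
    (hZ : ∀ n ∈ Z, (q : ZMod D) * n ∈ Z) {o : Finset (ZMod D)} (ho : o ∈ orbits q Z) {n : ZMod D}
    (hn : n ∈ o) : n ∈ Z ∧ orbit q n = o := by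
  obtain ⟨a, ha, rfl⟩ := Finset.mem_image.1 ho
  exact ⟨orbit_induction hn ha hZ, orbit_eq_of_mem hq hn⟩

theorem eq_natCast_iff_val_eq {a : ℕ} (ha : a < D) (n : ZMod D) : n = (a : ZMod D) ↔ n.val = a :=
  ⟨fun h => h ▸ ZMod.val_cast_of_lt ha, fun h => by rw [← h, ZMod.natCast_zmod_val]⟩

theorem mem_indexSet {d : ℕ} [NeZero d] (n : ZMod (2 * d)) :
    n ∈ indexSet d ↔ 4 * n ≠ 0 := by
  have hd : 0 < d := NeZero.pos d
  have hfour : 4 * n = 0 ↔ 2 * d ∣ 4 * n.val := by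
    rw [← ZMod.natCast_eq_zero_iff, Nat.cast_mul, ZMod.natCast_zmod_val, Nat.cast_ofNat]
  rw [Ne, hfour, dvd_four_mul_iff (ZMod.val_lt n), indexSet]
  split_ifs with hparity
  · obtain ⟨e, rfl⟩ := hparity
    simp only [Finset.mem_compl, Finset.mem_insert, Finset.mem_singleton]
    rw [← ZMod.val_eq_zero, eq_natCast_iff_val_eq (by lia), eq_natCast_iff_val_eq (by lia),
      eq_natCast_iff_val_eq (by lia)]
    lia
  · obtain ⟨e, rfl⟩ := Nat.not_even_iff_odd.1 hparity
    simp only [Finset.mem_compl, Finset.mem_insert, Finset.mem_singleton]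
    rw [← ZMod.val_eq_zero, eq_natCast_iff_val_eq (by lia)]
    lia

theorem mul_mem_indexSet {d : ℕ} [NeZero d] (hq : q.Coprime (2 * d)) :
    ∀ n ∈ indexSet d, (q : ZMod (2 * d)) * n ∈ indexSet d := by
  intro n hn
  rw [mem_indexSet] at hn ⊢
  rw [mul_left_comm]
  exact fun h => hn (((ZMod.isUnit_iff_coprime _ _).2 hq).mul_right_eq_zero.1 h)

end Orbit

/-! ### The Teichmüller character -/

attribute [local instance] Ideal.Quotient.field

section Teichmuller

variable (p : ℕ) [hp : Fact p.Prime] (P : Ideal ZBar) [P.IsMaximal] [CharP (ZBar ⧸ P) p]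

theorem mem_finiteSubfield {m : ℕ} {x : ZBar ⧸ P} : x ∈ finiteSubfield p P m ↔ x ^ p ^ m = x := by
  simp [finiteSubfield, RingHom.mem_eqLocusField, iterateFrobenius_def]

theorem finiteSubfield_le {m n : ℕ} (h : m ∣ n) : finiteSubfield p P m ≤ finiteSubfield p P n := by
  obtain ⟨r, rfl⟩ := h
  intro x hx
  rw [mem_finiteSubfield] at hx ⊢
  induction r with
  | zero => simp
  | succ r ih => rw [Nat.mul_succ, pow_add, pow_mul, ih, hx]

theorem one_lt_prime_pow (m : ℕ) [NeZero m] : 1 < p ^ m :=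
  Nat.one_lt_pow (NeZero.ne m) hp.out.one_lt

theorem prime_pow_sub_one_pos (m : ℕ) [NeZero m] : 0 < p ^ m - 1 :=
  Nat.sub_pos_of_lt (one_lt_prime_pow p m)

theorem coprime_prime_pow_sub_one (m : ℕ) [NeZero m] : (p ^ m - 1).Coprime p :=
  .coprime_dvd_right (dvd_pow_self p (NeZero.ne m))
    ((Nat.coprime_self_sub_left (one_lt_prime_pow p m).le).2 (Nat.coprime_one_left _))

omit [CharP (ZBar ⧸ P) p] in
theorem exists_isPrimitiveRoot_primeToRoots {n : ℕ} (hn : n.Coprime p) :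
    ∃ ζ : primeToRoots p, IsPrimitiveRoot ζ n := by
  have hpos : 0 < n := Nat.pos_of_ne_zero fun h =>
    hp.out.one_lt.ne' ((Nat.coprime_zero_left p).1 (h ▸ hn))
  have : NeZero n := ⟨hpos.ne'⟩
  obtain ⟨ω, hω⟩ := HasEnoughRootsOfUnity.exists_primitiveRoot QBar n
  have hint : IsPrimitiveRoot (⟨ω, hω.isIntegral hpos⟩ : ZBar) n :=
    .of_map_of_injective (f := (integralClosure ℤ QBar).val) hω Subtype.val_injective
  have hunit := hint.isUnit_unit hpos.ne'
  exact ⟨⟨_, n, hn, hunit.pow_eq_one⟩,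
    .of_map_of_injective (f := (primeToRoots p).subtype) hunit Subtype.val_injective⟩

theorem exists_isPrimitiveRoot_finiteSubfield (m : ℕ) [NeZero m] :
    ∃ y : finiteSubfield p P m, IsPrimitiveRoot y (p ^ m - 1) := by
  obtain ⟨ζ, hζ⟩ := exists_isPrimitiveRoot_primeToRoots p (coprime_prime_pow_sub_one p m)
  have hη : IsPrimitiveRoot (reductionHom p P ζ : ZBar ⧸ P) (p ^ m - 1) :=
    IsPrimitiveRoot.coe_units_iff.2 (hζ.map_of_injective (reductionHom_injective p P))
  have hmem : (reductionHom p P ζ : ZBar ⧸ P) ∈ finiteSubfield p P m := by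
    rw [mem_finiteSubfield, ← Nat.sub_add_cancel (one_lt_prime_pow p m).le, pow_succ,
      hη.pow_eq_one, one_mul]
  exact ⟨⟨_, hmem⟩,
    .of_map_of_injective (f := (finiteSubfield p P m).subtype) hη Subtype.val_injective⟩

theorem card_finiteSubfield (m : ℕ) [NeZero m] :
    Fintype.card (finiteSubfield p P m) = p ^ m := by
  classical
  have h1 := one_lt_prime_pow p m
  have : NeZero (p ^ m - 1) := ⟨(prime_pow_sub_one_pos p m).ne'⟩
  obtain ⟨y, hy⟩ := exists_isPrimitiveRoot_finiteSubfield p P m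
  have htop : rootsOfUnity (p ^ m - 1) (finiteSubfield p P m) = ⊤ := by
    refine (Subgroup.eq_top_iff' _).2 fun u => ?_
    have hu : u ^ p ^ m = u := Units.ext (Subtype.ext ((mem_finiteSubfield p P).1 u.1.2))
    rw [mem_rootsOfUnity]
    rwa [← Nat.sub_add_cancel h1.le, pow_succ, mul_eq_right] at hu
  have hcard : Fintype.card (finiteSubfield p P m)ˣ = p ^ m - 1 := by
    rw [← Nat.card_eq_fintype_card, ← Subgroup.card_top, ← htop, hy.card_rootsOfUnity]
  rw [Fintype.card_units] at hcard
  have := Fintype.card_pos (α := finiteSubfield p P m)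
  lia

theorem card_units_finiteSubfield (m : ℕ) [NeZero m] :
    Nat.card (finiteSubfield p P m)ˣ = p ^ m - 1 := by
  rw [Nat.card_units, Nat.card_eq_fintype_card, card_finiteSubfield]

theorem teichmuller_injective_units :
    Function.Injective fun u : (ZBar ⧸ P)ˣ => teichmuller p P u := by
  have h (u : (ZBar ⧸ P)ˣ) :
      teichmuller p P u = ((((reductionEquiv p P).symm u : ZBarˣ) : ZBar) : QBar) := by
    rw [teichmuller, MulChar.ofUnitHom_coe]
    rfl
  intro u w huw
  simp only [h] at huw
  exact (reductionEquiv p P).symm.injective (Subtype.ext (Units.ext (Subtype.ext huw)))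

theorem teichmullerOn_apply (m : ℕ) (x : finiteSubfield p P m) :
    teichmullerOn p P m x = teichmuller p P (x : ZBar ⧸ P) := by
  rcases eq_or_ne x 0 with rfl | hx
  · rw [MulChar.map_zero, ZeroMemClass.coe_zero, MulChar.map_zero]
  · lift x to (finiteSubfield p P m)ˣ using hx.isUnit
    rw [teichmullerOn, MulChar.ofUnitHom_coe]
    rfl

theorem teichmullerOn_injective_units (m : ℕ) :
    Function.Injective fun u : (finiteSubfield p P m)ˣ => teichmullerOn p P m u := by
  intro u w huw
  simp only [teichmullerOn_apply] at huw
  have h := teichmuller_injective_units p P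
    (a₁ := Units.map (finiteSubfield p P m).subtype.toMonoidHom u)
    (a₂ := Units.map (finiteSubfield p P m).subtype.toMonoidHom w) huw
  exact Units.map_injective Subtype.val_injective h

theorem orderOf_teichmullerOn (m : ℕ) [NeZero m] : orderOf (teichmullerOn p P m) = p ^ m - 1 := by
  rw [← card_units_finiteSubfield p P, ← IsCyclic.exponent_eq_card, ← Nat.dvd_right_iff_eq]
  intro k
  rw [orderOf_dvd_iff_pow_eq_one, Monoid.exponent_dvd_iff_forall_pow_eq_one, MulChar.eq_one_iff]
  refine forall_congr' fun u => ?_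
  rw [MulChar.pow_apply_coe, ← map_pow, ← Units.val_pow_eq_pow_val,
    ← (teichmullerOn_injective_units p P m).eq_iff, Units.val_one, map_one]

theorem exists_eq_teichmullerOn_pow (m : ℕ) [NeZero m] (χ : MulChar (finiteSubfield p P m) QBar) :
    ∃ a < p ^ m - 1, teichmullerOn p P m ^ a = χ := by
  classical
  have hcard : Nat.card (MulChar (finiteSubfield p P m) QBar) = p ^ m - 1 := by
    rw [MulChar.card_eq_card_units_of_hasEnoughRootsOfUnity, card_units_finiteSubfield]
  have hmem : χ ∈ Submonoid.powers (teichmullerOn p P m) := by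
    rw [mem_powers_iff_mem_zpowers, Subgroup.eq_top_of_card_eq (Subgroup.zpowers _)
      (by rw [Nat.card_zpowers, orderOf_teichmullerOn, hcard])]
    exact Subgroup.mem_top χ
  rw [mem_powers_iff_mem_range_orderOf, orderOf_teichmullerOn] at hmem
  simpa using hmem

end Teichmuller

/-! ### The factorization over the orbits -/

theorem exists_algebra_finrank_eq {F L : Type*} [Field F] [Fintype F] [Field L] [Fintype L] {m : ℕ}
    (h : Fintype.card L = Fintype.card F ^ m) : ∃ _ : Algebra F L, Module.finrank F L = m := by
  obtain ⟨p, hF⟩ := CharP.exists F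
  have := Fact.mk (CharP.char_is_prime F p)
  obtain ⟨f, -, hcard⟩ := FiniteField.card F p
  have : CharP L p := charP_of_card_eq_prime_pow (f := f * m) (by rw [h, hcard, pow_mul])
  let _ : Algebra (ZMod p) F := ZMod.algebra F p
  let _ : Algebra (ZMod p) L := ZMod.algebra L p
  have hrank : Module.finrank (ZMod p) L = Module.finrank (ZMod p) F * m := by
    refine Nat.pow_right_injective (CharP.char_is_prime F p).two_le ?_
    simp only [pow_mul, FiniteField.pow_finrank_eq_card, h]
  obtain ⟨φ⟩ := FiniteField.nonempty_algHom_of_finrank_dvd (F := ZMod p) (K := F) (L := L)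
    ⟨m, hrank⟩
  let _ : Algebra F L := φ.toRingHom.toAlgebra
  refine ⟨inferInstance, Nat.pow_right_injective (Fintype.one_lt_card (α := F)) ?_⟩
  exact Module.card_eq_pow_finrank.symm.trans h

theorem charB_pow_of_algebraMap {k L : Type*} [Field k] [Fintype k] [Field L] [Fintype L]
    [Algebra k L] (hk : ringChar k ≠ 2) {θ : MulChar k QBar} {Θ : MulChar L QBar}
    (hΘ : ∀ y : k, Θ (algebraMap k L y) = θ y) {a : ℕ} (ha : (θ ^ a) ^ 2 ≠ 1) :
    charB (Θ ^ (a * ((Fintype.card L - 1) / (Fintype.card k - 1)))) =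
      charB (θ ^ a) ^ Module.finrank k L := by
  have hnorm : normChar L θ = Θ ^ ((Fintype.card L - 1) / (Fintype.card k - 1)) := by
    ext x
    rw [normChar_apply, MulChar.pow_apply_coe, ← map_pow, ← hΘ, FiniteField.algebraMap_norm_eq_pow,
      Nat.card_eq_fintype_card, Nat.card_eq_fintype_card]
  rw [← charB_normChar hk ha L, normChar_pow, hnorm, ← pow_mul, mul_comm a]

section Beta

variable (p : ℕ) [hp : Fact p.Prime] (P : Ideal ZBar) [P.IsMaximal] [CharP (ZBar ⧸ P) p]

theorem charB_teichmullerOn_pow (hp2 : p ≠ 2) {k n r : ℕ} [NeZero k] [NeZero n] (hn : n = k * r)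
    {a : ℕ} (ha : (teichmullerOn p P k ^ a) ^ 2 ≠ 1) :
    charB (teichmullerOn p P n ^ (a * ((p ^ n - 1) / (p ^ k - 1)))) =
      charB (teichmullerOn p P k ^ a) ^ r := by
  have hle := finiteSubfield_le p P (Dvd.intro r hn.symm)
  let _ : Algebra (finiteSubfield p P k) (finiteSubfield p P n) :=
    (Subfield.inclusion hle).toAlgebra
  have hchar : ringChar (finiteSubfield p P k) ≠ 2 := by
    rwa [ringChar.eq (finiteSubfield p P k) p]
  have hrestrict (y : finiteSubfield p P k) :
      teichmullerOn p P n (algebraMap _ _ y) = teichmullerOn p P k y := by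
    rw [teichmullerOn_apply, teichmullerOn_apply]
    exact congrArg (teichmuller p P) (Subring.coe_inclusion (h := hle) y)
  have hrank : Module.finrank (finiteSubfield p P k) (finiteSubfield p P n) = r := by
    refine Nat.pow_right_injective (one_lt_prime_pow p k) ?_
    simp only
    rw [← card_finiteSubfield p P k, ← Module.card_eq_pow_finrank, card_finiteSubfield,
      card_finiteSubfield, hn, pow_mul]
  have h := charB_pow_of_algebraMap hchar hrestrict ha
  rwa [card_finiteSubfield, card_finiteSubfield, hrank] at h

/-- The exponent `(q ^ m - 1) n / 2d`; the division is exact if `q ^ m n = n` in `ℤ/2dℤ`. -/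
def torsionExp (q d m : ℕ) (n : ZMod (2 * d)) : ℕ := (q ^ m - 1) * n.val / (2 * d)

theorem torsionExp_mul {q d m : ℕ} [NeZero d] (hq : 0 < q) {n : ZMod (2 * d)}
    (hn : (q : ZMod (2 * d)) ^ m * n = n) :
    torsionExp q d m n * (2 * d) = (q ^ m - 1) * n.val := by
  apply Nat.div_mul_cancel
  rw [← ZMod.natCast_eq_zero_iff, Nat.cast_mul, ZMod.natCast_zmod_val,
    Nat.cast_sub (Nat.one_le_pow _ _ hq), Nat.cast_pow, Nat.cast_one, sub_mul, hn, one_mul,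
    sub_self]

variable (f d m : ℕ)

/-- For `n` fixed by multiplication by `q ^ m`, where `q = p ^ f`, the character
`θ ^ ((q ^ m - 1) n / 2d)` of the field with `q ^ m` elements, of order dividing `2d`. For `m` the
length of the orbit of `n` this is `thetaChar`. -/
def torsionChar (n : ZMod (2 * d)) : MulChar (finiteSubfield p P (f * m)) QBar :=
  teichmullerOn p P (f * m) ^ torsionExp (p ^ f) d m n

variable [NeZero f] [NeZero d] [NeZero m]

theorem beta_eq_charB_torsionChar {n : ZMod (2 * d)} (h : (orbit (p ^ f) n).card = m) :
    beta p P f d n = charB (torsionChar p P f d m n) := by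
  subst h
  change (thetaChar p P f d n ^ 2) 4 * -_ * -_ = (thetaChar p P f d n ^ 2) 4 *
    jacobiSum (thetaChar p P f d n) (thetaChar p P f d n) *
    jacobiSum (quadChar _ * thetaChar p P f d n ^ 2) (thetaChar p P f d n)⁻¹
  ring

variable {f d m}

omit [NeZero f] [NeZero m] in
theorem torsionExp_prime_pow_mul {n : ZMod (2 * d)}
    (hn : ((p ^ f : ℕ) : ZMod (2 * d)) ^ m * n = n) :
    torsionExp (p ^ f) d m n * (2 * d) = (p ^ (f * m) - 1) * n.val := by
  rw [torsionExp_mul (pow_pos hp.out.pos f) hn, pow_mul]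

theorem torsionChar_pow_eq_one_iff {n : ZMod (2 * d)}
    (hn : ((p ^ f : ℕ) : ZMod (2 * d)) ^ m * n = n) (c : ℕ) :
    torsionChar p P f d m n ^ c = 1 ↔ (c : ZMod (2 * d)) * n = 0 := by
  have hd : 0 < 2 * d := NeZero.pos _
  have hexp : torsionExp (p ^ f) d m n * c * (2 * d) = (p ^ (f * m) - 1) * (c * n.val) := by
    rw [mul_right_comm, torsionExp_prime_pow_mul p hn, mul_assoc, mul_comm n.val]
  rw [torsionChar, ← pow_mul, ← orderOf_dvd_iff_pow_eq_one, orderOf_teichmullerOn,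
    ← Nat.mul_dvd_mul_iff_right hd, hexp,
    Nat.mul_dvd_mul_iff_left (prime_pow_sub_one_pos p (f * m)), ← ZMod.natCast_eq_zero_iff,
    Nat.cast_mul, ZMod.natCast_zmod_val]

theorem charB_torsionChar_pow (hp2 : p ≠ 2) {ℓ r : ℕ} [NeZero ℓ] (hm : m = ℓ * r)
    {n : ZMod (2 * d)} (hn : ((p ^ f : ℕ) : ZMod (2 * d)) ^ ℓ * n = n) (hne : 2 * n ≠ 0) :
    charB (torsionChar p P f d ℓ n) ^ r = charB (torsionChar p P f d m n) := by
  have hsq : torsionChar p P f d ℓ n ^ 2 ≠ 1 := by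
    rw [Ne, torsionChar_pow_eq_one_iff p P hn]
    exact_mod_cast hne
  obtain ⟨c, hc⟩ : p ^ (f * ℓ) - 1 ∣ p ^ (f * m) - 1 := by
    rw [hm, ← mul_assoc, pow_mul p (f * ℓ)]
    exact Nat.sub_one_dvd_pow_sub_one _ _
  have hexp : torsionExp (p ^ f) d ℓ n * c = torsionExp (p ^ f) d m n := by
    apply Nat.eq_of_mul_eq_mul_right (NeZero.pos (2 * d))
    have hn' : ((p ^ f : ℕ) : ZMod (2 * d)) ^ m * n = n := by
      rw [hm, pow_mul, ← mul_left_iterate_apply]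
      exact Function.iterate_fixed hn r
    rw [mul_right_comm, torsionExp_prime_pow_mul p hn, torsionExp_prime_pow_mul p hn', hc,
      mul_right_comm]
  rw [torsionChar, ← charB_teichmullerOn_pow p P hp2 (n := f * m) (by rw [hm, mul_assoc]) hsq, hc,
    Nat.mul_div_cancel_left _ (prime_pow_sub_one_pos p (f * ℓ)), hexp, torsionChar]

theorem torsionChar_pow_prime_pow {n : ZMod (2 * d)}
    (hn : ((p ^ f : ℕ) : ZMod (2 * d)) ^ m * n = n) :
    torsionChar p P f d m n ^ p ^ f = torsionChar p P f d m ((p ^ f : ℕ) * n) := by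
  have hn' : ((p ^ f : ℕ) : ZMod (2 * d)) ^ m * ((p ^ f : ℕ) * n) = (p ^ f : ℕ) * n := by
    rw [mul_left_comm, hn]
  have hval : ((p ^ f : ℕ) * n : ZMod (2 * d)).val = p ^ f * n.val % (2 * d) := by
    rw [← ZMod.val_natCast, Nat.cast_mul, ZMod.natCast_zmod_val]
  have hexp : torsionExp (p ^ f) d m n * p ^ f =
      (p ^ (f * m) - 1) * (p ^ f * n.val / (2 * d)) +
        torsionExp (p ^ f) d m ((p ^ f : ℕ) * n) := by
    apply Nat.eq_of_mul_eq_mul_right (NeZero.pos (2 * d))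
    rw [mul_right_comm, torsionExp_prime_pow_mul p hn, add_mul, torsionExp_prime_pow_mul p hn',
      hval, mul_assoc, mul_assoc, ← mul_add, Nat.div_add_mod', mul_comm n.val]
  rw [torsionChar, torsionChar, ← pow_mul, hexp, pow_add, pow_mul, ← orderOf_teichmullerOn p P,
    pow_orderOf_eq_one, one_pow, one_mul]

theorem charB_torsionChar_mul (hp2 : p ≠ 2) {n : ZMod (2 * d)}
    (hn : ((p ^ f : ℕ) : ZMod (2 * d)) ^ m * n = n) :
    charB (torsionChar p P f d m ((p ^ f : ℕ) * n)) = charB (torsionChar p P f d m n) := by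
  rw [← torsionChar_pow_prime_pow p P hn, charB_pow_char_pow p hp2]

theorem injOn_torsionChar :
    Set.InjOn (torsionChar p P f d m) {n | ((p ^ f : ℕ) : ZMod (2 * d)) ^ m * n = n} := by
  have hd : 0 < 2 * d := NeZero.pos _
  have hM := prime_pow_sub_one_pos p (f * m)
  have hlt (n : ZMod (2 * d)) (hn : ((p ^ f : ℕ) : ZMod (2 * d)) ^ m * n = n) :
      torsionExp (p ^ f) d m n < orderOf (teichmullerOn p P (f * m)) := by
    rw [orderOf_teichmullerOn, ← Nat.mul_lt_mul_right hd, torsionExp_prime_pow_mul p hn]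
    exact Nat.mul_lt_mul_of_pos_left (ZMod.val_lt n) hM
  intro a ha b hb hab
  have hexp : torsionExp (p ^ f) d m a = torsionExp (p ^ f) d m b :=
    pow_injOn_Iio_orderOf (hlt a ha) (hlt b hb) hab
  apply ZMod.val_injective
  rw [← Nat.mul_right_inj hM.ne', ← torsionExp_prime_pow_mul p ha, hexp,
    torsionExp_prime_pow_mul p hb]

theorem exists_torsionChar_eq {χ : MulChar (finiteSubfield p P (f * m)) QBar}
    (hχ : χ ^ (2 * d) = 1) : ∃ n : ZMod (2 * d),
      ((p ^ f : ℕ) : ZMod (2 * d)) ^ m * n = n ∧ torsionChar p P f d m n = χ := by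
  have hd : 0 < 2 * d := NeZero.pos _
  have hM := prime_pow_sub_one_pos p (f * m)
  obtain ⟨a, ha, rfl⟩ := exists_eq_teichmullerOn_pow p P (f * m) χ
  rw [← pow_mul, ← orderOf_dvd_iff_pow_eq_one, orderOf_teichmullerOn] at hχ
  obtain ⟨c, hc⟩ := hχ
  have hlt : c < 2 * d := by
    rw [← Nat.mul_lt_mul_left hM, ← hc]
    exact Nat.mul_lt_mul_of_pos_right ha hd
  refine ⟨c, ?_, ?_⟩
  · have h := congrArg (Nat.cast : ℕ → ZMod (2 * d)) hc
    rw [Nat.cast_mul, ZMod.natCast_self, mul_zero, Nat.cast_mul,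
      Nat.cast_sub (one_lt_prime_pow p (f * m)).le, Nat.cast_one, pow_mul, Nat.cast_pow] at h
    linear_combination -h
  · rw [torsionChar, torsionExp, ZMod.val_cast_of_lt hlt, ← pow_mul, ← hc,
      Nat.mul_div_cancel _ hd]

theorem sum_charB_familyChars :
    ∑ χ ∈ familyChars (finiteSubfield p P (f * m)) d, charB χ =
      ∑ n ∈ indexSet d, if ((p ^ f : ℕ) : ZMod (2 * d)) ^ m * n = n then
        charB (torsionChar p P f d m n) else 0 := by
  rw [← Finset.sum_filter]
  refine (Finset.sum_bij (fun n _ => torsionChar p P f d m n) ?_ ?_ ?_ fun _ _ => rfl).symm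
  · intro n hn
    rw [Finset.mem_filter, mem_indexSet] at hn
    rw [mem_familyChars, Ne, torsionChar_pow_eq_one_iff p P hn.2,
      torsionChar_pow_eq_one_iff p P hn.2, ZMod.natCast_self, zero_mul]
    exact ⟨rfl, by exact_mod_cast hn.1⟩
  · exact fun a ha b hb => injOn_torsionChar p P (Finset.mem_filter.1 ha).2
      (Finset.mem_filter.1 hb).2
  · intro χ hχ
    rw [mem_familyChars] at hχ
    obtain ⟨n, hn, rfl⟩ := exists_torsionChar_eq p P hχ.1
    have hne := mt (torsionChar_pow_eq_one_iff p P hn 4).2 hχ.2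
    exact ⟨n, Finset.mem_filter.2 ⟨(mem_indexSet n).2 (by exact_mod_cast hne), hn⟩, rfl⟩

theorem ite_charB_torsionChar_eq (hp2 : p ≠ 2) (hq : (p ^ f).Coprime (2 * d)) {n : ZMod (2 * d)}
    (hn : n ∈ indexSet d) :
    (if ((p ^ f : ℕ) : ZMod (2 * d)) ^ m * n = n then charB (torsionChar p P f d m n) else 0) =
      if (orbit (p ^ f) n).card ∣ m then beta p P f d n ^ (m / (orbit (p ^ f) n).card) else 0 := by
  have : NeZero (orbit (p ^ f) n).card := ⟨(card_orbit_pos _ n).ne'⟩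
  have hne : 2 * n ≠ 0 := fun h => (mem_indexSet n).1 hn (by linear_combination 2 * h)
  simp only [← card_orbit_dvd_iff hq]
  split_ifs with h
  · rw [beta_eq_charB_torsionChar p P f d _ rfl, charB_torsionChar_pow p P hp2
      (Nat.mul_div_cancel' h).symm ((card_orbit_dvd_iff hq n _).1 dvd_rfl) hne]
  · rfl

theorem sum_charB_familyChars_eq_sum_orbits (hp2 : p ≠ 2) (hq : (p ^ f).Coprime (2 * d))
    {rep : Finset (ZMod (2 * d)) → ZMod (2 * d)}
    (hrep : ∀ o ∈ orbits (p ^ f) (indexSet d), rep o ∈ o) :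
    ∑ χ ∈ familyChars (finiteSubfield p P (f * m)) d, charB χ =
      ∑ o ∈ orbits (p ^ f) (indexSet d),
        if o.card ∣ m then o.card * beta p P f d (rep o) ^ (m / o.card) else 0 := by
  have hunit : IsUnit ((p ^ f : ℕ) : ZMod (2 * d)) := (ZMod.isUnit_iff_coprime _ _).2 hq
  have hstable := mul_mem_indexSet hq
  rw [sum_charB_familyChars, ← sum_orbits hq hstable hrep]
  · refine Finset.sum_congr rfl fun o ho => ?_
    obtain ⟨hmem, hcard⟩ := mem_and_orbit_eq_of_mem_orbits hq hstable ho (hrep o ho)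
    rw [ite_charB_torsionChar_eq p P hp2 hq hmem, hcard, mul_ite, mul_zero]
  · intro n
    simp only [mul_left_comm _ ((p ^ f : ℕ) : ZMod (2 * d)), hunit.mul_right_inj]
    split_ifs with h
    · exact charB_torsionChar_mul p P hp2 h
    · rfl

open PowerSeries

theorem LFunction_eq_prod_orbits {F : Type*} [Field F] [Fintype F] (hF : Fintype.card F = p ^ f)
    (hp2 : p ≠ 2) (hd : d.Coprime (p ^ f)) {rep : Finset (ZMod (2 * d)) → ZMod (2 * d)}
    (hrep : ∀ o ∈ orbits (p ^ f) (indexSet d), rep o ∈ o) :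
    (LFunction (curveE F d)).map (Int.castRingHom QBar) =
      (1 - C (Nat.card F : QBar) * X) * ∏ o ∈ orbits (p ^ f) (indexSet d),
        (1 - C (beta p P f d (rep o)) * X ^ o.card) := by
  have hchar := charP_of_card_eq_prime_pow hF
  have hq : (p ^ f).Coprime (2 * d) := Nat.Coprime.mul_right
    (Nat.Coprime.pow_left _ ((Nat.coprime_primes hp.out Nat.prime_two).2 hp2)) hd.symm
  refine LFunction_map_eq_prod (by rwa [ringChar.eq F p]) (NeZero.ne d) _ _
    (fun o ho => (Finset.card_pos.2 ⟨_, hrep o ho⟩).ne') fun m hm => ?_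
  have : NeZero m := ⟨hm⟩
  obtain ⟨alg, hrank⟩ := exists_algebra_finrank_eq (F := F) (L := finiteSubfield p P (f * m))
    (by rw [card_finiteSubfield, hF, pow_mul])
  exact ⟨finiteSubfield p P (f * m), inferInstance, inferInstance, alg, hrank,
    sum_charB_familyChars_eq_sum_orbits p P hp2 hq hrep⟩

end Beta

end KummerL

end

theorem theorem3p1 {F : Type*} [Field F] [Fintype F] (p f : ℕ) [Fact p.Prime] [NeZero f]
    (hF : Fintype.card F = p ^ f) (hp : p ≠ 2) (d : ℕ) [NeZero d] (hd : d.Coprime (p ^ f)) :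
    Multipliable (fun v : KummerL.Place F => v.eulerFactor (KummerL.curveE F d)) ∧
    (∀ (P : Ideal KummerL.ZBar) [P.IsMaximal] [CharP (KummerL.ZBar ⧸ P) p]
      (rep : Finset (ZMod (2 * d)) → ZMod (2 * d)),
      (∀ o ∈ KummerL.orbits (p ^ f) (KummerL.indexSet d), rep o ∈ o) →
      (KummerL.LFunction (KummerL.curveE F d)).map (Int.castRingHom KummerL.QBar) =
        (1 - PowerSeries.C ((p : KummerL.QBar) ^ f) * PowerSeries.X) *
          ∏ o ∈ KummerL.orbits (p ^ f) (KummerL.indexSet d),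
            (1 - PowerSeries.C (KummerL.beta p P f d (rep o)) * PowerSeries.X ^ o.card)) ∧
    (∀ χ : MulChar F KummerL.QBar, 2 * d ∣ p ^ f - 1 → orderOf χ = 2 * d →
      (KummerL.LFunction (KummerL.curveE F d)).map (Int.castRingHom KummerL.QBar) =
        (1 - PowerSeries.C ((p : KummerL.QBar) ^ f) * PowerSeries.X) *
          ∏ n ∈ (Finset.Icc 1 (2 * d - 1)).filter
              (fun n => 2 * n ≠ d ∧ n ≠ d ∧ 2 * n ≠ 3 * d),
            (1 - PowerSeries.C (KummerL.sumB d χ n) * PowerSeries.X)) := by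
  have hchar := charP_of_card_eq_prime_pow hF
  have hcard : (p : KummerL.QBar) ^ f = (Nat.card F : KummerL.QBar) := by
    rw [Nat.card_eq_fintype_card, hF, Nat.cast_pow]
  rw [hcard]
  refine ⟨(KummerL.Place.hasProd_eulerFactor _).multipliable, ?_, ?_⟩
  · intro P _ _ rep hrep
    exact KummerL.LFunction_eq_prod_orbits p P hF hp hd hrep
  · intro χ _ hχ
    exact KummerL.LFunction_eq_of_orderOf_eq (by rwa [ringChar.eq F p]) (NeZero.ne d) hχ
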